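/- Let $n\ge 1$ and $\alpha\in(0,1)$. For $t>0$ and $x,y\in\mathbb R^n$ let $$P_t(x,y)=\frac1{2\pi^{(n+1)/2}}\int_0^\infty \frac{t}{s^{3/2}}\,e^{-t^2/(4s)}\,\frac{\exp\left(-\frac{|y-e^{-s}x|^2}{1-e^{-2s}}\right)}{(1-e^{-2s})^{n/2}}\,ds$$ be the Ornstein–Uhlenbeck Poisson kernel, and let $P_tf(x)=\int_{\mathbb R^n}P_t(x,y)f(y)\,dy$. For $x,y\in\mathbb R^n$ write $y=y_x+y_x'$ with $y_x$ parallel to $x$ and $y_x'$ orthogonal to $x$, except that $y_x=y$ and $y_x'=0$ if $x=0$ or $n=1$. Put $$d(x,y_x)=\bigl|\ln(1+|x|)-\operatorname{sgn}\langle x,y\rangle\,\ln(1+|y_x|)\bigr|,\qquad \operatorname{sgn}0=1,$$ which is the absolute value of the integral of $d\xi/(1+|\xi|)$ between $x$ and $y_x$ along the line through $0$ containing both. Let $f$ be a (real- or complex-valued, Lebesgue) measurable function on $\mathbb R^n$. The following are equivalent. (i) $f\in\mathrm{GGLip}_\alpha$, that is, $$\int_{\mathbb R^n}\frac{e^{-|y|^2}}{\sqrt{\ln(e+|y|)}}\,|f(y)|\,dy<\infty,$$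 and there is a constant $A>0$ such that, for all $t>0$, the derivative $\partial_tP_tf(x)$ exists for every $x$ and $$\|t\,\partial_tP_tf\|_{L^\infty(\mathbb R^n)}\le A\,t^\alpha .\tag{1}$$ (ii) There is a constant $K>0$ such that, after correction of $f$ on a null set, $$|f(x)-f(y)|\le K\min\left\{|x-y|^\alpha,\ d(x,y_x)^{\alpha/2}+|y_x'|^\alpha\right\}\qquad\text{for all }x,y\in\mathbb R^n.\tag{2}$$ Moreover, there is a constant $C>0$ depending only on $n$ and $\alpha$ such that every measurable $f$ satisfying these conditions has $$C^{-1}\,\|f\|_{\mathrm{GGLip}_\alpha}\le \inf K\le C\,\|f\|_{\mathrm{GGLip}_\alpha},$$ where $\|f\|_{\mathrm{GGLip}_\alpha}$ is the infimum of the $A>0$ satisfying (1) and $\inf K$ is the infimum of the $K>0$ for which (2) holds after correction of $f$ on a null set. -/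

import Mathlib

open MeasureTheory

noncomputable section

namespace GaussLip

/-- The Mehler kernel `M_r(x,y) = exp(-|y - r x|² / (1 - r²)) / (1 - r²)^{n/2}`, for `0 < r < 1`. -/
def mehlerKernel {n : ℕ} (r : ℝ) (x y : EuclideanSpace ℝ (Fin n)) : ℝ :=
  Real.exp (-(‖y - r • x‖ ^ 2 / (1 - r ^ 2))) / (1 - r ^ 2) ^ ((n : ℝ) / 2)

/-- The Ornstein-Uhlenbeck Poisson kernel, for `t > 0`: the Mehler kernel of the semigroup
`T_s` (with `r = e^{-s}`), subordinated with the density `t / (2 √π s^{3/2}) e^{-t²/(4s)}`. -/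
def poissonKernel {n : ℕ} (t : ℝ) (x y : EuclideanSpace ℝ (Fin n)) : ℝ :=
  1 / (2 * Real.pi ^ (((n : ℝ) + 1) / 2)) *
    ∫ s in Set.Ioi (0 : ℝ),
      t / s ^ (3 / 2 : ℝ) * Real.exp (-(t ^ 2 / (4 * s))) * mehlerKernel (Real.exp (-s)) x y

/-- The Gaussian Poisson integral `P_t f(x) = ∫ P_t(x,y) f(y) dy`. -/
def poissonIntegral {n : ℕ} {𝕜 : Type*} [RCLike 𝕜] (t : ℝ)
    (f : EuclideanSpace ℝ (Fin n) → 𝕜) (x : EuclideanSpace ℝ (Fin n)) : 𝕜 :=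
  ∫ y, poissonKernel t x y • f y

/-- The growth condition `∫ e^{-|y|²} / √(ln(e + |y|)) |f(y)| dy < ∞`. -/
def GrowthCondition {n : ℕ} {𝕜 : Type*} [RCLike 𝕜]
    (f : EuclideanSpace ℝ (Fin n) → 𝕜) : Prop :=
  Integrable (fun y : EuclideanSpace ℝ (Fin n) =>
    Real.exp (-‖y‖ ^ 2) / Real.sqrt (Real.log (Real.exp 1 + ‖y‖)) * ‖f y‖) volume

/-- `A` satisfies `‖t ∂_t P_t f‖_{L^∞} ≤ A t^α` for all `t > 0` (and the derivative exists). -/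
def PoissonLipBound {n : ℕ} {𝕜 : Type*} [RCLike 𝕜] (α : ℝ)
    (f : EuclideanSpace ℝ (Fin n) → 𝕜) (A : ℝ) : Prop :=
  ∀ t : ℝ, 0 < t →
    (∀ x, DifferentiableAt ℝ (fun s : ℝ => poissonIntegral s f x) t) ∧
    eLpNorm (fun x : EuclideanSpace ℝ (Fin n) =>
      t • deriv (fun s : ℝ => poissonIntegral s f x) t) ⊤ volume ≤ ENNReal.ofReal (A * t ^ α)

/-- Membership of a measurable function in the global Gaussian Lipschitz space. -/
def MemGGLip {n : ℕ} {𝕜 : Type*} [RCLike 𝕜] (α : ℝ)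
    (f : EuclideanSpace ℝ (Fin n) → 𝕜) : Prop :=
  GrowthCondition f ∧ ∃ A : ℝ, 0 < A ∧ PoissonLipBound α f A

/-- The norm of a function in the global Gaussian Lipschitz space. -/
def ggLipNorm {n : ℕ} {𝕜 : Type*} [RCLike 𝕜] (α : ℝ)
    (f : EuclideanSpace ℝ (Fin n) → 𝕜) : ℝ :=
  sInf {A : ℝ | 0 < A ∧ PoissonLipBound α f A}

open Classical in
/-- The component `y_x` of `y` parallel to `x`; it is `y` itself if `x = 0` or `n = 1`. -/
def parallelPart {n : ℕ} (x y : EuclideanSpace ℝ (Fin n)) : EuclideanSpace ℝ (Fin n) :=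
  if x = 0 ∨ n = 1 then y else (inner ℝ x y / ‖x‖ ^ 2) • x

/-- The component `y_x' = y - y_x` of `y` orthogonal to `x`. -/
def orthogonalPart {n : ℕ} (x y : EuclideanSpace ℝ (Fin n)) : EuclideanSpace ℝ (Fin n) :=
  y - parallelPart x y

open Classical in
/-- The sign, with the convention `sgn 0 = 1`. -/
def sgn (a : ℝ) : ℝ := if 0 ≤ a then 1 else -1

/-- `d(x, y_x) = |ln(1 + |x|) - sgn⟨x,y⟩ ln(1 + |y_x|)|`, as a function of `x` and `y`. -/
def logDist {n : ℕ} (x y : EuclideanSpace ℝ (Fin n)) : ℝ :=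
  |Real.log (1 + ‖x‖) - sgn (inner ℝ x y) * Real.log (1 + ‖parallelPart x y‖)|

/-- The function `g` satisfies the pointwise Lipschitz-type condition with constant `K`. -/
def PointwiseLip {n : ℕ} {𝕜 : Type*} [RCLike 𝕜] (α : ℝ)
    (g : EuclideanSpace ℝ (Fin n) → 𝕜) (K : ℝ) : Prop :=
  ∀ x y : EuclideanSpace ℝ (Fin n),
    ‖g x - g y‖ ≤
      K * min (‖x - y‖ ^ α) (logDist x y ^ (α / 2) + ‖orthogonalPart x y‖ ^ α)

/-- `f` satisfies the pointwise condition with constant `K` after correction on a null set. -/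
def AEPointwiseLip {n : ℕ} {𝕜 : Type*} [RCLike 𝕜] (α : ℝ)
    (f : EuclideanSpace ℝ (Fin n) → 𝕜) (K : ℝ) : Prop :=
  ∃ g : EuclideanSpace ℝ (Fin n) → 𝕜, g =ᵐ[volume] f ∧ PointwiseLip α g K

/-- The infimum of the constants in the pointwise condition. -/
def pointwiseLipConst {n : ℕ} {𝕜 : Type*} [RCLike 𝕜] (α : ℝ)
    (f : EuclideanSpace ℝ (Fin n) → 𝕜) : ℝ :=
  sInf {K : ℝ | 0 < K ∧ AEPointwiseLip α f K}

end GaussLip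

end

/-!
The Poisson semigroup `P_t` is subordinated to the Mehler semigroup
`T_r f(x) = ∫ f(e^{-r} x + √(1 - e^{-2r}) z) dγ(z)`, where `γ` is the Gauss measure: `P_t f` is the
mean of `T_r f` with respect to the Lévy density in `r`, of scale `t²`. The pointwise condition is
the modulus of continuity that `T_r` sees. Over the time `r` the drift `x ↦ e^{-r} x` moves a point
by at most `r` in the metric `d`, and the diffusion moves it by about `√r` in the Euclidean metric,
so that both contribute `r^{α/2}`, and `r^{1/2}` is of the order of `t`.

*The pointwise condition implies the derivative bound.* It gives `|T_r f - f| ≤ C K r^{α/2}`. Under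
the integral over `r` the derivative `t ∂_t` falls on the Lévy density, whose moment of order `α/2`
scales like `t^α` (`exists_hasDerivAt_integral_levyDensity`).

*The derivative bound implies the pointwise condition.* Integration in `t` yields a continuous `g`
with `|g - P_t f| ≤ (A/α) t^α`. It agrees with `f` almost everywhere: this is tested against
compactly supported `ψ`, by the symmetry of `P_t` with respect to `γ`, and the growth condition is
exactly what dominated convergence needs, since `P_t ψ(y) = O(1 / √ln (e + |y|))`
(`GrowthCondition.ae_eq_of_norm_sub_poissonIntegral_le`). The bounded functions
`h = g - P_t g`, of size `t^α`, satisfy `P_t g - P_{2t} g = P_t h`. On bounded functions `P_t`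
improves regularity: `P_t h` is Lipschitz with constant `C ‖h‖_∞ / t`, since translates of `γ` vary
in a Lipschitz way in total variation, and `(I - T_s) P_t h = O(‖h‖_∞ s / t²)`, since the shifted Lévy
density does. Summation over dyadic multiples of `t` shows that `g` is `α`-Hölder
(with `t = |x - y|`) and that `|g - T_s g| ≤ C A s^{α/2}` (with `t = √s`). The sums converge because
`α < 1`, and the remainder vanishes because `P_t g(x) - P_t g(x') → 0` as `t → ∞`, once more by the
growth condition (`GrowthCondition.tendsto_poissonIntegral_sub`). Finally
`|T_s g(x) - g(e^{-s} x)| ≤ C A s^{α/2}` by Hölder continuity, so that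
`|g(x) - g(e^{-s} x)| ≤ C A s^{α/2}`. Away from the unit ball, `d` along a ray is comparable to the
time `s` of the dilation, and inside the ball Hölder continuity is stronger.
-/

open MeasureTheory

noncomputable section

namespace GaussLip

open Set Filter Topology

/-! ### The Lévy density -/

/-- The density of the Lévy (one-sided `1/2`-stable) distribution with parameter `t`, by which the
Poisson semigroup is subordinated to the Ornstein-Uhlenbeck semigroup. Only its values at `0 < r`
are meaningful. -/
def levyDensity (t r : ℝ) : ℝ :=
  1 / (2 * √Real.pi) * (t / r ^ (3 / 2 : ℝ) * Real.exp (-(t ^ 2 / (4 * r))))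

lemma rpow_three_halves {r : ℝ} (hr : 0 < r) : r ^ (3 / 2 : ℝ) = r * √r := by
  rw [show (3 / 2 : ℝ) = 1 + 1 / 2 by norm_num, Real.rpow_add hr, Real.rpow_one, Real.sqrt_eq_rpow]

lemma levyDensity_nonneg {t r : ℝ} (ht : 0 ≤ t) (hr : 0 < r) : 0 ≤ levyDensity t r := by
  unfold levyDensity; positivity

lemma measurable_levyDensity (t : ℝ) : Measurable (levyDensity t) := by
  unfold levyDensity; fun_prop

lemma levyDensity_eq {t r : ℝ} (hr : 0 < r) :
    levyDensity t r = t / (2 * √Real.pi * (r * √r)) * Real.exp (-(t ^ 2 / (4 * r))) := by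
  rw [levyDensity, rpow_three_halves hr]
  have := Real.sqrt_pos.2 hr
  field_simp

lemma levyDensity_mul_sq {t r : ℝ} (ht : 0 < t) (hr : 0 < r) :
    levyDensity t (t ^ 2 * r) = (t ^ 2)⁻¹ * levyDensity 1 r := by
  rw [levyDensity_eq (by positivity), levyDensity_eq hr, Real.sqrt_mul (by positivity),
    Real.sqrt_sq ht.le]
  have h1 : t ^ 2 / (4 * (t ^ 2 * r)) = 1 ^ 2 / (4 * r) := by field_simp
  have := Real.sqrt_pos.2 hr
  rw [h1]
  field_simp

/-- The Lévy density is a probability density: it is the law of `(t / (2 x))²` for a variable `x`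
with density `2 π^{-1/2} e^{-x²}` on `(0, ∞)`. -/
lemma lintegral_levyDensity {t : ℝ} (ht : 0 < t) :
    ∫⁻ r in Ioi 0, ENNReal.ofReal (levyDensity t r) = 1 := by
  have hder : ∀ r ∈ Ioi (0 : ℝ), HasDerivWithinAt (fun r : ℝ => t / (2 * √r))
      (-(t / (4 * (r * √r)))) (Ioi 0) r := by
    intro r hr
    have hr' : (0 : ℝ) < r := hr
    have hs := Real.sqrt_pos.2 hr'
    have h := ((Real.hasDerivAt_sqrt hr'.ne').const_mul 2).inv (by positivity)
    have h2 := h.const_mul t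
    refine (h2.congr_deriv ?_).hasDerivWithinAt
    have : √r ^ 2 = r := Real.sq_sqrt hr'.le
    field_simp
    rw [this]; ring
  have hinj : InjOn (fun r : ℝ => t / (2 * √r)) (Ioi 0) := by
    intro a ha b hb hab
    have ha' := Real.sqrt_pos.2 (show (0 : ℝ) < a from ha)
    have hb' := Real.sqrt_pos.2 (show (0 : ℝ) < b from hb)
    have : √a = √b := by
      simp only at hab
      field_simp at hab
      linarith
    rwa [Real.sqrt_inj (le_of_lt ha) (le_of_lt hb)] at this
  have himg : (fun r : ℝ => t / (2 * √r)) '' Ioi 0 = Ioi 0 := by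
    ext x
    constructor
    · rintro ⟨r, hr, rfl⟩
      have := Real.sqrt_pos.2 (show (0 : ℝ) < r from hr)
      simp only [mem_Ioi]; positivity
    · intro hx
      have hx' : (0 : ℝ) < x := hx
      refine ⟨(t / (2 * x)) ^ 2, by simp only [mem_Ioi]; positivity, ?_⟩
      simp only
      rw [Real.sqrt_sq (by positivity)]
      field_simp
  have key := lintegral_image_eq_lintegral_abs_deriv_mul measurableSet_Ioi hder hinj
    (fun x => ENNReal.ofReal (2 / √Real.pi * Real.exp (-1 * x ^ 2)))
  rw [himg] at key
  have hpi : 0 < √Real.pi := Real.sqrt_pos.2 Real.pi_pos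
  have h1 : ∫⁻ x in Ioi (0 : ℝ), ENNReal.ofReal (2 / √Real.pi * Real.exp (-1 * x ^ 2)) = 1 := by
    rw [← ofReal_integral_eq_lintegral_ofReal, integral_const_mul, integral_gaussian_Ioi]
    · rw [div_one]
      rw [show 2 / √Real.pi * (√Real.pi / 2) = 1 by field_simp]; simp
    · exact ((integrable_exp_neg_mul_sq one_pos).const_mul _).integrableOn
    · exact Eventually.of_forall fun x => by positivity
  rw [← h1, key]
  refine setLIntegral_congr_fun measurableSet_Ioi fun r hr => ?_
  have hr' : (0 : ℝ) < r := hr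
  have hs := Real.sqrt_pos.2 hr'
  rw [← ENNReal.ofReal_mul (abs_nonneg _), abs_neg, abs_of_pos (by positivity), levyDensity_eq hr']
  congr 1
  have h3 : -1 * (t / (2 * √r)) ^ 2 = -(t ^ 2 / (4 * r)) := by
    rw [div_pow, mul_pow, Real.sq_sqrt hr'.le]; ring
  rw [h3]
  field_simp
  ring

/-- The convolution square of the Lévy density with parameter `a` is the Lévy density with
parameter `2 a`. The substitution `x = a (s - 2 r) / (2 √(s r (s - r)))` turns the convolution
integral into a Gaussian integral over the line. -/
lemma lintegral_levyDensity_conv_self {a s : ℝ} (ha : 0 < a) (hs : 0 < s) :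
    ∫⁻ r in Ioo 0 s, ENNReal.ofReal (levyDensity a r) * ENNReal.ofReal (levyDensity a (s - r)) =
      ENNReal.ofReal (levyDensity (2 * a) s) := by
  set φ : ℝ → ℝ := fun r => (s - 2 * r) / √(r * (s - r)) with hφ
  have hss := Real.sqrt_pos.2 hs
  have hder0 : ∀ r ∈ Ioo (0 : ℝ) s, HasDerivAt φ
      (-(s ^ 2 / (2 * ((r * (s - r)) * √(r * (s - r)))))) r := by
    intro r hr
    have hq : 0 < r * (s - r) := mul_pos hr.1 (by linarith [hr.2])
    have hsq := Real.sqrt_pos.2 hq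
    have h1 : HasDerivAt (fun r : ℝ => r * (s - r)) (s - 2 * r) r :=
      ((hasDerivAt_id r).mul ((hasDerivAt_id r).const_sub s)).congr_deriv (by simp; ring)
    have h2 : HasDerivAt (fun r : ℝ => s - 2 * r) (-2) r :=
      (((hasDerivAt_id r).const_mul 2).const_sub s).congr_deriv (by simp)
    refine (h2.div (h1.sqrt hq.ne') hsq.ne').congr_deriv ?_
    have h3 : √(r * (s - r)) ^ 2 = r * (s - r) := Real.sq_sqrt hq.le
    have hr1 : r ≠ 0 := hr.1.ne'
    have hr2 : s - r ≠ 0 := by linarith [hr.2]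
    rw [h3]
    field_simp
    rw [h3]
    ring
  have hder : ∀ r ∈ Ioo (0 : ℝ) s, HasDerivWithinAt φ
      (-(s ^ 2 / (2 * ((r * (s - r)) * √(r * (s - r)))))) (Ioo 0 s) r :=
    fun r hr => (hder0 r hr).hasDerivWithinAt
  have hinj : InjOn φ (Ioo 0 s) := by
    refine (strictAntiOn_of_deriv_neg (convex_Ioo 0 s)
      (fun r hr => (hder0 r hr).continuousAt.continuousWithinAt) fun r hr => ?_).injOn
    rw [interior_Ioo] at hr
    have hq : 0 < r * (s - r) := mul_pos hr.1 (by linarith [hr.2])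
    have hsq := Real.sqrt_pos.2 hq
    rw [(hder0 r hr).deriv, neg_lt_zero]
    positivity
  have himg : φ '' Ioo 0 s = univ := by
    refine eq_univ_of_forall fun y => ?_
    have hb : 0 < √(4 + y ^ 2) := Real.sqrt_pos.2 (by positivity)
    have hyb : |y| < √(4 + y ^ 2) := by
      rw [← Real.sqrt_sq_eq_abs]; exact Real.sqrt_lt_sqrt (by positivity) (by linarith)
    have hc : |y / √(4 + y ^ 2)| < 1 := by
      rwa [abs_div, abs_of_pos hb, div_lt_one hb]
    obtain ⟨hc1, hc2⟩ := abs_lt.1 hc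
    set c := y / √(4 + y ^ 2) with hcdef
    refine ⟨s / 2 * (1 - c), ⟨by nlinarith, by nlinarith⟩, ?_⟩
    have hq : s / 2 * (1 - c) * (s - s / 2 * (1 - c)) = (s / √(4 + y ^ 2)) ^ 2 := by
      have h4 : c ^ 2 = y ^ 2 / (4 + y ^ 2) := by
        rw [hcdef, div_pow, Real.sq_sqrt (by positivity)]
      rw [div_pow, Real.sq_sqrt (by positivity)]
      have : s / 2 * (1 - c) * (s - s / 2 * (1 - c)) = s ^ 2 / 4 * (1 - c ^ 2) := by ring
      rw [this, h4]
      field_simp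
      ring
    simp only [hφ]
    rw [hq, Real.sqrt_sq (by positivity), hcdef]
    field_simp
    ring
  have hpi : 0 < √Real.pi := Real.sqrt_pos.2 Real.pi_pos
  -- the Gaussian density in the variable `φ`, with the factors that do not depend on `r`
  set D : ℝ := a ^ 2 / (2 * Real.pi * s ^ 2) * Real.exp (-((2 * a) ^ 2 / (4 * s))) with hD
  have hD0 : 0 ≤ D := by positivity
  have key := lintegral_image_eq_lintegral_abs_deriv_mul measurableSet_Ioo hder hinj
    (fun x => ENNReal.ofReal (D * Real.exp (-(a ^ 2 / (4 * s)) * x ^ 2)))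
  rw [himg, Measure.restrict_univ] at key
  have h1 : ∫⁻ x, ENNReal.ofReal (D * Real.exp (-(a ^ 2 / (4 * s)) * x ^ 2)) =
      ENNReal.ofReal (levyDensity (2 * a) s) := by
    rw [← ofReal_integral_eq_lintegral_ofReal, integral_const_mul, integral_gaussian]
    · congr 1
      rw [levyDensity_eq hs, hD]
      have h5 : Real.pi / (a ^ 2 / (4 * s)) = (2 * √Real.pi * √s / a) ^ 2 := by
        rw [div_pow, mul_pow, mul_pow, Real.sq_sqrt Real.pi_pos.le, Real.sq_sqrt hs.le]
        field_simp
        ring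
      rw [h5, Real.sqrt_sq (by positivity)]
      have h6 : √Real.pi ^ 2 = Real.pi := Real.sq_sqrt Real.pi_pos.le
      have h7 : √s ^ 2 = s := Real.sq_sqrt hs.le
      field_simp
      rw [h6, h7]
    · exact (integrable_exp_neg_mul_sq (by positivity)).const_mul _
    · exact Eventually.of_forall fun x => by positivity
  rw [← h1, key]
  refine setLIntegral_congr_fun measurableSet_Ioo fun r hr => ?_
  have hr1 : 0 < r := hr.1
  have hr2 : 0 < s - r := by linarith [hr.2]
  have hq : 0 < r * (s - r) := mul_pos hr1 hr2
  have hsq := Real.sqrt_pos.2 hq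
  rw [← ENNReal.ofReal_mul (abs_nonneg _), abs_neg, abs_of_pos (by positivity),
    ← ENNReal.ofReal_mul (levyDensity_nonneg ha.le hr1), levyDensity_eq hr1, levyDensity_eq hr2]
  congr 1
  have h8 : φ r ^ 2 = (s - 2 * r) ^ 2 / (r * (s - r)) := by
    simp only [hφ]; rw [div_pow, Real.sq_sqrt hq.le]
  rw [h8, hD, Real.sqrt_mul hr1.le]
  have e1 := Real.sqrt_pos.2 hr1
  have e2 := Real.sqrt_pos.2 hr2
  have h9 : -(a ^ 2 / (4 * r)) + -(a ^ 2 / (4 * (s - r))) =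
      -((2 * a) ^ 2 / (4 * s)) + -(a ^ 2 / (4 * s)) * ((s - 2 * r) ^ 2 / (r * (s - r))) := by
    field_simp; ring
  have h10 : Real.exp (-(a ^ 2 / (4 * r))) * Real.exp (-(a ^ 2 / (4 * (s - r)))) =
      Real.exp (-((2 * a) ^ 2 / (4 * s))) *
        Real.exp (-(a ^ 2 / (4 * s)) * ((s - 2 * r) ^ 2 / (r * (s - r)))) := by
    rw [← Real.exp_add, ← Real.exp_add, h9]
  have h6 : √Real.pi * √Real.pi = Real.pi := Real.mul_self_sqrt Real.pi_pos.le
  calc _ = a ^ 2 / (4 * (√Real.pi * √Real.pi) * (r * √r) * ((s - r) * √(s - r))) *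
        (Real.exp (-(a ^ 2 / (4 * r))) * Real.exp (-(a ^ 2 / (4 * (s - r))))) := by
        field_simp; ring
    _ = _ := by rw [h10, h6]; field_simp; ring

lemma exists_pow_mul_exp_neg_div_le (k : ℕ) {c : ℝ} (hc : 0 < c) :
    ∃ C : ℝ, 0 < C ∧ ∀ r : ℝ, 0 < r → ((1 + r) / r) ^ k * Real.exp (-(c / r)) ≤ C := by
  refine ⟨k.factorial / c ^ k * Real.exp c, by positivity, fun r hr => ?_⟩
  have h := Real.pow_div_factorial_le_exp (x := c * ((1 + r) / r)) (by positivity) k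
  have h2 : c * ((1 + r) / r) = c / r + c := by field_simp
  rw [mul_pow, h2, Real.exp_add, div_le_iff₀ (by positivity)] at h
  rw [Real.exp_neg, ← div_eq_mul_inv, div_le_iff₀ (Real.exp_pos _), div_mul_eq_mul_div,
    div_mul_eq_mul_div, le_div_iff₀ (by positivity)]
  linarith

lemma one_le_one_add_div {r : ℝ} (hr : 0 < r) : 1 ≤ (1 + r) / r := by
  rw [le_div_iff₀ hr]; linarith

lemma inv_rpow_three_halves_le {r : ℝ} (hr : 0 < r) :
    1 / r ^ (3 / 2 : ℝ) ≤ (r + 1) ^ (-(3 / 2) : ℝ) * ((1 + r) / r) ^ 2 := by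
  have hu := one_le_one_add_div hr
  have h1 : 1 / r ^ (3 / 2 : ℝ) = (r + 1) ^ (-(3 / 2) : ℝ) * ((1 + r) / r) ^ (3 / 2 : ℝ) := by
    rw [Real.div_rpow (by positivity) hr.le, Real.rpow_neg (by positivity), add_comm 1 r]
    have : 0 < (r + 1) ^ (3 / 2 : ℝ) := by positivity
    field_simp
  rw [h1, ← Real.rpow_natCast ((1 + r) / r) 2]
  gcongr
  norm_num

lemma two_sqrt_pi_ge_one : 1 ≤ 2 * √Real.pi := by
  have : 1 ≤ √Real.pi := Real.one_le_sqrt.2 (by linarith [Real.pi_gt_three])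
  linarith

lemma levyDensity_le {t r : ℝ} (ht : 0 ≤ t) (hr : 0 < r) :
    levyDensity t r ≤ t * (1 / r ^ (3 / 2 : ℝ)) * Real.exp (-(t ^ 2 / (4 * r))) := by
  have h : 1 / (2 * √Real.pi) ≤ 1 := by
    rw [div_le_one (by positivity)]; exact two_sqrt_pi_ge_one
  unfold levyDensity
  calc _ ≤ 1 * (t / r ^ (3 / 2 : ℝ) * Real.exp (-(t ^ 2 / (4 * r)))) := by gcongr
    _ = _ := by ring

/-- For `t` in a compact subset of `(0, ∞)` the Lévy densities have a common majorant, which absorbs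
any power of the singularity at `r = 0`. -/
lemma exists_levyDensity_mul_pow_le (m : ℕ) {t₀ t₁ : ℝ} (ht₀ : 0 < t₀) (ht₁ : t₀ ≤ t₁) :
    ∃ C : ℝ, 0 < C ∧ ∀ t ∈ Icc t₀ t₁, ∀ r : ℝ, 0 < r →
      levyDensity t r * ((1 + r) / r) ^ m ≤ C * (r + 1) ^ (-(3 / 2) : ℝ) := by
  obtain ⟨C, hC, h⟩ := exists_pow_mul_exp_neg_div_le (m + 2) (c := t₀ ^ 2 / 4) (by positivity)
  have ht₁' : 0 < t₁ := ht₀.trans_le ht₁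
  refine ⟨t₁ * C, by positivity, fun t ht r hr => ?_⟩
  have ht0 : 0 < t := ht₀.trans_le ht.1
  calc levyDensity t r * ((1 + r) / r) ^ m
      ≤ t * (1 / r ^ (3 / 2 : ℝ)) * Real.exp (-(t ^ 2 / (4 * r))) * ((1 + r) / r) ^ m := by
        gcongr; exact levyDensity_le ht0.le hr
    _ ≤ t₁ * ((r + 1) ^ (-(3 / 2) : ℝ) * ((1 + r) / r) ^ 2) * Real.exp (-(t₀ ^ 2 / 4 / r)) *
          ((1 + r) / r) ^ m := by
        rw [div_div]
        gcongr ?_ * ?_ * Real.exp (-(?_ / (4 * r))) * _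
        · exact ht.2
        · exact inv_rpow_three_halves_le hr
        · have := ht.1
          gcongr
    _ = t₁ * (r + 1) ^ (-(3 / 2) : ℝ) *
          (((1 + r) / r) ^ (m + 2) * Real.exp (-(t₀ ^ 2 / 4 / r))) := by ring
    _ ≤ t₁ * (r + 1) ^ (-(3 / 2) : ℝ) * C := by
        gcongr
        exact h r hr
    _ = _ := by ring

lemma mul_exp_neg_sq_le (x : ℝ) : x * Real.exp (-(x ^ 2 / 8)) ≤ 2 := by
  have h := Real.add_one_le_exp (x ^ 2 / 8)
  rw [Real.exp_neg, ← div_eq_mul_inv, div_le_iff₀ (Real.exp_pos _)]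
  nlinarith [sq_nonneg (x - 2)]

/-- Bounds for the Lévy densities that are uniform in `1 ≤ t`: a majorant independent of `t`, and
decay as `t → ∞`. -/
lemma exists_levyDensity_mul_pow_le_of_one_le (m : ℕ) :
    ∃ C : ℝ, 0 < C ∧ ∀ t : ℝ, 1 ≤ t → ∀ r : ℝ, 0 < r →
      levyDensity t r * ((1 + r) / r) ^ m ≤ C * (1 + r)⁻¹ ∧
      levyDensity t r * ((1 + r) / r) ^ m ≤ C / t := by
  obtain ⟨C, hC, h⟩ := exists_pow_mul_exp_neg_div_le (m + 1) (c := 1 / 8) (by positivity)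
  refine ⟨8 * C, by positivity, fun t ht r hr => ?_⟩
  have ht0 : 0 < t := by linarith
  have hsr := Real.sqrt_pos.2 hr
  have hsq : √r ^ 2 = r := Real.sq_sqrt hr.le
  have hu := one_le_one_add_div hr
  have hexp : Real.exp (-(t ^ 2 / (4 * r))) =
      Real.exp (-(t ^ 2 / (8 * r))) * Real.exp (-(t ^ 2 / (8 * r))) := by
    rw [← Real.exp_add]; congr 1; field_simp; norm_num
  have hexp1 : Real.exp (-(t ^ 2 / (8 * r))) ≤ Real.exp (-(1 / 8 / r)) := by
    rw [div_div]; gcongr; nlinarith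
  have hden : levyDensity t r ≤ t / (r * √r) *
      (Real.exp (-(t ^ 2 / (8 * r))) * Real.exp (-(1 / 8 / r))) := by
    refine (levyDensity_le ht0.le hr).trans ?_
    rw [rpow_three_halves hr, hexp, mul_one_div]
    gcongr
  constructor
  · have h1 : t / √r * Real.exp (-(t ^ 2 / (8 * r))) ≤ 2 := by
      have := mul_exp_neg_sq_le (t / √r)
      rwa [div_pow, hsq, div_div, mul_comm r 8] at this
    calc levyDensity t r * ((1 + r) / r) ^ m
        ≤ t / (r * √r) * (Real.exp (-(t ^ 2 / (8 * r))) * Real.exp (-(1 / 8 / r))) *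
          ((1 + r) / r) ^ m := by gcongr
      _ = (t / √r * Real.exp (-(t ^ 2 / (8 * r)))) *
          ((1 + r)⁻¹ * (((1 + r) / r) ^ (m + 1) * Real.exp (-(1 / 8 / r)))) := by
          rw [pow_succ ((1 + r) / r) m, show (1 + r)⁻¹ * ((((1 + r) / r) ^ m * ((1 + r) / r)) *
            Real.exp (-(1 / 8 / r))) = ((1 + r) / r) ^ m * Real.exp (-(1 / 8 / r)) / r by field_simp]
          ring
      _ ≤ 2 * ((1 + r)⁻¹ * C) := by
          gcongr
          exact h r hr
      _ ≤ _ := by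
          have : 0 < (1 + r)⁻¹ * C := by positivity
          linarith
  · have h1 : Real.exp (-(t ^ 2 / (8 * r))) ≤ 8 * r / t ^ 2 := by
      have h2 := Real.add_one_le_exp (t ^ 2 / (8 * r))
      rw [Real.exp_neg]
      calc (Real.exp (t ^ 2 / (8 * r)))⁻¹ ≤ (t ^ 2 / (8 * r))⁻¹ := by
            gcongr; linarith
        _ = _ := by rw [inv_div]
    have h3 : 1 / √r ≤ (1 + r) / r := by
      rw [div_le_div_iff₀ hsr hr]
      nlinarith [sq_nonneg (√r - 1)]
    calc levyDensity t r * ((1 + r) / r) ^ m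
        ≤ t / (r * √r) * (8 * r / t ^ 2 * Real.exp (-(1 / 8 / r))) * ((1 + r) / r) ^ m := by
          refine (mul_le_mul_of_nonneg_right hden (by positivity)).trans ?_
          gcongr
      _ = 8 / t * (1 / √r) * (((1 + r) / r) ^ m * Real.exp (-(1 / 8 / r))) := by field_simp
      _ ≤ 8 / t * ((1 + r) / r) * (((1 + r) / r) ^ m * Real.exp (-(1 / 8 / r))) := by gcongr
      _ = 8 / t * (((1 + r) / r) ^ (m + 1) * Real.exp (-(1 / 8 / r))) := by ring
      _ ≤ 8 / t * C := by gcongr; exact h r hr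
      _ = _ := by ring

lemma integrableOn_add_one_rpow {a : ℝ} (ha : a < -1) :
    IntegrableOn (fun r : ℝ => (r + 1) ^ a) (Ioi 0) :=
  integrableOn_add_rpow_Ioi_of_lt ha (by norm_num)

lemma exists_levyDensity_mul_rpow_le (β : ℝ) {t₀ t₁ : ℝ} (ht₀ : 0 < t₀) (ht₁ : t₀ ≤ t₁) :
    ∃ C : ℝ, 0 < C ∧ ∀ t ∈ Icc t₀ t₁, ∀ r : ℝ, 0 < r →
      levyDensity t r * r ^ β ≤ C * (r + 1) ^ (β - 3 / 2) := by
  obtain ⟨m, hm⟩ := exists_nat_ge (-β)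
  obtain ⟨C, hC, h⟩ := exists_levyDensity_mul_pow_le m ht₀ ht₁
  refine ⟨C, hC, fun t ht r hr => ?_⟩
  have ht0 : 0 < t := ht₀.trans_le ht.1
  have hu := one_le_one_add_div hr
  have h1 : r ^ β ≤ (r + 1) ^ β * ((1 + r) / r) ^ m := by
    have h2 : r ^ β = (r + 1) ^ β * ((1 + r) / r) ^ (-β) := by
      rw [Real.div_rpow (by positivity) hr.le, Real.rpow_neg (by positivity),
        Real.rpow_neg hr.le, add_comm 1 r]
      have : 0 < (r + 1) ^ β := by positivity
      have : 0 < r ^ β := by positivity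
      field_simp
    rw [h2, ← Real.rpow_natCast ((1 + r) / r) m]
    gcongr
  calc levyDensity t r * r ^ β
      ≤ levyDensity t r * ((r + 1) ^ β * ((1 + r) / r) ^ m) := by
        have := levyDensity_nonneg ht0.le hr
        gcongr
    _ = (levyDensity t r * ((1 + r) / r) ^ m) * (r + 1) ^ β := by ring
    _ ≤ C * (r + 1) ^ (-(3 / 2) : ℝ) * (r + 1) ^ β := by
        exact mul_le_mul_of_nonneg_right (h t ht r hr) (by positivity)
    _ = _ := by
        rw [mul_assoc, ← Real.rpow_add (by positivity)]; congr 2; ring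

lemma integrableOn_levyDensity_mul_rpow {t β : ℝ} (ht : 0 < t) (hβ : β < 1 / 2) :
    IntegrableOn (fun r => levyDensity t r * r ^ β) (Ioi 0) := by
  obtain ⟨C, -, h⟩ := exists_levyDensity_mul_rpow_le β ht le_rfl
  refine Integrable.mono' ((integrableOn_add_one_rpow (a := β - 3 / 2) (by linarith)).const_mul C)
    ((measurable_levyDensity t).mul (by fun_prop)).aestronglyMeasurable ?_
  filter_upwards [self_mem_ae_restrict measurableSet_Ioi] with r hr
  have hr' : 0 < r := hr
  rw [Real.norm_of_nonneg (mul_nonneg (levyDensity_nonneg ht.le hr') (by positivity))]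
  exact h t ⟨le_rfl, le_rfl⟩ r hr

lemma integrableOn_levyDensity {t : ℝ} (ht : 0 < t) : IntegrableOn (levyDensity t) (Ioi 0) := by
  simpa using integrableOn_levyDensity_mul_rpow ht (β := 0) (by norm_num)

lemma integral_levyDensity {t : ℝ} (ht : 0 < t) : ∫ r in Ioi 0, levyDensity t r = 1 := by
  rw [integral_eq_lintegral_of_nonneg_ae, lintegral_levyDensity ht, ENNReal.toReal_one]
  · filter_upwards [self_mem_ae_restrict measurableSet_Ioi] with r hr
    exact levyDensity_nonneg ht.le hr
  · exact (measurable_levyDensity t).aestronglyMeasurable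

lemma integral_levyDensity_smul_eq {F : Type*} [NormedAddCommGroup F] [NormedSpace ℝ F]
    {t : ℝ} (ht : 0 < t) (H : ℝ → F) :
    ∫ r in Ioi 0, levyDensity t r • H r = ∫ r in Ioi 0, levyDensity 1 r • H (t ^ 2 * r) := by
  have h := integral_comp_mul_left_Ioi' (fun r => levyDensity t r • H r) 0 (b := t ^ 2)
    (by positivity)
  rw [mul_zero] at h
  rw [← h, ← integral_smul]
  refine setIntegral_congr_fun measurableSet_Ioi fun r hr => ?_
  rw [levyDensity_mul_sq ht hr, smul_smul, ← mul_assoc, mul_inv_cancel₀ (by positivity), one_mul]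

lemma integral_levyDensity_mul_rpow {t : ℝ} (ht : 0 < t) (β : ℝ) :
    ∫ r in Ioi 0, levyDensity t r * r ^ β =
      t ^ (2 * β) * ∫ r in Ioi 0, levyDensity 1 r * r ^ β := by
  have h := integral_levyDensity_smul_eq ht (fun r => r ^ β)
  simp only [smul_eq_mul] at h
  rw [h, ← integral_const_mul]
  refine setIntegral_congr_fun measurableSet_Ioi fun r hr => ?_
  have hr' : 0 < r := hr
  rw [Real.mul_rpow (by positivity) hr'.le, ← Real.rpow_natCast t 2, ← Real.rpow_mul ht.le]
  push_cast; ring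

lemma setIntegral_Ioi_levyDensity_le {t r₀ : ℝ} (ht : 0 ≤ t) (hr₀ : 0 < r₀) :
    ∫ r in Ioi r₀, levyDensity t r ≤ 2 * t / √r₀ := by
  have hint := (integrableOn_Ioi_rpow_of_lt (a := -(3 / 2)) (by norm_num) hr₀).const_mul t
  calc ∫ r in Ioi r₀, levyDensity t r ≤ ∫ r in Ioi r₀, t * r ^ (-(3 / 2) : ℝ) := by
        refine integral_mono_of_nonneg ?_ hint ?_
        · filter_upwards [self_mem_ae_restrict measurableSet_Ioi] with r hr
          exact levyDensity_nonneg ht (hr₀.trans hr)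
        · filter_upwards [self_mem_ae_restrict measurableSet_Ioi] with r hr
          have hr' : 0 < r := hr₀.trans hr
          refine (levyDensity_le ht hr').trans ?_
          rw [Real.rpow_neg hr'.le, one_div]
          refine mul_le_of_le_one_right (by positivity) (Real.exp_le_one_iff.2 ?_)
          rw [neg_nonpos]; positivity
    _ = 2 * t / √r₀ := by
        rw [integral_const_mul, integral_Ioi_rpow_of_lt (by norm_num) hr₀,
          show (-(3 / 2) + 1 : ℝ) = -(1 / 2) by norm_num, Real.rpow_neg hr₀.le, ← Real.sqrt_eq_rpow]
        field_simp

lemma hasDerivAt_levyDensity_right {r : ℝ} (hr : 0 < r) :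
    HasDerivAt (levyDensity 1) (levyDensity 1 r * (1 / (4 * r ^ 2) - 3 / (2 * r))) r := by
  have h1 : HasDerivAt (fun r : ℝ => r ^ (3 / 2 : ℝ)) (3 / 2 * r ^ (3 / 2 - 1 : ℝ)) r :=
    Real.hasDerivAt_rpow_const (Or.inl hr.ne')
  have h2 : HasDerivAt (fun r : ℝ => 1 / r ^ (3 / 2 : ℝ))
      (-(3 / 2 * r ^ (3 / 2 - 1 : ℝ)) / (r ^ (3 / 2 : ℝ)) ^ 2) r := by
    simpa only [one_div] using! h1.inv (by positivity)
  have h3 : HasDerivAt (fun r : ℝ => -((1 : ℝ) ^ 2 / (4 * r))) (1 / (4 * r ^ 2)) r := by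
    have := (((hasDerivAt_id r).const_mul 4).inv (by simp; positivity)).neg
    refine (this.congr_deriv ?_).congr_of_eventuallyEq (Eventually.of_forall fun x => ?_)
    · simp; field_simp
    · simp
  refine ((h2.mul h3.exp).const_mul (1 / (2 * √Real.pi))).congr_deriv ?_
  have h4 : r ^ (3 / 2 - 1 : ℝ) = r ^ (3 / 2 : ℝ) / r := by
    rw [Real.rpow_sub hr, Real.rpow_one]
  rw [h4, levyDensity]
  have : 0 < r ^ (3 / 2 : ℝ) := by positivity
  field_simp
  ring

/-- The `L¹` modulus of continuity of the Lévy density, in dual form. For `t = 1` the derivative of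
the density has the decreasing integrable majorant `C (r + 1) ^ (-3/2)`; the general case follows
by scaling. -/
lemma exists_norm_integral_levyDensity_smul_sub_shift_le (F : Type*) [NormedAddCommGroup F]
    [NormedSpace ℝ F] :
    ∃ C : ℝ, 0 < C ∧ ∀ (t s M : ℝ), 0 < t → 0 < s → ∀ H : ℝ → F, StronglyMeasurable H →
      (∀ r, ‖H r‖ ≤ M) →
      ‖∫ r in Ioi 0, levyDensity t r • (H r - H (r + s))‖ ≤ C * M * (s / t ^ 2) := by
  obtain ⟨C₀, hC₀, h₀⟩ := exists_levyDensity_mul_pow_le 2 one_pos le_rfl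
  set J : ℝ := ∫ r in Ioi (0 : ℝ), (r + 1) ^ (-(3 / 2) : ℝ) with hJ
  have hJint : IntegrableOn (fun r : ℝ => (r + 1) ^ (-(3 / 2) : ℝ)) (Ioi 0) :=
    integrableOn_add_one_rpow (by norm_num)
  have hJ0 : 0 ≤ J := setIntegral_nonneg measurableSet_Ioi fun r hr => by
    have : 0 < r := hr
    positivity
  have hone : (1 : ℝ) ∈ Icc (1 : ℝ) 1 := ⟨le_rfl, le_rfl⟩
  have hderiv : ∀ r, 0 < r → |levyDensity 1 r * (1 / (4 * r ^ 2) - 3 / (2 * r))| ≤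
      2 * C₀ * (r + 1) ^ (-(3 / 2) : ℝ) := by
    intro r hr
    have h1 : |1 / (4 * r ^ 2) - 3 / (2 * r)| ≤ 2 * ((1 + r) / r) ^ 2 := by
      rw [abs_le, div_pow]
      constructor
      · rw [← sub_nonneg]
        have : 1 / (4 * r ^ 2) - 3 / (2 * r) - -(2 * ((1 + r) ^ 2 / r ^ 2)) =
          (1 / 4 + 2 + 5 / 2 * r + 2 * r ^ 2) / r ^ 2 := by field_simp; ring
        rw [this]; positivity
      · rw [← sub_nonneg]
        have : 2 * ((1 + r) ^ 2 / r ^ 2) - (1 / (4 * r ^ 2) - 3 / (2 * r)) =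
          (7 / 4 + 11 / 2 * r + 2 * r ^ 2) / r ^ 2 := by field_simp; ring
        rw [this]; positivity
    have hp := levyDensity_nonneg zero_le_one hr
    rw [abs_mul, abs_of_nonneg hp]
    calc _ ≤ levyDensity 1 r * (2 * ((1 + r) / r) ^ 2) := by gcongr
      _ = 2 * (levyDensity 1 r * ((1 + r) / r) ^ 2) := by ring
      _ ≤ 2 * (C₀ * (r + 1) ^ (-(3 / 2) : ℝ)) :=
          mul_le_mul_of_nonneg_left (h₀ 1 hone r hr) (by norm_num)
      _ = _ := by ring
  have hsup : ∀ r, 0 < r → levyDensity 1 r ≤ C₀ := by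
    intro r hr
    have hp := levyDensity_nonneg zero_le_one hr
    have h1 : 1 ≤ ((1 + r) / r) ^ 2 := one_le_pow₀ (one_le_one_add_div hr)
    have h2 : (r + 1) ^ (-(3 / 2) : ℝ) ≤ 1 :=
      Real.rpow_le_one_of_one_le_of_nonpos (by linarith) (by norm_num)
    nlinarith [h₀ 1 hone r hr]
  have hshift : ∀ s r, 0 < s → 0 < r →
      |levyDensity 1 (r + s) - levyDensity 1 r| ≤ 2 * C₀ * s * (r + 1) ^ (-(3 / 2) : ℝ) := by
    intro s r hs hr
    have h := Convex.norm_image_sub_le_of_norm_hasDerivWithin_le (f := levyDensity 1)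
      (f' := fun r => levyDensity 1 r * (1 / (4 * r ^ 2) - 3 / (2 * r)))
      (C := 2 * C₀ * (r + 1) ^ (-(3 / 2) : ℝ)) (s := Icc r (r + s)) (x := r) (y := r + s)
      (fun x hx => (hasDerivAt_levyDensity_right (hr.trans_le hx.1)).hasDerivWithinAt)
      (fun x hx => by
        refine (hderiv x (hr.trans_le hx.1)).trans ?_
        have hxr := hx.1
        have : (x + 1) ^ (-(3 / 2) : ℝ) ≤ (r + 1) ^ (-(3 / 2) : ℝ) :=
          Real.rpow_le_rpow_of_nonpos (by linarith) (by linarith) (by norm_num)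
        gcongr)
      (convex_Icc _ _) ⟨le_rfl, by linarith⟩ ⟨by linarith, le_rfl⟩
    rw [Real.norm_eq_abs, Real.norm_eq_abs, add_sub_cancel_left, abs_of_pos hs] at h
    linarith
  have hmain : ∀ (s M : ℝ), 0 < s → ∀ H : ℝ → F, StronglyMeasurable H → (∀ r, ‖H r‖ ≤ M) →
      ‖∫ r in Ioi 0, levyDensity 1 r • (H r - H (r + s))‖ ≤ (C₀ + 2 * C₀ * J) * M * s := by
    intro s M hs H hH hM
    have hM0 : 0 ≤ M := (norm_nonneg _).trans (hM 0)
    have hHs : StronglyMeasurable (fun r => H (r + s)) :=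
      hH.comp_measurable (measurable_id.add_const s)
    have hi : ∀ G : ℝ → F, StronglyMeasurable G → (∀ r, ‖G r‖ ≤ M) →
        IntegrableOn (fun r => levyDensity 1 r • G r) (Ioi 0) := by
      intro G hG hGM
      refine Integrable.mono' ((integrableOn_levyDensity one_pos).mul_const M)
        ((measurable_levyDensity 1).stronglyMeasurable.smul hG).aestronglyMeasurable ?_
      filter_upwards [self_mem_ae_restrict measurableSet_Ioi] with r hr
      rw [norm_smul, Real.norm_of_nonneg (levyDensity_nonneg zero_le_one hr)]
      exact mul_le_mul_of_nonneg_left (hGM r) (levyDensity_nonneg zero_le_one hr)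
    have hi1 := hi H hH hM
    have hi2 := hi _ hHs (fun r => hM _)
    have hi3 : IntegrableOn (fun r => levyDensity 1 (r + s) • H (r + s)) (Ioi 0) := by
      have h : IntegrableOn (fun r => levyDensity 1 r • H r) (Ioi s) :=
        hi1.mono_set (Ioi_subset_Ioi hs.le)
      have := ((measurePreserving_add_right volume s).integrableOn_comp_preimage
        (measurableEmbedding_addRight s) (s := Ioi s)
        (f := fun r => levyDensity 1 r • H r)).2 h
      simpa [Function.comp_def] using this
    -- after a translation the difference falls on the density, up to the piece `(0, s]`
    have hsplit : ∫ r in Ioi 0, levyDensity 1 r • H r =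
        (∫ r in Ioc 0 s, levyDensity 1 r • H r) +
          ∫ r in Ioi 0, levyDensity 1 (r + s) • H (r + s) := by
      have h1 : ∫ r in Ioi 0, levyDensity 1 (r + s) • H (r + s) =
          ∫ r in Ioi s, levyDensity 1 r • H r := by
        have := (measurePreserving_add_right volume s).setIntegral_preimage_emb
          (measurableEmbedding_addRight s) (fun r => levyDensity 1 r • H r) (Ioi s)
        simpa using this
      rw [h1, ← setIntegral_union (Ioc_disjoint_Ioi le_rfl) measurableSet_Ioi
        (hi1.mono_set Ioc_subset_Ioi_self) (hi1.mono_set (Ioi_subset_Ioi hs.le)),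
        Ioc_union_Ioi_eq_Ioi hs.le]
    have heq : ∫ r in Ioi 0, levyDensity 1 r • (H r - H (r + s)) =
        (∫ r in Ioc 0 s, levyDensity 1 r • H r) +
          ∫ r in Ioi 0, (levyDensity 1 (r + s) - levyDensity 1 r) • H (r + s) := by
      simp only [smul_sub, sub_smul]
      rw [integral_sub hi1 hi2, integral_sub hi3 hi2, hsplit]
      abel
    have hb1 : ‖∫ r in Ioc 0 s, levyDensity 1 r • H r‖ ≤ C₀ * M * s := by
      have := norm_setIntegral_le_of_norm_le_const (μ := volume) (s := Ioc 0 s)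
        (f := fun r => levyDensity 1 r • H r) (C := C₀ * M) (by simp)
        (fun r hr => by
          rw [norm_smul, Real.norm_of_nonneg (levyDensity_nonneg zero_le_one hr.1)]
          exact mul_le_mul (hsup r hr.1) (hM r) (norm_nonneg _) hC₀.le)
      simpa [Measure.real, hs.le] using this
    have hb2 : ‖∫ r in Ioi 0, (levyDensity 1 (r + s) - levyDensity 1 r) • H (r + s)‖ ≤
        2 * C₀ * s * M * J := by
      rw [hJ, ← integral_const_mul]
      refine norm_integral_le_of_norm_le (hJint.const_mul _) ?_
      filter_upwards [self_mem_ae_restrict measurableSet_Ioi] with r hr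
      have hr' : 0 < r := hr
      rw [norm_smul, Real.norm_eq_abs]
      calc _ ≤ 2 * C₀ * s * (r + 1) ^ (-(3 / 2) : ℝ) * M :=
            mul_le_mul (hshift s r hs hr) (hM _) (norm_nonneg _) (by positivity)
        _ = _ := by ring
    rw [heq]
    calc _ ≤ C₀ * M * s + 2 * C₀ * s * M * J := (norm_add_le _ _).trans (add_le_add hb1 hb2)
      _ = _ := by ring
  refine ⟨C₀ + 2 * C₀ * J, by positivity, fun t s M ht hs H hH hM => ?_⟩
  rw [integral_levyDensity_smul_eq ht (fun r => H r - H (r + s))]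
  have h := hmain (s / t ^ 2) M (by positivity) (fun r => H (t ^ 2 * r))
    (hH.comp_measurable (measurable_id.const_mul _)) (fun r => hM _)
  have h2 : ∀ r, t ^ 2 * (r + s / t ^ 2) = t ^ 2 * r + s := fun r => by field_simp
  simpa only [h2] using h

/-! ### The Gauss measure -/

/-- The probability measure `π^{-n/2} e^{-|z|²} dz`, which is invariant under the
Ornstein-Uhlenbeck semigroup. -/
def gaussMeasure (n : ℕ) : Measure (EuclideanSpace ℝ (Fin n)) :=
  volume.withDensity fun z => ENNReal.ofReal (Real.pi ^ (-((n : ℝ) / 2)) * Real.exp (-‖z‖ ^ 2))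

lemma integral_withDensity_ofReal {X F : Type*} [MeasurableSpace X] [NormedAddCommGroup F]
    [NormedSpace ℝ F] {μ : Measure X} {k : X → ℝ} (hk : Measurable k) (hk0 : ∀ᵐ x ∂μ, 0 ≤ k x)
    (g : X → F) :
    ∫ x, g x ∂μ.withDensity (fun x => ENNReal.ofReal (k x)) = ∫ x, k x • g x ∂μ := by
  rw [integral_withDensity_eq_integral_toReal_smul hk.ennreal_ofReal (by simp)]
  refine integral_congr_ae ?_
  filter_upwards [hk0] with x hx
  rw [ENNReal.toReal_ofReal hx]

lemma integrable_withDensity_ofReal_iff {X F : Type*} [MeasurableSpace X] [NormedAddCommGroup F]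
    [NormedSpace ℝ F] {μ : Measure X} {k : X → ℝ} (hk : Measurable k) (hk0 : ∀ᵐ x ∂μ, 0 ≤ k x)
    {g : X → F} :
    Integrable g (μ.withDensity (fun x => ENNReal.ofReal (k x))) ↔
      Integrable (fun x => k x • g x) μ := by
  rw [integrable_withDensity_iff_integrable_smul' hk.ennreal_ofReal (by simp)]
  refine integrable_congr ?_
  filter_upwards [hk0] with x hx
  rw [ENNReal.toReal_ofReal hx]

variable {n : ℕ}

lemma measurable_gaussDensity : Measurable fun z : EuclideanSpace ℝ (Fin n) =>
    Real.pi ^ (-((n : ℝ) / 2)) * Real.exp (-‖z‖ ^ 2) := by fun_prop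

lemma integrable_exp_neg_mul_norm_sq {b : ℝ} (hb : 0 < b) :
    Integrable fun z : EuclideanSpace ℝ (Fin n) => Real.exp (-b * ‖z‖ ^ 2) := by
  have h := (GaussianFourier.integrable_cexp_neg_mul_sq_norm_add (b := (b : ℂ)) (by simpa) 0
    (0 : EuclideanSpace ℝ (Fin n))).norm
  refine h.congr (Eventually.of_forall fun z => ?_)
  simp only [Complex.norm_exp]
  simp [← Complex.ofReal_pow]

lemma integrable_exp_neg_norm_sq :
    Integrable fun z : EuclideanSpace ℝ (Fin n) => Real.exp (-‖z‖ ^ 2) := by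
  simpa using integrable_exp_neg_mul_norm_sq (n := n) one_pos

lemma integral_exp_neg_norm_sq :
    ∫ z : EuclideanSpace ℝ (Fin n), Real.exp (-‖z‖ ^ 2) = Real.pi ^ ((n : ℝ) / 2) := by
  have h := GaussianFourier.integral_rexp_neg_mul_sq_norm (V := EuclideanSpace ℝ (Fin n)) one_pos
  simpa using h

instance : IsProbabilityMeasure (gaussMeasure n) := by
  refine ⟨?_⟩
  rw [gaussMeasure, withDensity_apply _ MeasurableSet.univ, Measure.restrict_univ,
    ← ofReal_integral_eq_lintegral_ofReal (integrable_exp_neg_norm_sq.const_mul _)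
      (Eventually.of_forall fun z => by positivity), integral_const_mul, integral_exp_neg_norm_sq,
    ← Real.rpow_add Real.pi_pos]
  simp

lemma integral_gaussMeasure {F : Type*} [NormedAddCommGroup F] [NormedSpace ℝ F]
    (g : EuclideanSpace ℝ (Fin n) → F) :
    ∫ z, g z ∂gaussMeasure n =
      ∫ z, (Real.pi ^ (-((n : ℝ) / 2)) * Real.exp (-‖z‖ ^ 2)) • g z :=
  integral_withDensity_ofReal measurable_gaussDensity (Eventually.of_forall fun z => by positivity) g

lemma integrable_gaussMeasure_iff {F : Type*} [NormedAddCommGroup F] [NormedSpace ℝ F]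
    {g : EuclideanSpace ℝ (Fin n) → F} :
    Integrable g (gaussMeasure n) ↔
      Integrable fun z => (Real.pi ^ (-((n : ℝ) / 2)) * Real.exp (-‖z‖ ^ 2)) • g z :=
  integrable_withDensity_ofReal_iff measurable_gaussDensity
    (Eventually.of_forall fun z => by positivity)

lemma integrable_norm_gaussMeasure :
    Integrable (fun z : EuclideanSpace ℝ (Fin n) => ‖z‖) (gaussMeasure n) := by
  rw [integrable_gaussMeasure_iff]
  have h := integrable_exp_neg_mul_norm_sq (n := n) (b := 1 / 2) (by norm_num)
  refine Integrable.mono' (h.const_mul (Real.pi ^ (-((n : ℝ) / 2))))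
    (by fun_prop) (Eventually.of_forall fun z => ?_)
  rw [smul_eq_mul, Real.norm_of_nonneg (by positivity), mul_assoc]
  gcongr
  have h1 : Real.exp (-‖z‖ ^ 2) = Real.exp (-(1 / 2) * ‖z‖ ^ 2) * Real.exp (-(1 / 2) * ‖z‖ ^ 2) := by
    rw [← Real.exp_add]; ring_nf
  rw [h1, mul_assoc]
  refine mul_le_of_le_one_right (Real.exp_pos _).le ?_
  rw [neg_mul, Real.exp_neg, inv_mul_le_iff₀ (Real.exp_pos _), mul_one]
  nlinarith [Real.add_one_le_exp (1 / 2 * ‖z‖ ^ 2), sq_nonneg (‖z‖ - 1)]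

lemma integrable_norm_rpow_gaussMeasure {α : ℝ} (hα0 : 0 ≤ α) (hα1 : α ≤ 1) :
    Integrable (fun z : EuclideanSpace ℝ (Fin n) => ‖z‖ ^ α) (gaussMeasure n) := by
  refine Integrable.mono' ((integrable_const (1 : ℝ)).add integrable_norm_gaussMeasure)
    (by fun_prop) (Eventually.of_forall fun z => ?_)
  rw [Real.norm_of_nonneg (by positivity), Pi.add_apply]
  rcases le_total ‖z‖ 1 with h | h
  · have := Real.rpow_le_one (norm_nonneg z) h hα0
    linarith [norm_nonneg z]
  · have := Real.rpow_le_rpow_of_exponent_le h hα1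
    rw [Real.rpow_one] at this
    linarith

lemma lintegral_comp_add_smul (m : EuclideanSpace ℝ (Fin n)) {σ : ℝ} (hσ : 0 < σ)
    {G : EuclideanSpace ℝ (Fin n) → ENNReal} (hG : Measurable G) :
    ∫⁻ z, G (m + σ • z) = ENNReal.ofReal ((σ ^ n)⁻¹) * ∫⁻ y, G y := by
  have h1 : ∫⁻ z, G (m + σ • z) =
      ∫⁻ y, G (m + y) ∂(Measure.map (fun z : EuclideanSpace ℝ (Fin n) => σ • z) volume) := by
    rw [lintegral_map (f := fun y => G (m + y)) (by fun_prop) (measurable_const_smul σ)]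
  rw [h1, Measure.map_addHaar_smul _ hσ.ne', lintegral_smul_measure, lintegral_add_left_eq_self,
    finrank_euclideanSpace_fin, abs_of_pos (by positivity), smul_eq_mul]

/-- The law of `m + σ z` under the Gauss measure, in density form. -/
lemma lintegral_gaussMeasure_comp_add_smul (m : EuclideanSpace ℝ (Fin n)) {σ : ℝ} (hσ : 0 < σ)
    {G : EuclideanSpace ℝ (Fin n) → ENNReal} (hG : Measurable G) :
    ∫⁻ z, G (m + σ • z) ∂gaussMeasure n =
      ∫⁻ y, ENNReal.ofReal (Real.pi ^ (-((n : ℝ) / 2)) * (Real.exp (-(‖y - m‖ ^ 2 / σ ^ 2)) / σ ^ n))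
        * G y := by
  rw [gaussMeasure, lintegral_withDensity_eq_lintegral_mul _
    measurable_gaussDensity.ennreal_ofReal (by fun_prop)]
  have h := lintegral_comp_add_smul m hσ (G := fun y => ENNReal.ofReal
    (Real.pi ^ (-((n : ℝ) / 2)) * Real.exp (-(‖y - m‖ ^ 2 / σ ^ 2))) * G y) (by fun_prop)
  have h2 : ∀ z : EuclideanSpace ℝ (Fin n), ‖m + σ • z - m‖ ^ 2 / σ ^ 2 = ‖z‖ ^ 2 := by
    intro z
    rw [add_sub_cancel_left, norm_smul, Real.norm_of_nonneg hσ.le]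
    field_simp
  simp only [h2] at h
  simp only [Pi.mul_apply]
  rw [h, ← lintegral_const_mul _ (by fun_prop)]
  refine lintegral_congr fun y => ?_
  rw [← mul_assoc, ← ENNReal.ofReal_mul (by positivity)]
  congr 2
  ring

lemma charFun_gaussMeasure (ξ : EuclideanSpace ℝ (Fin n)) :
    charFun (gaussMeasure n) ξ = Complex.exp (-((‖ξ‖ ^ 2 / 4 : ℝ) : ℂ)) := by
  rw [charFun_apply, integral_gaussMeasure]
  have h := GaussianFourier.integral_cexp_neg_mul_sq_norm_add (b := 1) (by simp) Complex.I ξ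
  have h2 : ∀ z : EuclideanSpace ℝ (Fin n),
      (Real.pi ^ (-((n : ℝ) / 2)) * Real.exp (-‖z‖ ^ 2)) • Complex.exp (inner ℝ z ξ * Complex.I) =
      ((Real.pi ^ (-((n : ℝ) / 2)) : ℝ) : ℂ) *
        Complex.exp (-1 * (‖z‖ : ℂ) ^ 2 + Complex.I * (inner ℝ ξ z : ℝ)) := by
    intro z
    rw [Complex.real_smul, Complex.exp_add, real_inner_comm]
    push_cast
    rw [neg_one_mul, mul_comm Complex.I]
    ring
  simp only [h2]
  rw [integral_const_mul, h, ← mul_assoc]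
  have h3 : ((Real.pi ^ (-((n : ℝ) / 2)) : ℝ) : ℂ) * (Real.pi / 1 : ℂ) ^
      ((Module.finrank ℝ (EuclideanSpace ℝ (Fin n)) : ℂ) / 2) = 1 := by
    rw [finrank_euclideanSpace_fin, div_one]
    have : ((Real.pi : ℂ)) ^ ((n : ℂ) / 2) = ((Real.pi ^ ((n : ℝ) / 2) : ℝ) : ℂ) := by
      rw [Complex.ofReal_cpow Real.pi_pos.le]; push_cast; rfl
    rw [this, ← Complex.ofReal_mul, ← Real.rpow_add Real.pi_pos]
    simp
  rw [h3, one_mul]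
  congr 1
  rw [Complex.I_sq]
  push_cast
  ring

/-- Rotation invariance of the Gauss measure. -/
lemma map_smul_add_smul_gaussMeasure {a b c : ℝ} (h : a ^ 2 + b ^ 2 = c ^ 2) :
    ((gaussMeasure n).prod (gaussMeasure n)).map (fun p => a • p.1 + b • p.2) =
      (gaussMeasure n).map (fun z => c • z) := by
  have h1 : ((gaussMeasure n).prod (gaussMeasure n)).map (fun p => a • p.1 + b • p.2) =
      (((gaussMeasure n).map (fun z => a • z)).prod ((gaussMeasure n).map (fun z => b • z))).map
        (fun p => p.1 + p.2) := by
    rw [Measure.map_prod_map _ _ (by fun_prop) (by fun_prop),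
      Measure.map_map (by fun_prop) (by fun_prop)]
    rfl
  have : ∀ a : ℝ, IsProbabilityMeasure ((gaussMeasure n).map (fun z => a • z)) :=
    fun a => Measure.isProbabilityMeasure_map (by fun_prop)
  have : IsProbabilityMeasure ((((gaussMeasure n).map (fun z => a • z)).prod
      ((gaussMeasure n).map (fun z => b • z))).map (fun p => p.1 + p.2)) :=
    Measure.isProbabilityMeasure_map (by fun_prop)
  rw [h1]
  refine Measure.ext_of_charFun ?_
  rw [ProbabilityTheory.charFun_map_add_prod_eq_mul]
  ext ξ
  rw [Pi.mul_apply, charFun_map_smul, charFun_map_smul, charFun_map_smul, charFun_gaussMeasure,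
    charFun_gaussMeasure, charFun_gaussMeasure, ← Complex.exp_add]
  congr 1
  rw [← neg_add, ← Complex.ofReal_add]
  congr 2
  simp only [norm_smul, mul_pow, Real.norm_eq_abs, sq_abs]
  rw [← h]; ring

lemma lintegral_lintegral_gaussMeasure {a b c : ℝ} (h : a ^ 2 + b ^ 2 = c ^ 2)
    {G : EuclideanSpace ℝ (Fin n) → ENNReal} (hG : Measurable G) :
    ∫⁻ z, ∫⁻ w, G (a • z + b • w) ∂gaussMeasure n ∂gaussMeasure n =
      ∫⁻ z, G (c • z) ∂gaussMeasure n := by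
  have h1 := lintegral_map (μ := (gaussMeasure n).prod (gaussMeasure n))
    (g := fun p : EuclideanSpace ℝ (Fin n) × EuclideanSpace ℝ (Fin n) => a • p.1 + b • p.2)
    hG (by fun_prop)
  rw [map_smul_add_smul_gaussMeasure h, lintegral_map hG (by fun_prop)] at h1
  rw [h1, lintegral_prod _ (by fun_prop)]

lemma abs_exp_neg_sub_exp_neg_le (a b : ℝ) :
    |Real.exp (-a) - Real.exp (-b)| ≤ |a - b| * (Real.exp (-a) + Real.exp (-b)) := by
  wlog hab : a ≤ b generalizing a b
  · rw [abs_sub_comm, abs_sub_comm a, add_comm]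
    exact this b a (by linarith)
  have h1 : Real.exp (-b) ≤ Real.exp (-a) := Real.exp_le_exp.2 (by linarith)
  have h2 : Real.exp (-b) = Real.exp (-a) * Real.exp (-(b - a)) := by
    rw [← Real.exp_add]; ring_nf
  rw [abs_of_nonneg (by linarith), abs_of_nonpos (by linarith)]
  have h3 := Real.add_one_le_exp (-(b - a))
  have h4 := Real.exp_pos (-a)
  have h5 := Real.exp_pos (-b)
  nlinarith [mul_nonneg (sub_nonneg.2 hab) h5.le, mul_le_mul_of_nonneg_left h3 h4.le]

/-- Translates of the Gauss measure depend on the translation in a Lipschitz way, in total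
variation. -/
lemma exists_norm_integral_gaussMeasure_sub_translate_le (n : ℕ) (F : Type*) [NormedAddCommGroup F]
    [NormedSpace ℝ F] :
    ∃ C : ℝ, 0 < C ∧ ∀ (a : EuclideanSpace ℝ (Fin n)) (M : ℝ) (h : EuclideanSpace ℝ (Fin n) → F),
      StronglyMeasurable h → (∀ z, ‖h z‖ ≤ M) →
      ‖(∫ z, h (a + z) ∂gaussMeasure n) - ∫ z, h z ∂gaussMeasure n‖ ≤ C * M * ‖a‖ := by
  obtain ⟨m, hm⟩ : ∃ m : ℝ, m = ∫ z, ‖z‖ ∂gaussMeasure n := ⟨_, rfl⟩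
  have hm0 : 0 ≤ m := hm ▸ integral_nonneg fun z => norm_nonneg z
  refine ⟨4 * m + 2, by positivity, fun a M h hh hM => ?_⟩
  have hM0 : 0 ≤ M := (norm_nonneg _).trans (hM 0)
  have hbd : ∀ g : EuclideanSpace ℝ (Fin n) → F, StronglyMeasurable g → (∀ z, ‖g z‖ ≤ M) →
      Integrable g (gaussMeasure n) := fun g hg hgM =>
    Integrable.of_bound hg.aestronglyMeasurable M (Eventually.of_forall hgM)
  have hha : StronglyMeasurable fun z => h (a + z) := hh.comp_measurable (measurable_const_add a)
  -- the trivial bound `2 M` suffices for `1 ≤ ‖a‖`; otherwise the density is estimated pointwise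
  rcases le_or_gt 1 ‖a‖ with ha | ha
  · have h1 : ∀ g : EuclideanSpace ℝ (Fin n) → F, (∀ z, ‖g z‖ ≤ M) →
        ‖∫ z, g z ∂gaussMeasure n‖ ≤ M := fun g hgM => by
      have h2 := norm_integral_le_of_norm_le_const (f := g) (C := M) (μ := gaussMeasure n)
        (Eventually.of_forall hgM)
      rwa [probReal_univ, mul_one] at h2
    calc _ ≤ M + M := (norm_sub_le _ _).trans (add_le_add (h1 _ fun z => hM _) (h1 _ hM))
      _ = 2 * M * 1 := by ring
      _ ≤ (4 * m + 2) * M * ‖a‖ :=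
        mul_le_mul (mul_le_mul_of_nonneg_right (by linarith) hM0) ha zero_le_one (by positivity)
  set k : EuclideanSpace ℝ (Fin n) → ℝ :=
    fun z => Real.pi ^ (-((n : ℝ) / 2)) * Real.exp (-‖z‖ ^ 2) with hk
  have hk0 : ∀ z, 0 ≤ k z := fun z => by simp only [hk]; positivity
  have hi1 : Integrable fun z => k z • h z := integrable_gaussMeasure_iff.1 (hbd h hh hM)
  have hi2 : Integrable fun z => k (-a + z) • h z := by
    have h1 : Integrable fun z => k z • h (a + z) :=
      integrable_gaussMeasure_iff.1 (hbd _ hha fun z => hM _)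
    have h2 := h1.comp_add_left (-a)
    simpa only [add_neg_cancel_left] using h2
  have heq : (∫ z, h (a + z) ∂gaussMeasure n) - ∫ z, h z ∂gaussMeasure n =
      ∫ z, (k (-a + z) - k z) • h z := by
    rw [integral_gaussMeasure, integral_gaussMeasure]
    have := integral_add_left_eq_self (μ := volume) (fun z => k z • h (a + z)) (-a)
    simp only [add_neg_cancel_left] at this
    simp only [sub_smul]
    rw [integral_sub hi2 hi1, this]
  have hq : Integrable fun z : EuclideanSpace ℝ (Fin n) => k z * (2 * ‖z‖ + ‖a‖) := by
    have := integrable_gaussMeasure_iff.1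
      ((integrable_norm_gaussMeasure (n := n)).const_mul 2 |>.add (integrable_const ‖a‖))
    simpa only [smul_eq_mul, Pi.add_apply] using! this
  have hqi : ∫ z, k z * (2 * ‖z‖ + ‖a‖) = 2 * m + ‖a‖ := by
    have h1 := integral_gaussMeasure (n := n) fun z => 2 * ‖z‖ + ‖a‖
    rw [integral_add (integrable_norm_gaussMeasure.const_mul 2) (integrable_const _),
      integral_const_mul, ← hm] at h1
    simpa using h1.symm
  have hpt : ∀ z, ‖(k (-a + z) - k z) • h z‖ ≤
      M * ‖a‖ * (k (-a + z) * (2 * ‖-a + z‖ + ‖a‖) + k z * (2 * ‖z‖ + ‖a‖)) := by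
    intro z
    have e1 : ‖z‖ ≤ ‖-a + z‖ + ‖a‖ := by
      have := norm_add_le (-a + z) a
      simpa using this
    have e2 : ‖-a + z‖ ≤ ‖z‖ + ‖a‖ := by
      have := norm_add_le (-a) z
      rw [norm_neg] at this; linarith
    have e3 : |‖-a + z‖ ^ 2 - ‖z‖ ^ 2| ≤ ‖a‖ * (‖-a + z‖ + ‖z‖) := by
      rw [sq_sub_sq, abs_mul, abs_of_nonneg (add_nonneg (norm_nonneg _) (norm_nonneg _)), mul_comm]
      gcongr
      rw [abs_le]; constructor <;> linarith
    have e4 := abs_exp_neg_sub_exp_neg_le (‖-a + z‖ ^ 2) (‖z‖ ^ 2)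
    rw [norm_smul, Real.norm_eq_abs]
    have e5 : |k (-a + z) - k z| ≤ ‖a‖ * (‖-a + z‖ + ‖z‖) * (k (-a + z) + k z) := by
      simp only [hk]
      rw [← mul_sub, abs_mul, abs_of_nonneg (by positivity), ← mul_add]
      calc _ ≤ Real.pi ^ (-((n : ℝ) / 2)) * (|‖-a + z‖ ^ 2 - ‖z‖ ^ 2| *
            (Real.exp (-‖-a + z‖ ^ 2) + Real.exp (-‖z‖ ^ 2))) := by gcongr
        _ ≤ Real.pi ^ (-((n : ℝ) / 2)) * (‖a‖ * (‖-a + z‖ + ‖z‖) *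
            (Real.exp (-‖-a + z‖ ^ 2) + Real.exp (-‖z‖ ^ 2))) := by gcongr
        _ = _ := by ring
    calc _ ≤ ‖a‖ * (‖-a + z‖ + ‖z‖) * (k (-a + z) + k z) * M :=
          mul_le_mul e5 (hM z) (norm_nonneg _) ((abs_nonneg _).trans e5)
      _ = M * ‖a‖ * (k (-a + z) * (‖-a + z‖ + ‖z‖) + k z * (‖-a + z‖ + ‖z‖)) := by ring
      _ ≤ _ := by
        refine mul_le_mul_of_nonneg_left (add_le_add (mul_le_mul_of_nonneg_left ?_ (hk0 _))
          (mul_le_mul_of_nonneg_left ?_ (hk0 _))) (by positivity) <;> linarith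
  rw [heq]
  calc _ ≤ ∫ z, M * ‖a‖ * (k (-a + z) * (2 * ‖-a + z‖ + ‖a‖) + k z * (2 * ‖z‖ + ‖a‖)) :=
        norm_integral_le_of_norm_le
          (((hq.comp_add_left (-a)).add hq).const_mul _) (Eventually.of_forall hpt)
    _ = M * ‖a‖ * ((2 * m + ‖a‖) + (2 * m + ‖a‖)) := by
        rw [integral_const_mul, integral_add (hq.comp_add_left (-a)) hq, hqi,
          integral_add_left_eq_self (μ := volume) (fun z => k z * (2 * ‖z‖ + ‖a‖)) (-a), hqi]
    _ ≤ M * ‖a‖ * ((2 * m + 1) + (2 * m + 1)) := by gcongr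
    _ = _ := by ring

/-! ### The Poisson integral as a mean over Lévy time and Gaussian space -/

/-- The Lévy distribution with parameter `t`, as a measure on `ℝ` carried by `(0, ∞)`. -/
def levyMeasure (t : ℝ) : Measure ℝ :=
  (volume.restrict (Ioi 0)).withDensity fun r => ENNReal.ofReal (levyDensity t r)

lemma isProbabilityMeasure_levyMeasure {t : ℝ} (ht : 0 < t) :
    IsProbabilityMeasure (levyMeasure t) := by
  refine ⟨?_⟩
  rw [levyMeasure, withDensity_apply _ MeasurableSet.univ, Measure.restrict_univ,
    lintegral_levyDensity ht]

instance (t : ℝ) : SFinite (levyMeasure t) := by unfold levyMeasure; infer_instance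

lemma ae_levyMeasure_pos (t : ℝ) : ∀ᵐ r ∂levyMeasure t, 0 < r :=
  (withDensity_absolutelyContinuous _ _).ae_le (self_mem_ae_restrict measurableSet_Ioi)

lemma ae_levyDensity_nonneg {t : ℝ} (ht : 0 ≤ t) :
    ∀ᵐ r ∂(volume.restrict (Ioi (0 : ℝ))), 0 ≤ levyDensity t r := by
  filter_upwards [self_mem_ae_restrict measurableSet_Ioi] with r hr
  exact levyDensity_nonneg ht hr

lemma integral_levyMeasure {F : Type*} [NormedAddCommGroup F] [NormedSpace ℝ F] {t : ℝ}
    (ht : 0 ≤ t) (H : ℝ → F) :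
    ∫ r, H r ∂levyMeasure t = ∫ r in Ioi 0, levyDensity t r • H r :=
  integral_withDensity_ofReal (measurable_levyDensity t) (ae_levyDensity_nonneg ht) H

lemma lintegral_levyMeasure {t : ℝ} {H : ℝ → ENNReal} (hH : Measurable H) :
    ∫⁻ r, H r ∂levyMeasure t = ∫⁻ r in Ioi 0, ENNReal.ofReal (levyDensity t r) * H r := by
  rw [levyMeasure, lintegral_withDensity_eq_lintegral_mul _
    (measurable_levyDensity t).ennreal_ofReal hH]
  rfl

lemma lintegral_lintegral_levyMeasure {a : ℝ} (ha : 0 < a) {H : ℝ → ENNReal} (hH : Measurable H) :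
    ∫⁻ r, ∫⁻ s, H (r + s) ∂levyMeasure a ∂levyMeasure a = ∫⁻ u, H u ∂levyMeasure (2 * a) := by
  set k : ℝ → ENNReal := (Ioi 0).indicator fun r => ENNReal.ofReal (levyDensity a r) with hk
  have hkm : Measurable k := (measurable_levyDensity a).ennreal_ofReal.indicator measurableSet_Ioi
  have hlin : ∀ G : ℝ → ENNReal, Measurable G → ∫⁻ r, G r ∂levyMeasure a = ∫⁻ r, k r * G r := by
    intro G hG
    rw [lintegral_levyMeasure hG, ← lintegral_indicator measurableSet_Ioi]
    refine lintegral_congr fun r => ?_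
    simp only [hk, indicator]
    split_ifs <;> simp
  have h1 : ∀ r, ∫⁻ s, H (r + s) ∂levyMeasure a = ∫⁻ u, k (u - r) * H u := by
    intro r
    rw [hlin _ (by fun_prop), ← lintegral_add_left_eq_self (fun u => k (u - r) * H u) r]
    simp
  simp only [h1]
  rw [hlin _ (by fun_prop), lintegral_levyMeasure hH, ← lintegral_indicator measurableSet_Ioi]
  have h2 : ∀ r, k r * ∫⁻ u, k (u - r) * H u = ∫⁻ u, k r * (k (u - r) * H u) := fun r =>
    (lintegral_const_mul _ (by fun_prop)).symm
  simp only [h2]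
  rw [lintegral_lintegral_swap (by fun_prop)]
  refine lintegral_congr fun u => ?_
  have h3 : ∫⁻ r, k r * (k (u - r) * H u) = (∫⁻ r, k r * k (u - r)) * H u := by
    rw [← lintegral_mul_const _ (by fun_prop)]
    simp only [mul_assoc]
  rw [h3]
  have h4 : ∀ r, k r * k (u - r) = (Ioo 0 u).indicator (fun r =>
      ENNReal.ofReal (levyDensity a r) * ENNReal.ofReal (levyDensity a (u - r))) r := by
    intro r
    by_cases hr : 0 < r <;> by_cases hu : r < u <;> simp [hk, indicator, hr, hu]
  simp only [h4]
  rw [lintegral_indicator measurableSet_Ioo]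
  by_cases hu : 0 < u
  · rw [lintegral_levyDensity_conv_self ha hu, indicator_of_mem (show u ∈ Ioi 0 from hu)]
  · rw [Ioo_eq_empty hu, indicator_of_notMem (show u ∉ Ioi 0 from hu)]
    simp

/-- The Ornstein-Uhlenbeck flow: the value at time `p.1`, started at `x` and driven by the Gaussian
variable `p.2`. -/
def ouFlow (x : EuclideanSpace ℝ (Fin n)) (p : ℝ × EuclideanSpace ℝ (Fin n)) :
    EuclideanSpace ℝ (Fin n) :=
  Real.exp (-p.1) • x + √(1 - Real.exp (-p.1) ^ 2) • p.2

lemma continuous_ouFlow : Continuous fun q : EuclideanSpace ℝ (Fin n) ×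
    (ℝ × EuclideanSpace ℝ (Fin n)) => ouFlow q.1 q.2 := by
  unfold ouFlow; fun_prop

@[fun_prop]
lemma measurable_ouFlow (x : EuclideanSpace ℝ (Fin n)) : Measurable (ouFlow x) := by
  unfold ouFlow; fun_prop

lemma one_sub_exp_sq_pos {r : ℝ} (hr : 0 < r) : 0 < 1 - Real.exp (-r) ^ 2 := by
  have h1 : Real.exp (-r) < 1 := by rw [Real.exp_lt_one_iff]; linarith
  nlinarith [Real.exp_pos (-r)]

lemma one_sub_exp_sq_nonneg {r : ℝ} (hr : 0 ≤ r) : 0 ≤ 1 - Real.exp (-r) ^ 2 := by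
  have h1 : Real.exp (-r) ≤ 1 := Real.exp_le_one_iff.2 (by linarith)
  nlinarith [Real.exp_pos (-r)]

lemma mehlerKernel_nonneg {ρ : ℝ} (hρ : ρ ^ 2 ≤ 1) (x y : EuclideanSpace ℝ (Fin n)) :
    0 ≤ mehlerKernel ρ x y := by
  have : 0 ≤ 1 - ρ ^ 2 := by linarith
  unfold mehlerKernel; positivity

lemma exp_neg_sq_le_one {r : ℝ} (hr : 0 ≤ r) : Real.exp (-r) ^ 2 ≤ 1 := by
  linarith [one_sub_exp_sq_nonneg hr]

/-- The law of the Ornstein-Uhlenbeck flow at time `r` has the Mehler kernel as its density. -/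
lemma lintegral_gaussMeasure_ouFlow (x : EuclideanSpace ℝ (Fin n)) {r : ℝ} (hr : 0 < r)
    {G : EuclideanSpace ℝ (Fin n) → ENNReal} (hG : Measurable G) :
    ∫⁻ z, G (ouFlow x (r, z)) ∂gaussMeasure n =
      ∫⁻ y, ENNReal.ofReal (Real.pi ^ (-((n : ℝ) / 2)) * mehlerKernel (Real.exp (-r)) x y) *
        G y := by
  have h0 := one_sub_exp_sq_pos hr
  simp only [ouFlow]
  rw [lintegral_gaussMeasure_comp_add_smul _ (Real.sqrt_pos.2 h0) hG]
  refine lintegral_congr fun y => ?_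
  rw [Real.sq_sqrt h0.le, mehlerKernel, Real.sqrt_eq_rpow, ← Real.rpow_mul_natCast h0.le]
  congr 5
  ring

lemma inv_one_sub_exp_sq_le {r : ℝ} (hr : 0 < r) :
    (1 - Real.exp (-r) ^ 2)⁻¹ ≤ (1 + r) / r := by
  rw [inv_le_comm₀ (one_sub_exp_sq_pos hr) (by positivity), inv_div]
  have h1 : Real.exp (-r) ≤ (1 + r)⁻¹ := by
    rw [Real.exp_neg]
    gcongr
    linarith [Real.add_one_le_exp r]
  have h2 : r / (1 + r) = 1 - (1 + r)⁻¹ := by field_simp; ring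
  rw [h2]
  have h3 : Real.exp (-r) ≤ 1 := Real.exp_le_one_iff.2 (by linarith)
  nlinarith [Real.exp_pos (-r)]

lemma inv_one_sub_exp_sq_rpow_le (n : ℕ) {r : ℝ} (hr : 0 < r) :
    ((1 - Real.exp (-r) ^ 2) ^ ((n : ℝ) / 2))⁻¹ ≤ ((1 + r) / r) ^ n := by
  have h0 := one_sub_exp_sq_pos hr
  have h1 := one_le_one_add_div hr
  rw [← Real.inv_rpow h0.le, ← Real.rpow_natCast ((1 + r) / r) n]
  calc _ ≤ ((1 + r) / r) ^ ((n : ℝ) / 2) :=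
        Real.rpow_le_rpow (inv_nonneg.2 h0.le) (inv_one_sub_exp_sq_le hr) (by positivity)
    _ ≤ _ := by
        apply Real.rpow_le_rpow_of_exponent_le h1
        linarith [(Nat.cast_nonneg n : (0 : ℝ) ≤ n)]

lemma mehlerKernel_le (x y : EuclideanSpace ℝ (Fin n)) {r : ℝ} (hr : 0 < r) :
    mehlerKernel (Real.exp (-r)) x y ≤ ((1 + r) / r) ^ n := by
  have h0 := one_sub_exp_sq_pos hr
  refine le_trans ?_ (inv_one_sub_exp_sq_rpow_le n hr)
  rw [mehlerKernel, div_eq_mul_inv]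
  refine mul_le_of_le_one_left (by positivity) (Real.exp_le_one_iff.2 ?_)
  rw [neg_nonpos]; positivity

lemma poissonKernel_eq (t : ℝ) (x y : EuclideanSpace ℝ (Fin n)) :
    poissonKernel t x y = ∫ r in Ioi (0 : ℝ), Real.pi ^ (-((n : ℝ) / 2)) *
      (levyDensity t r * mehlerKernel (Real.exp (-r)) x y) := by
  rw [poissonKernel, ← integral_const_mul]
  refine integral_congr_ae (Eventually.of_forall fun r => ?_)
  simp only [levyDensity]
  have h : 1 / (2 * Real.pi ^ (((n : ℝ) + 1) / 2)) =
      Real.pi ^ (-((n : ℝ) / 2)) * (1 / (2 * √Real.pi)) := by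
    rw [add_div, Real.rpow_add Real.pi_pos, Real.rpow_neg Real.pi_pos.le, Real.sqrt_eq_rpow]
    field_simp
  rw [h]; ring

lemma integrableOn_levyDensity_mul_pow {t : ℝ} (ht : 0 < t) (m : ℕ) :
    IntegrableOn (fun r => levyDensity t r * ((1 + r) / r) ^ m) (Ioi 0) := by
  obtain ⟨C, -, h⟩ := exists_levyDensity_mul_pow_le m ht le_rfl
  refine Integrable.mono' ((integrableOn_add_one_rpow (a := -(3 / 2)) (by norm_num)).const_mul C)
    ((measurable_levyDensity t).mul (by fun_prop)).aestronglyMeasurable ?_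
  filter_upwards [self_mem_ae_restrict measurableSet_Ioi] with r hr
  have hr' : 0 < r := hr
  rw [Real.norm_of_nonneg (mul_nonneg (levyDensity_nonneg ht.le hr') (by positivity))]
  exact h t ⟨le_rfl, le_rfl⟩ r hr

lemma integrableOn_levyDensity_mul_mehlerKernel {t : ℝ} (ht : 0 < t)
    (x y : EuclideanSpace ℝ (Fin n)) :
    IntegrableOn (fun r => levyDensity t r * mehlerKernel (Real.exp (-r)) x y) (Ioi 0) := by
  refine Integrable.mono' (integrableOn_levyDensity_mul_pow ht n)
    ((measurable_levyDensity t).mul (by unfold mehlerKernel; fun_prop)).aestronglyMeasurable ?_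
  filter_upwards [self_mem_ae_restrict measurableSet_Ioi] with r hr
  have hr' : 0 < r := hr
  have h1 := levyDensity_nonneg ht.le hr'
  rw [Real.norm_of_nonneg (mul_nonneg h1 (mehlerKernel_nonneg (exp_neg_sq_le_one hr'.le) x y))]
  gcongr
  exact mehlerKernel_le x y hr'

lemma poissonKernel_nonneg {t : ℝ} (ht : 0 ≤ t) (x y : EuclideanSpace ℝ (Fin n)) :
    0 ≤ poissonKernel t x y := by
  rw [poissonKernel_eq]
  refine setIntegral_nonneg measurableSet_Ioi fun r hr => ?_
  have hr' : 0 < r := hr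
  have := mehlerKernel_nonneg (exp_neg_sq_le_one hr'.le) x y
  have := levyDensity_nonneg ht hr'
  positivity

lemma measurable_poissonKernel (t : ℝ) : Measurable fun q : EuclideanSpace ℝ (Fin n) ×
    EuclideanSpace ℝ (Fin n) => poissonKernel t q.1 q.2 := by
  simp only [poissonKernel_eq]
  refine (StronglyMeasurable.integral_prod_right (f := fun (q : EuclideanSpace ℝ (Fin n) ×
    EuclideanSpace ℝ (Fin n)) (r : ℝ) => Real.pi ^ (-((n : ℝ) / 2)) *
      (levyDensity t r * mehlerKernel (Real.exp (-r)) q.1 q.2)) ?_).measurable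
  refine Measurable.stronglyMeasurable ?_
  have := measurable_levyDensity t
  simp only [Function.uncurry_def, mehlerKernel]
  fun_prop

lemma measurable_poissonKernel_right (t : ℝ) (x : EuclideanSpace ℝ (Fin n)) :
    Measurable (poissonKernel t x) := by
  have h : Measurable fun y : EuclideanSpace ℝ (Fin n) => (x, y) := measurable_prodMk_left
  have h2 := (measurable_poissonKernel t).comp h
  simpa only [Function.comp_def] using h2

lemma ofReal_poissonKernel {t : ℝ} (ht : 0 < t) (x y : EuclideanSpace ℝ (Fin n)) :
    ENNReal.ofReal (poissonKernel t x y) = ∫⁻ r in Ioi (0 : ℝ), ENNReal.ofReal (levyDensity t r) *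
      ENNReal.ofReal (Real.pi ^ (-((n : ℝ) / 2)) * mehlerKernel (Real.exp (-r)) x y) := by
  rw [poissonKernel_eq, ofReal_integral_eq_lintegral_ofReal
    ((integrableOn_levyDensity_mul_mehlerKernel ht x y).const_mul _)]
  · refine setLIntegral_congr_fun measurableSet_Ioi fun r hr => ?_
    have hr' : 0 < r := hr
    rw [← ENNReal.ofReal_mul (levyDensity_nonneg ht.le hr')]
    congr 1; ring
  · filter_upwards [self_mem_ae_restrict measurableSet_Ioi] with r hr
    have hr' : 0 < r := hr
    have := mehlerKernel_nonneg (exp_neg_sq_le_one hr'.le) x y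
    have := levyDensity_nonneg ht.le hr'
    simp only [Pi.zero_apply]; positivity

/-- The measure on `ℝⁿ` with density `P_t(x, ·)`. -/
def poissonMeasure (t : ℝ) (x : EuclideanSpace ℝ (Fin n)) : Measure (EuclideanSpace ℝ (Fin n)) :=
  volume.withDensity fun y => ENNReal.ofReal (poissonKernel t x y)

/-- The Poisson measure is the law of the Ornstein-Uhlenbeck flow at an independent Lévy time. -/
lemma map_ouFlow_eq_poissonMeasure {t : ℝ} (ht : 0 < t) (x : EuclideanSpace ℝ (Fin n)) :
    ((levyMeasure t).prod (gaussMeasure n)).map (ouFlow x) = poissonMeasure t x := by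
  refine Measure.ext_of_lintegral _ fun G hG => ?_
  have hGx : Measurable fun p => G (ouFlow x p) := hG.comp (measurable_ouFlow x)
  rw [lintegral_map hG (measurable_ouFlow x), lintegral_prod _ hGx.aemeasurable,
    lintegral_levyMeasure hGx.lintegral_prod_right', poissonMeasure,
    lintegral_withDensity_eq_lintegral_mul _
      (measurable_poissonKernel_right t x).ennreal_ofReal hG]
  have hm := measurable_levyDensity t
  have h1 : ∀ y, (((fun y => ENNReal.ofReal (poissonKernel t x y)) * G) y) =
      ∫⁻ r in Ioi (0 : ℝ), ENNReal.ofReal (levyDensity t r) *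
      (ENNReal.ofReal (Real.pi ^ (-((n : ℝ) / 2)) * mehlerKernel (Real.exp (-r)) x y) * G y) := by
    intro y
    rw [Pi.mul_apply, ofReal_poissonKernel ht, ← lintegral_mul_const]
    · simp only [mul_assoc]
    · unfold mehlerKernel; fun_prop
  simp only [h1]
  rw [lintegral_lintegral_swap]
  · refine setLIntegral_congr_fun measurableSet_Ioi fun r hr => ?_
    have hr' : 0 < r := hr
    rw [lintegral_gaussMeasure_ouFlow x hr' hG, lintegral_const_mul]
    unfold mehlerKernel; fun_prop
  · unfold mehlerKernel; fun_prop

lemma isProbabilityMeasure_poissonMeasure {t : ℝ} (ht : 0 < t) (x : EuclideanSpace ℝ (Fin n)) :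
    IsProbabilityMeasure (poissonMeasure t x) := by
  have := isProbabilityMeasure_levyMeasure ht
  rw [← map_ouFlow_eq_poissonMeasure ht x]
  exact Measure.isProbabilityMeasure_map (measurable_ouFlow x).aemeasurable

lemma poissonMeasure_absolutelyContinuous (t : ℝ) (x : EuclideanSpace ℝ (Fin n)) :
    poissonMeasure t x ≪ volume := withDensity_absolutelyContinuous _ _

/-- The Mehler semigroup `T_r f(x) = ∫ f(e^{-r} x + √(1 - e^{-2r}) z) dγ(z)`. -/
def ouSemigroup {F : Type*} [NormedAddCommGroup F] [NormedSpace ℝ F] (r : ℝ)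
    (f : EuclideanSpace ℝ (Fin n) → F) (x : EuclideanSpace ℝ (Fin n)) : F :=
  ∫ z, f (ouFlow x (r, z)) ∂gaussMeasure n

section

variable {𝕜 : Type*} [RCLike 𝕜] {f : EuclideanSpace ℝ (Fin n) → 𝕜}

lemma poissonIntegral_eq_integral_poissonMeasure {t : ℝ} (ht : 0 ≤ t)
    (f : EuclideanSpace ℝ (Fin n) → 𝕜) (x : EuclideanSpace ℝ (Fin n)) :
    poissonIntegral t f x = ∫ y, f y ∂poissonMeasure t x :=
  (integral_withDensity_ofReal (measurable_poissonKernel_right t x)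
    (Eventually.of_forall fun y => poissonKernel_nonneg ht x y) f).symm

lemma integrable_poissonMeasure_iff {t : ℝ} (ht : 0 ≤ t) (x : EuclideanSpace ℝ (Fin n)) :
    Integrable f (poissonMeasure t x) ↔ Integrable fun y => poissonKernel t x y • f y :=
  integrable_withDensity_ofReal_iff (measurable_poissonKernel_right t x)
    (Eventually.of_forall fun y => poissonKernel_nonneg ht x y)

lemma integrable_comp_ouFlow_iff {t : ℝ} (ht : 0 < t) (hf : AEStronglyMeasurable f volume)
    (x : EuclideanSpace ℝ (Fin n)) :
    Integrable (fun p => f (ouFlow x p)) ((levyMeasure t).prod (gaussMeasure n)) ↔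
      Integrable f (poissonMeasure t x) := by
  rw [← map_ouFlow_eq_poissonMeasure ht x, integrable_map_measure _ (by fun_prop)]
  · rfl
  · rw [map_ouFlow_eq_poissonMeasure ht x]
    exact hf.mono_ac (poissonMeasure_absolutelyContinuous t x)

lemma poissonIntegral_eq_integral_ouFlow {t : ℝ} (ht : 0 < t) (hf : AEStronglyMeasurable f volume)
    (x : EuclideanSpace ℝ (Fin n)) :
    poissonIntegral t f x = ∫ p, f (ouFlow x p) ∂(levyMeasure t).prod (gaussMeasure n) := by
  rw [poissonIntegral_eq_integral_poissonMeasure ht.le, ← map_ouFlow_eq_poissonMeasure ht x,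
    integral_map (by fun_prop)]
  rw [map_ouFlow_eq_poissonMeasure ht x]
  exact hf.mono_ac (poissonMeasure_absolutelyContinuous t x)

lemma poissonIntegral_eq_integral_ouSemigroup {t : ℝ} (ht : 0 < t)
    (hf : AEStronglyMeasurable f volume) {x : EuclideanSpace ℝ (Fin n)}
    (hfi : Integrable f (poissonMeasure t x)) :
    poissonIntegral t f x = ∫ r in Ioi 0, levyDensity t r • ouSemigroup r f x := by
  rw [poissonIntegral_eq_integral_ouFlow ht hf,
    integral_prod _ ((integrable_comp_ouFlow_iff ht hf x).2 hfi), integral_levyMeasure ht.le]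
  rfl

lemma stronglyMeasurable_poissonIntegral {t : ℝ} (f : EuclideanSpace ℝ (Fin n) → 𝕜)
    (hf : StronglyMeasurable f) : StronglyMeasurable (poissonIntegral t f) := by
  refine StronglyMeasurable.integral_prod_right (f := fun x y => poissonKernel t x y • f y) ?_
  exact (measurable_poissonKernel t).stronglyMeasurable.smul
    (hf.comp_measurable measurable_snd)

lemma lintegral_ouFlow_ouFlow (x : EuclideanSpace ℝ (Fin n)) {r s : ℝ} (hr : 0 ≤ r) (hs : 0 ≤ s)
    {G : EuclideanSpace ℝ (Fin n) → ENNReal} (hG : Measurable G) :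
    ∫⁻ z, ∫⁻ w, G (ouFlow (ouFlow x (r, z)) (s, w)) ∂gaussMeasure n ∂gaussMeasure n =
      ∫⁻ z, G (ouFlow x (r + s, z)) ∂gaussMeasure n := by
  have h0 := one_sub_exp_sq_nonneg hr
  have h1 := one_sub_exp_sq_nonneg hs
  have h2 := one_sub_exp_sq_nonneg (add_nonneg hr hs)
  have h3 : Real.exp (-(r + s)) = Real.exp (-r) * Real.exp (-s) := by
    rw [← Real.exp_add]; ring_nf
  have h := lintegral_lintegral_gaussMeasure (n := n)
    (a := Real.exp (-s) * √(1 - Real.exp (-r) ^ 2)) (b := √(1 - Real.exp (-s) ^ 2))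
    (c := √(1 - Real.exp (-(r + s)) ^ 2)) (G := fun y => G (Real.exp (-(r + s)) • x + y))
    (by rw [mul_pow, Real.sq_sqrt h0, Real.sq_sqrt h1, Real.sq_sqrt h2, h3]; ring) (by fun_prop)
  simp only [ouFlow]
  rw [← h]
  refine lintegral_congr fun z => lintegral_congr fun w => ?_
  congr 1
  rw [h3, smul_add, smul_smul, smul_smul, mul_comm (Real.exp (-s)), add_assoc]

/-- The flow over time `r` followed by an independent flow over time `s` has the law of the flow
over time `r + s`. -/
lemma map_ouFlow_ouFlow (x : EuclideanSpace ℝ (Fin n)) {r s : ℝ} (hr : 0 ≤ r) (hs : 0 ≤ s) :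
    ((gaussMeasure n).prod (gaussMeasure n)).map
      (fun p => ouFlow (ouFlow x (r, p.1)) (s, p.2)) =
    (gaussMeasure n).map fun z => ouFlow x (r + s, z) := by
  refine Measure.ext_of_lintegral _ fun G hG => ?_
  have hm : Measurable fun p : EuclideanSpace ℝ (Fin n) × EuclideanSpace ℝ (Fin n) =>
    ouFlow (ouFlow x (r, p.1)) (s, p.2) := by unfold ouFlow; fun_prop
  have hGm : Measurable fun p : EuclideanSpace ℝ (Fin n) × EuclideanSpace ℝ (Fin n) =>
    G (ouFlow (ouFlow x (r, p.1)) (s, p.2)) := hG.comp hm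
  rw [lintegral_map hG hm, lintegral_map hG (by fun_prop),
    lintegral_prod _ hGm.aemeasurable, lintegral_ouFlow_ouFlow x hr hs hG]

/-- The semigroup law of the Poisson integral, for equal times. -/
lemma poissonIntegral_poissonIntegral {a : ℝ} (ha : 0 < a) (hf : StronglyMeasurable f)
    {x : EuclideanSpace ℝ (Fin n)} (hfi : Integrable f (poissonMeasure (2 * a) x)) :
    poissonIntegral a (poissonIntegral a f) x = poissonIntegral (2 * a) f x := by
  set μ := (levyMeasure a).prod (gaussMeasure n) with hμ
  have hΨ : Measurable fun q : (ℝ × EuclideanSpace ℝ (Fin n)) × (ℝ × EuclideanSpace ℝ (Fin n)) =>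
      ouFlow (ouFlow x q.1) q.2 :=
    continuous_ouFlow.measurable.comp (((measurable_ouFlow x).comp measurable_fst).prodMk
      measurable_snd)
  have hmap : (μ.prod μ).map (fun q => ouFlow (ouFlow x q.1) q.2) = poissonMeasure (2 * a) x := by
    rw [← map_ouFlow_eq_poissonMeasure (by positivity) x]
    refine Measure.ext_of_lintegral _ fun G hG => ?_
    rw [lintegral_map hG hΨ, lintegral_map hG (measurable_ouFlow x)]
    have hGΨ : Measurable fun q : (ℝ × EuclideanSpace ℝ (Fin n)) ×
      (ℝ × EuclideanSpace ℝ (Fin n)) => G (ouFlow (ouFlow x q.1) q.2) := hG.comp hΨ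
    have hGx : Measurable fun p => G (ouFlow x p) := hG.comp (measurable_ouFlow x)
    rw [lintegral_prod _ hGΨ.aemeasurable, hμ,
      lintegral_prod _ hGΨ.lintegral_prod_right'.aemeasurable,
      lintegral_prod _ hGx.aemeasurable,
      ← lintegral_lintegral_levyMeasure ha hGx.lintegral_prod_right']
    refine lintegral_congr_ae ?_
    filter_upwards [ae_levyMeasure_pos a] with r hr
    have h1 : ∀ z, ∫⁻ q, G (ouFlow (ouFlow x (r, z)) q) ∂(levyMeasure a).prod (gaussMeasure n) =
        ∫⁻ s, ∫⁻ w, G (ouFlow (ouFlow x (r, z)) (s, w)) ∂gaussMeasure n ∂levyMeasure a := fun z =>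
      lintegral_prod _ (hG.comp (measurable_ouFlow _)).aemeasurable
    simp only [h1]
    rw [lintegral_lintegral_swap]
    · refine lintegral_congr_ae ?_
      filter_upwards [ae_levyMeasure_pos a] with s hs
      exact lintegral_ouFlow_ouFlow x hr.le hs.le hG
    · have h2 : Measurable fun p : (EuclideanSpace ℝ (Fin n) × ℝ) × EuclideanSpace ℝ (Fin n) =>
          G (ouFlow (ouFlow x (r, p.1.1)) (p.1.2, p.2)) := by
        refine hG.comp ?_
        unfold ouFlow; fun_prop
      exact h2.lintegral_prod_right'.aemeasurable
  have hint : Integrable (fun q => f (ouFlow (ouFlow x q.1) q.2)) (μ.prod μ) := by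
    rw [← hmap, integrable_map_measure hf.aestronglyMeasurable hΨ.aemeasurable] at hfi
    exact hfi
  rw [poissonIntegral_eq_integral_ouFlow ha
    (stronglyMeasurable_poissonIntegral f hf).aestronglyMeasurable,
    poissonIntegral_eq_integral_poissonMeasure (by positivity), ← hmap,
    integral_map hΨ.aemeasurable hf.aestronglyMeasurable, integral_prod _ hint]
  refine integral_congr_ae (Eventually.of_forall fun p => ?_)
  exact poissonIntegral_eq_integral_ouFlow ha hf.aestronglyMeasurable _

end

/-! ### From the pointwise condition to the derivative bound -/

section

variable {𝕜 : Type*} [RCLike 𝕜] {g : EuclideanSpace ℝ (Fin n) → 𝕜}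

lemma parallelPart_smul_self (x : EuclideanSpace ℝ (Fin n)) (c : ℝ) :
    parallelPart x (c • x) = c • x := by
  unfold parallelPart
  split_ifs with h
  · rfl
  · have hx : ‖x‖ ≠ 0 := fun h0 => h (Or.inl (norm_eq_zero.1 h0))
    rw [inner_smul_right, real_inner_self_eq_norm_sq, mul_div_assoc, div_self (by positivity),
      mul_one]

lemma orthogonalPart_smul_self (x : EuclideanSpace ℝ (Fin n)) (c : ℝ) :
    orthogonalPart x (c • x) = 0 := by
  rw [orthogonalPart, parallelPart_smul_self, sub_self]

lemma logDist_nonneg (x y : EuclideanSpace ℝ (Fin n)) : 0 ≤ logDist x y := abs_nonneg _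

lemma logDist_exp_smul_le (x : EuclideanSpace ℝ (Fin n)) {r : ℝ} (hr : 0 ≤ r) :
    logDist x (Real.exp (-r) • x) ≤ r := by
  have hρ : Real.exp (-r) ≤ 1 := Real.exp_le_one_iff.2 (by linarith)
  have hρ0 := Real.exp_pos (-r)
  have h0 := norm_nonneg x
  have hinner : 0 ≤ inner ℝ x (Real.exp (-r) • x) := by
    rw [inner_smul_right, real_inner_self_eq_norm_sq]; positivity
  rw [logDist, parallelPart_smul_self, sgn, if_pos hinner, one_mul, norm_smul,
    Real.norm_of_nonneg hρ0.le]
  have h1 : Real.log (1 + Real.exp (-r) * ‖x‖) ≤ Real.log (1 + ‖x‖) := by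
    apply Real.log_le_log (by positivity); nlinarith
  rw [abs_of_nonneg (by linarith)]
  have h2 : Real.log (1 + ‖x‖) ≤ Real.log (Real.exp r * (1 + Real.exp (-r) * ‖x‖)) := by
    apply Real.log_le_log (by positivity)
    have : Real.exp r * Real.exp (-r) = 1 := by rw [← Real.exp_add]; simp
    have h3 : 1 ≤ Real.exp r := Real.one_le_exp hr
    calc 1 + ‖x‖ ≤ Real.exp r + ‖x‖ := by linarith
      _ = Real.exp r + (Real.exp r * Real.exp (-r)) * ‖x‖ := by rw [this, one_mul]
      _ = _ := by ring
  rw [Real.log_mul (Real.exp_pos _).ne' (by positivity), Real.log_exp] at h2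
  linarith

lemma PointwiseLip.norm_sub_le {α K : ℝ} (hK : 0 ≤ K) (h : PointwiseLip α g K)
    (x y : EuclideanSpace ℝ (Fin n)) : ‖g x - g y‖ ≤ K * ‖x - y‖ ^ α :=
  (h x y).trans (mul_le_mul_of_nonneg_left (min_le_left _ _) hK)

lemma PointwiseLip.norm_sub_exp_smul_le {α K : ℝ} (hα : 0 < α) (hK : 0 ≤ K)
    (h : PointwiseLip α g K) (x : EuclideanSpace ℝ (Fin n)) {r : ℝ} (hr : 0 ≤ r) :
    ‖g x - g (Real.exp (-r) • x)‖ ≤ K * r ^ (α / 2) := by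
  refine (h x _).trans (mul_le_mul_of_nonneg_left ((min_le_right _ _).trans ?_) hK)
  rw [orthogonalPart_smul_self, norm_zero, Real.zero_rpow hα.ne', add_zero]
  exact Real.rpow_le_rpow (logDist_nonneg _ _) (logDist_exp_smul_le x hr) (by positivity)

lemma continuous_of_norm_sub_le_rpow {α K : ℝ} (hα : 0 < α)
    (h : ∀ x y, ‖g x - g y‖ ≤ K * ‖x - y‖ ^ α) : Continuous g := by
  refine continuous_iff_continuousAt.2 fun x => ?_
  rw [ContinuousAt, tendsto_iff_norm_sub_tendsto_zero]
  refine squeeze_zero (fun y => norm_nonneg _) (fun y => h y x) ?_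
  have h1 : Continuous fun y : EuclideanSpace ℝ (Fin n) => K * ‖y - x‖ ^ α :=
    continuous_const.mul ((continuous_id.sub continuous_const).norm.rpow_const
      fun _ => Or.inr hα.le)
  have h2 := h1.tendsto x
  simpa [Real.zero_rpow hα.ne'] using h2

lemma one_sub_exp_sq_le {r : ℝ} : 1 - Real.exp (-r) ^ 2 ≤ 2 * r := by
  rw [← Real.exp_nat_mul]
  have := Real.add_one_le_exp (((2 : ℕ) : ℝ) * -r)
  push_cast at this ⊢
  linarith

lemma norm_sqrt_smul_rpow_le {α : ℝ} (hα0 : 0 < α) (hα1 : α < 1) {r : ℝ} (hr : 0 ≤ r)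
    (z : EuclideanSpace ℝ (Fin n)) :
    ‖√(1 - Real.exp (-r) ^ 2) • z‖ ^ α ≤ 2 * r ^ (α / 2) * ‖z‖ ^ α := by
  rw [norm_smul, Real.norm_of_nonneg (Real.sqrt_nonneg _),
    Real.mul_rpow (Real.sqrt_nonneg _) (norm_nonneg _)]
  gcongr
  calc √(1 - Real.exp (-r) ^ 2) ^ α ≤ √(2 * r) ^ α := by
        gcongr; exact one_sub_exp_sq_le
    _ = 2 ^ (α / 2) * r ^ (α / 2) := by
        rw [Real.sqrt_eq_rpow, ← Real.rpow_mul (by positivity), Real.mul_rpow (by norm_num) hr]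
        ring_nf
    _ ≤ 2 * r ^ (α / 2) := by
        gcongr
        calc (2 : ℝ) ^ (α / 2) ≤ 2 ^ (1 : ℝ) :=
              Real.rpow_le_rpow_of_exponent_le (by norm_num) (by linarith)
          _ = 2 := Real.rpow_one 2

/-- The increments of `g` along the Ornstein-Uhlenbeck flow: the drift `x ↦ e^{-r} x` moves by at
most `r` in the logarithmic metric, and the diffusion by `√(2 r) |z|` in the Euclidean one. -/
lemma PointwiseLip.norm_ouFlow_sub_le {α K : ℝ} (hα0 : 0 < α) (hα1 : α < 1) (hK : 0 ≤ K)
    (h : PointwiseLip α g K) (x z : EuclideanSpace ℝ (Fin n)) {r : ℝ} (hr : 0 ≤ r) :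
    ‖g (ouFlow x (r, z)) - g x‖ ≤ K * (r ^ (α / 2) * (1 + 2 * ‖z‖ ^ α)) := by
  have h1 := h.norm_sub_exp_smul_le hα0 hK x hr
  have h2 := h.norm_sub_le hK (ouFlow x (r, z)) (Real.exp (-r) • x)
  have h3 : ouFlow x (r, z) - Real.exp (-r) • x = √(1 - Real.exp (-r) ^ 2) • z := by
    simp [ouFlow]
  rw [h3] at h2
  have h4 := mul_le_mul_of_nonneg_left (norm_sqrt_smul_rpow_le hα0 hα1 hr z) hK
  have h5 : g (ouFlow x (r, z)) - g x = (g (ouFlow x (r, z)) - g (Real.exp (-r) • x)) -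
    (g x - g (Real.exp (-r) • x)) := by abel
  rw [h5]
  refine (_root_.norm_sub_le _ _).trans ?_
  linarith

lemma integrable_rpow_levyMeasure {t β : ℝ} (ht : 0 < t) (hβ : β < 1 / 2) :
    Integrable (fun r => r ^ β) (levyMeasure t) := by
  rw [levyMeasure, integrable_withDensity_ofReal_iff (measurable_levyDensity t)
    (ae_levyDensity_nonneg ht.le)]
  exact integrableOn_levyDensity_mul_rpow ht hβ

lemma integrable_one_add_norm_rpow {α : ℝ} (hα0 : 0 < α) (hα1 : α < 1) :
    Integrable (fun z : EuclideanSpace ℝ (Fin n) => 1 + 2 * ‖z‖ ^ α) (gaussMeasure n) :=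
  (integrable_const _).add ((integrable_norm_rpow_gaussMeasure hα0.le hα1.le).const_mul 2)

lemma PointwiseLip.integrable_poissonMeasure {α K : ℝ} (hα0 : 0 < α) (hα1 : α < 1) (hK : 0 ≤ K)
    (h : PointwiseLip α g K) {t : ℝ} (ht : 0 < t) (x : EuclideanSpace ℝ (Fin n)) :
    Integrable g (poissonMeasure t x) := by
  have hg := continuous_of_norm_sub_le_rpow hα0 (h.norm_sub_le hK)
  have := isProbabilityMeasure_levyMeasure ht
  rw [← integrable_comp_ouFlow_iff ht hg.aestronglyMeasurable]
  have h1 : Integrable (fun p : ℝ × EuclideanSpace ℝ (Fin n) =>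
      p.1 ^ (α / 2) * (1 + 2 * ‖p.2‖ ^ α)) ((levyMeasure t).prod (gaussMeasure n)) :=
    (integrable_rpow_levyMeasure ht (by linarith)).mul_prod (integrable_one_add_norm_rpow hα0 hα1)
  refine Integrable.mono' ((integrable_const ‖g x‖).add (h1.const_mul K))
    (hg.measurable.comp (measurable_ouFlow x)).aestronglyMeasurable ?_
  have h2 : ∀ᵐ p ∂(levyMeasure t).prod (gaussMeasure n), 0 < p.1 :=
    Measure.quasiMeasurePreserving_fst.ae (ae_levyMeasure_pos t)
  filter_upwards [h2] with p hp
  have h3 := h.norm_ouFlow_sub_le hα0 hα1 hK x p.2 hp.le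
  simp only [Pi.add_apply]
  have h4 := norm_le_norm_add_norm_sub' (g (ouFlow x p)) (g x)
  linarith

lemma stronglyMeasurable_ouSemigroup (hg : StronglyMeasurable g)
    (x : EuclideanSpace ℝ (Fin n)) : StronglyMeasurable fun r => ouSemigroup r g x := by
  refine StronglyMeasurable.integral_prod_right (f := fun r z => g (ouFlow x (r, z))) ?_
  exact hg.comp_measurable (measurable_ouFlow x)

lemma PointwiseLip.norm_ouSemigroup_sub_le {α K : ℝ} (hα0 : 0 < α) (hα1 : α < 1) (hK : 0 ≤ K)
    (h : PointwiseLip α g K) (x : EuclideanSpace ℝ (Fin n)) {r : ℝ} (hr : 0 ≤ r) :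
    ‖ouSemigroup r g x - g x‖ ≤
      K * (∫ z, (1 + 2 * ‖z‖ ^ α) ∂gaussMeasure n) * r ^ (α / 2) := by
  have hg := continuous_of_norm_sub_le_rpow hα0 (h.norm_sub_le hK)
  have hb : Integrable (fun z : EuclideanSpace ℝ (Fin n) =>
      K * (r ^ (α / 2) * (1 + 2 * ‖z‖ ^ α))) (gaussMeasure n) :=
    ((integrable_one_add_norm_rpow hα0 hα1).const_mul _).const_mul _
  have hm : StronglyMeasurable fun z => g (ouFlow x (r, z)) :=
    hg.stronglyMeasurable.comp_measurable ((measurable_ouFlow x).comp measurable_prodMk_left)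
  have hi : Integrable (fun z => g (ouFlow x (r, z))) (gaussMeasure n) := by
    refine Integrable.mono' ((integrable_const ‖g x‖).add hb) hm.aestronglyMeasurable
      (Eventually.of_forall fun z => ?_)
    have h3 := h.norm_ouFlow_sub_le hα0 hα1 hK x z hr
    have h4 := norm_le_norm_add_norm_sub' (g (ouFlow x (r, z))) (g x)
    simp only [Pi.add_apply]
    linarith
  have h1 : ouSemigroup r g x - g x = ∫ z, (g (ouFlow x (r, z)) - g x) ∂gaussMeasure n := by
    rw [integral_sub hi (integrable_const _), ouSemigroup]
    simp
  rw [h1]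
  refine (norm_integral_le_of_norm_le hb
    (Eventually.of_forall fun z => h.norm_ouFlow_sub_le hα0 hα1 hK x z hr)).trans (le_of_eq ?_)
  rw [integral_const_mul, integral_const_mul]
  ring

lemma hasDerivAt_levyDensity_left {t r : ℝ} (ht : 0 < t) (hr : 0 < r) :
    HasDerivAt (fun t => levyDensity t r) ((1 / t - t / (2 * r)) * levyDensity t r) t := by
  have h1 : HasDerivAt (fun t : ℝ => -(t ^ 2 / (4 * r))) (-(2 * t / (4 * r))) t := by
    have := ((hasDerivAt_pow 2 t).div_const (4 * r)).neg
    simpa using! this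
  have h2 : HasDerivAt (fun t : ℝ => t / r ^ (3 / 2 : ℝ)) (1 / r ^ (3 / 2 : ℝ)) t :=
    (hasDerivAt_id t).div_const _
  refine ((h2.mul h1.exp).const_mul (1 / (2 * √Real.pi))).congr_deriv ?_
  rw [levyDensity]
  have : 0 < r ^ (3 / 2 : ℝ) := by positivity
  field_simp
  ring

/-- Differentiation of a subordinated function in the parameter of the Lévy distribution, and the
resulting bound when the function is `O(r^{α/2})`. -/
lemma exists_hasDerivAt_integral_levyDensity {α : ℝ} (hα0 : 0 < α) (hα1 : α < 1) (F : Type*)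
    [NormedAddCommGroup F] [NormedSpace ℝ F] :
    ∃ C : ℝ, 0 < C ∧ ∀ (B : ℝ) (H : ℝ → F), StronglyMeasurable H → 0 ≤ B →
      (∀ r, 0 < r → ‖H r‖ ≤ B * r ^ (α / 2)) → ∀ t : ℝ, 0 < t → ∃ d : F,
        HasDerivAt (fun t => ∫ r in Ioi 0, levyDensity t r • H r) d t ∧
        ‖t • d‖ ≤ C * B * t ^ α := by
  set m₁ : ℝ := ∫ r in Ioi 0, levyDensity 1 r * r ^ (α / 2) with hm₁
  set m₂ : ℝ := ∫ r in Ioi 0, levyDensity 1 r * r ^ (α / 2 - 1) with hm₂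
  have hnn : ∀ β : ℝ, 0 ≤ ∫ r in Ioi 0, levyDensity 1 r * r ^ β := fun β =>
    setIntegral_nonneg measurableSet_Ioi fun r hr => by
      have hr' : 0 < r := hr
      have := levyDensity_nonneg zero_le_one hr'
      positivity
  have hm₁0 : 0 ≤ m₁ := hnn _
  have hm₂0 : 0 ≤ m₂ := hnn _
  refine ⟨m₁ + m₂ / 2 + 1, by positivity, fun B H hH hB hHB t ht => ?_⟩
  have hmeas : ∀ s, AEStronglyMeasurable (fun r => levyDensity s r • H r)
      (volume.restrict (Ioi 0)) := fun s =>
    ((measurable_levyDensity s).stronglyMeasurable.smul hH).aestronglyMeasurable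
  have hint : IntegrableOn (fun r => levyDensity t r • H r) (Ioi 0) := by
    refine Integrable.mono' ((integrableOn_levyDensity_mul_rpow ht
      (β := α / 2) (by linarith)).const_mul B) (hmeas t) ?_
    filter_upwards [self_mem_ae_restrict measurableSet_Ioi] with r hr
    have h1 := levyDensity_nonneg ht.le hr
    rw [norm_smul, Real.norm_of_nonneg h1]
    calc _ ≤ levyDensity t r * (B * r ^ (α / 2)) := by gcongr; exact hHB r hr
      _ = _ := by ring
  have hbound : ∀ s, 0 < s → ∀ r, 0 < r →
      ‖((1 / s - s / (2 * r)) * levyDensity s r) • H r‖ ≤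
        B * (1 / s * (levyDensity s r * r ^ (α / 2)) +
          s / 2 * (levyDensity s r * r ^ (α / 2 - 1))) := by
    intro s hs r hr
    have h1 := levyDensity_nonneg hs.le hr
    have h2 : |1 / s - s / (2 * r)| ≤ 1 / s + s / (2 * r) := by
      refine (abs_sub _ _).trans (le_of_eq ?_)
      rw [abs_of_pos (by positivity), abs_of_pos (by positivity)]
    rw [norm_smul, norm_mul, Real.norm_eq_abs, Real.norm_of_nonneg h1, Real.rpow_sub hr,
      Real.rpow_one]
    calc _ ≤ (1 / s + s / (2 * r)) * levyDensity s r * (B * r ^ (α / 2)) := by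
          gcongr; exact hHB r hr
      _ = _ := by field_simp
  obtain ⟨C₁, hC₁, h₁⟩ := exists_levyDensity_mul_rpow_le (α / 2)
    (t₀ := t / 2) (t₁ := 2 * t) (by positivity) (by linarith)
  obtain ⟨C₂, hC₂, h₂⟩ := exists_levyDensity_mul_rpow_le (α / 2 - 1)
    (t₀ := t / 2) (t₁ := 2 * t) (by positivity) (by linarith)
  have hball : ∀ s ∈ Metric.ball t (t / 2), s ∈ Icc (t / 2) (2 * t) := by
    intro s hs
    rw [Metric.mem_ball, Real.dist_eq, abs_lt] at hs
    constructor <;> linarith [hs.1, hs.2]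
  have hderiv := hasDerivAt_integral_of_dominated_loc_of_deriv_le (𝕜 := ℝ)
    (μ := volume.restrict (Ioi (0 : ℝ))) (F := fun s r => levyDensity s r • H r)
    (F' := fun s r => ((1 / s - s / (2 * r)) * levyDensity s r) • H r)
    (x₀ := t) (s := Metric.ball t (t / 2))
    (bound := fun r => B * (2 / t * (C₁ * (r + 1) ^ (α / 2 - 3 / 2)) +
      t * (C₂ * (r + 1) ^ (α / 2 - 1 - 3 / 2))))
    (Metric.ball_mem_nhds t (by positivity)) (Eventually.of_forall hmeas) hint
    (by
      refine (StronglyMeasurable.smul ?_ hH).aestronglyMeasurable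
      have := measurable_levyDensity t
      exact Measurable.stronglyMeasurable (by fun_prop))
    (by
      filter_upwards [self_mem_ae_restrict measurableSet_Ioi] with r hr s hs
      have hs' := hball s hs
      have hs0 : 0 < s := by linarith [hs'.1]
      have hr' : 0 < r := hr
      refine (hbound s hs0 r hr).trans ?_
      have e1 : 1 / s ≤ 2 / t := by
        rw [div_le_div_iff₀ hs0 ht]; linarith [hs'.1]
      have e2 : s / 2 ≤ t := by linarith [hs'.2]
      have e3 := levyDensity_nonneg hs0.le hr'
      have e4 := h₁ s hs' r hr
      have e5 := h₂ s hs' r hr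
      refine mul_le_mul_of_nonneg_left (add_le_add ?_ ?_) hB
      · exact mul_le_mul e1 e4 (by positivity) (by positivity)
      · exact mul_le_mul e2 e5 (by positivity) (by positivity))
    (by
      refine Integrable.const_mul (Integrable.add ?_ ?_) _
      · exact ((integrableOn_add_one_rpow (by linarith)).const_mul _).const_mul _
      · exact ((integrableOn_add_one_rpow (by linarith)).const_mul _).const_mul _)
    (by
      filter_upwards [self_mem_ae_restrict measurableSet_Ioi] with r hr s hs
      exact (hasDerivAt_levyDensity_left (by linarith [(hball s hs).1]) hr).smul_const (H r))
  refine ⟨_, hderiv.2, ?_⟩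
  have hi₁ := integrableOn_levyDensity_mul_rpow ht (β := α / 2) (by linarith)
  have hi₂ := integrableOn_levyDensity_mul_rpow ht (β := α / 2 - 1) (by linarith)
  have hnorm : ‖∫ r in Ioi 0, ((1 / t - t / (2 * r)) * levyDensity t r) • H r‖ ≤
      B * (1 / t * (t ^ α * m₁) + t / 2 * (t ^ (α - 2) * m₂)) := by
    refine (norm_integral_le_of_norm_le
      (((hi₁.const_mul (1 / t)).add (hi₂.const_mul (t / 2))).const_mul B) ?_).trans (le_of_eq ?_)
    · filter_upwards [self_mem_ae_restrict measurableSet_Ioi] with r hr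
      exact hbound t ht r hr
    · simp only [Pi.add_apply]
      rw [integral_const_mul, integral_add (hi₁.const_mul _) (hi₂.const_mul _),
        integral_const_mul, integral_const_mul, integral_levyDensity_mul_rpow ht,
        integral_levyDensity_mul_rpow ht, ← hm₁, ← hm₂]
      ring_nf
  rw [norm_smul, Real.norm_of_nonneg ht.le]
  calc _ ≤ t * (B * (1 / t * (t ^ α * m₁) + t / 2 * (t ^ (α - 2) * m₂))) := by gcongr
    _ = (m₁ + m₂ / 2) * B * t ^ α := by
        rw [Real.rpow_sub ht, Real.rpow_two]; field_simp
    _ ≤ _ := mul_le_mul_of_nonneg_right (mul_le_mul_of_nonneg_right (by linarith) hB)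
        (by positivity)

lemma one_le_sqrt_log (a : ℝ) (ha : 0 ≤ a) : 1 ≤ √(Real.log (Real.exp 1 + a)) := by
  rw [Real.one_le_sqrt, Real.le_log_iff_exp_le (by positivity)]
  linarith

/-- By its Hölder continuity `g` grows at most like `|y|^α`, so the Gaussian factor alone suffices.
-/
lemma growthCondition_of_aePointwiseLip {α K : ℝ} (hα0 : 0 < α) (hα1 : α < 1) (hK : 0 ≤ K)
    {f : EuclideanSpace ℝ (Fin n) → 𝕜} (hf : AEPointwiseLip α f K) : GrowthCondition f := by
  obtain ⟨g, hgf, hg⟩ := hf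
  have hgc := continuous_of_norm_sub_le_rpow hα0 (hg.norm_sub_le hK)
  have h1 : Integrable (fun y : EuclideanSpace ℝ (Fin n) => Real.exp (-‖y‖ ^ 2) / √(Real.log
      (Real.exp 1 + ‖y‖)) * ‖g y‖) volume := by
    have h2 := integrable_gaussMeasure_iff.1 ((integrable_const ‖g 0‖).add
      ((integrable_norm_rpow_gaussMeasure (n := n) hα0.le hα1.le).const_mul K))
    refine Integrable.mono' (h2.const_mul (Real.pi ^ ((n : ℝ) / 2)))
      (Measurable.aestronglyMeasurable (by have := hgc.measurable; fun_prop))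
      (Eventually.of_forall fun y => ?_)
    have hs := one_le_sqrt_log ‖y‖ (norm_nonneg y)
    have h3 := hg.norm_sub_le hK y 0
    rw [sub_zero] at h3
    have h4 := norm_le_norm_add_norm_sub' (g y) (g 0)
    have h5 : Real.pi ^ ((n : ℝ) / 2) * Real.pi ^ (-((n : ℝ) / 2)) = 1 := by
      rw [← Real.rpow_add Real.pi_pos]; simp
    simp only [Pi.add_apply, smul_eq_mul]
    rw [Real.norm_of_nonneg (by positivity), ← mul_assoc, ← mul_assoc, h5, one_mul]
    calc _ ≤ Real.exp (-‖y‖ ^ 2) * ‖g y‖ := by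
          gcongr
          exact div_le_self (Real.exp_pos _).le hs
      _ ≤ _ := by gcongr; linarith
  refine h1.congr ?_
  filter_upwards [hgf] with y hy
  rw [hy]

lemma poissonIntegral_congr_ae {f g : EuclideanSpace ℝ (Fin n) → 𝕜} (h : g =ᵐ[volume] f) (t : ℝ) :
    poissonIntegral t g = poissonIntegral t f := by
  ext x
  refine integral_congr_ae ?_
  filter_upwards [h] with y hy
  rw [hy]

/-- The derivative bound: `P_t f(x) - f(x)` is the subordination of `T_r f(x) - f(x) = O(r^{α/2})`,
and the derivative in `t` falls on the Lévy density. -/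
theorem exists_poissonLipBound_of_aePointwiseLip (n : ℕ) (𝕜 : Type*) [RCLike 𝕜] {α : ℝ}
    (hα0 : 0 < α) (hα1 : α < 1) :
    ∃ C : ℝ, 0 < C ∧ ∀ (f : EuclideanSpace ℝ (Fin n) → 𝕜) (K : ℝ), 0 ≤ K →
      AEPointwiseLip α f K → PoissonLipBound α f (C * K) := by
  obtain ⟨C, hC, h⟩ := exists_hasDerivAt_integral_levyDensity hα0 hα1 𝕜
  set m : ℝ := ∫ z, (1 + 2 * ‖z‖ ^ α) ∂gaussMeasure n with hm
  have hm0 : 0 ≤ m := integral_nonneg fun z => by positivity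
  refine ⟨C * (m + 1), by positivity, fun f K hK hf t ht => ?_⟩
  obtain ⟨g, hgf, hg⟩ := hf
  have hgc := continuous_of_norm_sub_le_rpow hα0 (hg.norm_sub_le hK)
  have key : ∀ x, ∃ d : 𝕜, HasDerivAt (fun s => poissonIntegral s f x) d t ∧
      ‖t • d‖ ≤ C * (m + 1) * K * t ^ α := by
    intro x
    have hmeas := stronglyMeasurable_ouSemigroup hgc.stronglyMeasurable x
    obtain ⟨d, hd, hdn⟩ := h (K * m) (fun r => ouSemigroup r g x - g x)
      (hmeas.sub stronglyMeasurable_const) (by positivity)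
      (fun r hr => hg.norm_ouSemigroup_sub_le hα0 hα1 hK x hr.le) t ht
    refine ⟨d, ?_, ?_⟩
    · refine (hd.const_add (g x)).congr_of_eventuallyEq ?_
      filter_upwards [lt_mem_nhds ht] with s hs
      have hi := hg.integrable_poissonMeasure hα0 hα1 hK hs x
      rw [← poissonIntegral_congr_ae hgf,
        poissonIntegral_eq_integral_ouSemigroup hs hgc.aestronglyMeasurable hi]
      simp only [smul_sub]
      have hi2 : IntegrableOn (fun r => levyDensity s r • ouSemigroup r g x) (Ioi 0) := by
        have h1 := ((integrable_comp_ouFlow_iff hs hgc.aestronglyMeasurable x).2 hi).integral_prod_left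
        exact (integrable_withDensity_ofReal_iff (measurable_levyDensity s)
          (ae_levyDensity_nonneg hs.le)).1 h1
      rw [integral_sub hi2 ((integrableOn_levyDensity hs).smul_const _), integral_smul_const,
        integral_levyDensity hs, one_smul]
      abel
    · refine hdn.trans ?_
      have : 0 < t ^ α := by positivity
      calc C * (K * m) * t ^ α ≤ C * (K * (m + 1)) * t ^ α := by gcongr; linarith
        _ = _ := by ring
  refine ⟨fun x => (key x).choose_spec.1.differentiableAt, ?_⟩
  rw [eLpNorm_exponent_top]
  refine eLpNormEssSup_le_of_ae_bound (Eventually.of_forall fun x => ?_)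
  obtain ⟨d, hd, hdn⟩ := key x
  rw [hd.deriv]
  exact hdn

end

/-! ### Kernel estimates matched to the growth condition -/

lemma one_add_mul_exp_neg_le {a : ℝ} (ha : 0 ≤ a) :
    (1 + a) * Real.exp (-(a ^ 2 / (2 * (Real.exp 1 + a)))) ≤
      8 * Real.exp (Real.exp 1) / √(Real.log (Real.exp 1 + a)) := by
  have he := Real.add_one_le_exp 1
  set b := Real.exp 1 + a with hb
  have hb2 : 2 ≤ b := by linarith
  have hs := one_le_sqrt_log a ha
  rw [← hb] at hs
  have hs2 : √(Real.log b) ≤ b := by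
    rw [Real.sqrt_le_left (by linarith)]
    nlinarith [Real.log_le_sub_one_of_pos (show 0 < b by linarith)]
  have h1 : Real.exp (-(a ^ 2 / (2 * b))) ≤ Real.exp (Real.exp 1) * Real.exp (-(b / 2)) := by
    rw [← Real.exp_add]
    apply Real.exp_le_exp.2
    have : a ^ 2 / (2 * b) ≥ b / 2 - Real.exp 1 := by
      rw [ge_iff_le, le_div_iff₀ (by positivity)]
      have : a = b - Real.exp 1 := by rw [hb]; ring
      rw [this]
      nlinarith [sq_nonneg (Real.exp 1)]
    linarith
  have h2 : b ^ 2 * Real.exp (-(b / 2)) ≤ 8 := by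
    have := Real.pow_div_factorial_le_exp (x := b / 2) (by positivity) 2
    rw [Real.exp_neg, ← div_eq_mul_inv, div_le_iff₀ (Real.exp_pos _)]
    norm_num [Nat.factorial] at this
    nlinarith
  rw [le_div_iff₀ (by linarith)]
  calc (1 + a) * Real.exp (-(a ^ 2 / (2 * b))) * √(Real.log b)
      ≤ b * (Real.exp (Real.exp 1) * Real.exp (-(b / 2))) * b := by
        gcongr
        rw [hb]; linarith
    _ = Real.exp (Real.exp 1) * (b ^ 2 * Real.exp (-(b / 2))) := by ring
    _ ≤ Real.exp (Real.exp 1) * 8 := by gcongr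
    _ = _ := by ring

lemma exp_neg_le_of_le_half_log {a r : ℝ} (ha : 0 ≤ a)
    (hr : r ≤ 1 / 2 * Real.log (Real.exp 1 + a)) :
    Real.exp (-(Real.exp (-r) ^ 2 * a ^ 2 / 2)) ≤
      Real.exp (-(a ^ 2 / (2 * (Real.exp 1 + a)))) := by
  have hb : 0 < Real.exp 1 + a := by positivity
  have h1 : (Real.exp 1 + a)⁻¹ ≤ Real.exp (-r) ^ 2 := by
    rw [← Real.exp_log hb, ← Real.exp_neg, ← Real.exp_nat_mul]
    apply Real.exp_le_exp.2
    push_cast; linarith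
  apply Real.exp_le_exp.2
  rw [neg_le_neg_iff]
  calc a ^ 2 / (2 * (Real.exp 1 + a)) = (Real.exp 1 + a)⁻¹ * a ^ 2 / 2 := by field_simp
    _ ≤ _ := by gcongr

/-- Times before `½ ln (e + a)` contribute little because of the Gaussian factor, and later times
because of the tail of the Lévy density; this is the origin of the weight `1 / √ln (e + |y|)`. -/
lemma exists_integral_rpow_mul_exp_le :
    ∃ C : ℝ, 0 < C ∧ ∀ a : ℝ, 0 ≤ a →
      IntegrableOn (fun r => (r + 1) ^ (-(3 / 2) : ℝ) *
        Real.exp (-(Real.exp (-r) ^ 2 * a ^ 2 / 2))) (Ioi 0) ∧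
      ∫ r in Ioi (0 : ℝ), (r + 1) ^ (-(3 / 2) : ℝ) * Real.exp (-(Real.exp (-r) ^ 2 * a ^ 2 / 2)) ≤
        C / √(Real.log (Real.exp 1 + a)) := by
  set J : ℝ := ∫ r in Ioi (0 : ℝ), (r + 1) ^ (-(3 / 2) : ℝ) with hJ
  have hJint : IntegrableOn (fun r : ℝ => (r + 1) ^ (-(3 / 2) : ℝ)) (Ioi 0) :=
    integrableOn_add_one_rpow (by norm_num)
  have hJ0 : 0 ≤ J := setIntegral_nonneg measurableSet_Ioi fun r hr => by
    have : 0 < r := hr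
    positivity
  refine ⟨J * (8 * Real.exp (Real.exp 1)) + 4, by positivity, fun a ha => ?_⟩
  set L := Real.log (Real.exp 1 + a) with hL
  have hs := one_le_sqrt_log a ha
  rw [← hL] at hs
  have hL1 : 1 ≤ L := by
    rw [Real.one_le_sqrt] at hs; exact hs
  set E₀ := Real.exp (-(a ^ 2 / (2 * (Real.exp 1 + a)))) with hE₀
  have hE : E₀ ≤ 8 * Real.exp (Real.exp 1) / √L := by
    refine le_trans ?_ (one_add_mul_exp_neg_le ha)
    rw [← hE₀]
    have : 0 < E₀ := Real.exp_pos _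
    nlinarith
  have hint : IntegrableOn (fun r => (r + 1) ^ (-(3 / 2) : ℝ) *
      Real.exp (-(Real.exp (-r) ^ 2 * a ^ 2 / 2))) (Ioi 0) := by
    refine Integrable.mono' hJint (by fun_prop) ?_
    filter_upwards [self_mem_ae_restrict measurableSet_Ioi] with r hr
    have hr' : 0 < r := hr
    rw [Real.norm_of_nonneg (by positivity)]
    refine mul_le_of_le_one_right (by positivity) (Real.exp_le_one_iff.2 ?_)
    rw [neg_nonpos]; positivity
  refine ⟨hint, ?_⟩
  have hr₀ : 0 < 1 / 2 * L := by positivity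
  have htail : IntegrableOn (fun r : ℝ => (r + 1) ^ (-(3 / 2) : ℝ)) (Ioi (1 / 2 * L)) :=
    hJint.mono_set (Ioi_subset_Ioi hr₀.le)
  have htail2 : ∫ r in Ioi (1 / 2 * L), (r + 1) ^ (-(3 / 2) : ℝ) ≤ 4 / √L := by
    calc _ ≤ ∫ r in Ioi (1 / 2 * L), r ^ (-(3 / 2) : ℝ) := by
          refine setIntegral_mono_on htail (integrableOn_Ioi_rpow_of_lt (by norm_num) hr₀)
            measurableSet_Ioi fun r hr => ?_
          have hr' : 0 < r := hr₀.trans hr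
          exact Real.rpow_le_rpow_of_nonpos hr' (by linarith) (by norm_num)
      _ = 2 / √(1 / 2 * L) := by
          rw [integral_Ioi_rpow_of_lt (by norm_num) hr₀,
            show (-(3 / 2) + 1 : ℝ) = -(1 / 2) by norm_num, Real.rpow_neg hr₀.le,
            ← Real.sqrt_eq_rpow]
          field_simp
      _ ≤ 4 / √L := by
          rw [div_le_div_iff₀ (Real.sqrt_pos.2 hr₀) (by linarith)]
          have : √L ≤ √(4 * (1 / 2 * L)) := Real.sqrt_le_sqrt (by linarith)
          rw [Real.sqrt_mul (by norm_num), show (4 : ℝ) = 2 ^ 2 by norm_num,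
            Real.sqrt_sq (by norm_num)] at this
          linarith
  calc ∫ r in Ioi (0 : ℝ), (r + 1) ^ (-(3 / 2) : ℝ) * Real.exp (-(Real.exp (-r) ^ 2 * a ^ 2 / 2))
      ≤ ∫ r in Ioi (0 : ℝ), ((r + 1) ^ (-(3 / 2) : ℝ) * E₀ +
          (Ioi (1 / 2 * L)).indicator (fun r => (r + 1) ^ (-(3 / 2) : ℝ)) r) := by
        refine setIntegral_mono_on hint ((hJint.mul_const E₀).add
          ((integrable_indicator_iff measurableSet_Ioi).2 htail).integrableOn)
          measurableSet_Ioi fun r hr => ?_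
        have hr' : 0 < r := hr
        by_cases h : r ≤ 1 / 2 * L
        · rw [indicator_of_notMem (by simpa using h), add_zero]
          gcongr
          exact exp_neg_le_of_le_half_log ha h
        · rw [indicator_of_mem (by simpa using h)]
          have : Real.exp (-(Real.exp (-r) ^ 2 * a ^ 2 / 2)) ≤ 1 := by
            rw [Real.exp_le_one_iff, neg_nonpos]; positivity
          have h2 : 0 ≤ (r + 1) ^ (-(3 / 2) : ℝ) * E₀ := by positivity
          have h3 : 0 ≤ (r + 1) ^ (-(3 / 2) : ℝ) := by positivity
          nlinarith
    _ = J * E₀ + ∫ r in Ioi (1 / 2 * L), (r + 1) ^ (-(3 / 2) : ℝ) := by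
        rw [integral_add (hJint.mul_const E₀)
          ((integrable_indicator_iff measurableSet_Ioi).2 htail).integrableOn, integral_mul_const,
          setIntegral_indicator measurableSet_Ioi, inter_eq_right.2 (Ioi_subset_Ioi hr₀.le)]
    _ ≤ J * (8 * Real.exp (Real.exp 1) / √L) + 4 / √L := by gcongr
    _ = _ := by ring

lemma integrableOn_exp_neg : IntegrableOn (fun r : ℝ => Real.exp (-r)) (Ioi 0) := by
  simpa using integrableOn_exp_mul_Ioi (a := -1) (by norm_num) 0

lemma integral_exp_neg : ∫ r in Ioi (0 : ℝ), Real.exp (-r) = 1 := by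
  simpa using integral_exp_mul_Ioi (a := -1) (by norm_num) 0

lemma integral_exp_neg_mul_div (a : ℝ) (ha : 0 ≤ a) :
    IntegrableOn (fun r : ℝ => Real.exp (-r) * a / (1 + (Real.exp (-r) * a) ^ 2)) (Ioi 0) ∧
    ∫ r in Ioi (0 : ℝ), Real.exp (-r) * a / (1 + (Real.exp (-r) * a) ^ 2) = Real.arctan a := by
  have hd : ∀ r ∈ Ici (0 : ℝ), HasDerivAt (fun r => -Real.arctan (Real.exp (-r) * a))
      (Real.exp (-r) * a / (1 + (Real.exp (-r) * a) ^ 2)) r := by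
    intro r _
    have h1 : HasDerivAt (fun r : ℝ => Real.exp (-r) * a) (-(Real.exp (-r)) * a) r := by
      have := ((hasDerivAt_id r).neg.exp).mul_const a
      simpa using! this
    refine (h1.arctan.neg).congr_deriv ?_
    ring
  have hnn : ∀ r ∈ Ioi (0 : ℝ), 0 ≤ Real.exp (-r) * a / (1 + (Real.exp (-r) * a) ^ 2) :=
    fun r _ => by positivity
  have ht : Tendsto (fun r => -Real.arctan (Real.exp (-r) * a)) atTop (𝓝 0) := by
    have h1 : Tendsto (fun r : ℝ => Real.exp (-r) * a) atTop (𝓝 (0 * a)) :=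
      (Real.tendsto_exp_neg_atTop_nhds_zero).mul_const a
    have h2 := ((Real.continuous_arctan.tendsto (0 * a)).comp h1).neg
    simpa [Function.comp_def] using h2
  refine ⟨integrableOn_Ioi_deriv_of_nonneg' hd hnn ht, ?_⟩
  rw [integral_Ioi_of_hasDerivAt_of_nonneg' hd hnn ht]
  simp

/-- The analogue of `exists_integral_rpow_mul_exp_le` for differences of the kernel in the space
variable: the factor `e^{-r}` gained by differentiation compensates the slower decay `(1 + r)⁻¹`. -/
lemma exists_integral_inv_mul_exp_le :
    ∃ C : ℝ, 0 < C ∧ ∀ a : ℝ, 0 ≤ a →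
      IntegrableOn (fun r => (1 + r)⁻¹ * (Real.exp (-r) * (1 + a) *
        Real.exp (-(Real.exp (-r) ^ 2 * a ^ 2 / 2)))) (Ioi 0) ∧
      ∫ r in Ioi (0 : ℝ), (1 + r)⁻¹ * (Real.exp (-r) * (1 + a) *
          Real.exp (-(Real.exp (-r) ^ 2 * a ^ 2 / 2))) ≤
        C / √(Real.log (Real.exp 1 + a)) := by
  refine ⟨2 * (1 + Real.pi) + 8 * Real.exp (Real.exp 1), by positivity, fun a ha => ?_⟩
  set L := Real.log (Real.exp 1 + a) with hL
  have hs := one_le_sqrt_log a ha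
  rw [← hL] at hs
  have hL1 : 1 ≤ L := by
    rw [Real.one_le_sqrt] at hs; exact hs
  set E₀ := Real.exp (-(a ^ 2 / (2 * (Real.exp 1 + a)))) with hE₀
  have hE : (1 + a) * E₀ ≤ 8 * Real.exp (Real.exp 1) / √L := one_add_mul_exp_neg_le ha
  obtain ⟨hq, hqi⟩ := integral_exp_neg_mul_div a ha
  have hint : IntegrableOn (fun r => (1 + r)⁻¹ * (Real.exp (-r) * (1 + a) *
        Real.exp (-(Real.exp (-r) ^ 2 * a ^ 2 / 2)))) (Ioi 0) := by
    refine Integrable.mono' (integrableOn_exp_neg.mul_const (1 + a))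
      (Measurable.aestronglyMeasurable (by fun_prop)) ?_
    filter_upwards [self_mem_ae_restrict measurableSet_Ioi] with r hr
    have hr' : 0 < r := hr
    rw [Real.norm_of_nonneg (by positivity)]
    have h1 : (1 + r)⁻¹ ≤ 1 := inv_le_one_of_one_le₀ (by linarith)
    have h2 : Real.exp (-(Real.exp (-r) ^ 2 * a ^ 2 / 2)) ≤ 1 := by
      rw [Real.exp_le_one_iff, neg_nonpos]; positivity
    calc _ ≤ 1 * (Real.exp (-r) * (1 + a) * 1) := by gcongr
      _ = _ := by ring
  refine ⟨hint, ?_⟩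
  have hdom : IntegrableOn (fun r => (1 / 2 * L)⁻¹ * (Real.exp (-r) +
      2 * (Real.exp (-r) * a / (1 + (Real.exp (-r) * a) ^ 2)))) (Ioi 0) :=
    (integrableOn_exp_neg.add (hq.const_mul 2)).const_mul _
  have hdom2 : IntegrableOn (fun r => Real.exp (-r) * ((1 + a) * E₀)) (Ioi 0) :=
    integrableOn_exp_neg.mul_const _
  calc _ ≤ ∫ r in Ioi (0 : ℝ), ((1 / 2 * L)⁻¹ * (Real.exp (-r) +
          2 * (Real.exp (-r) * a / (1 + (Real.exp (-r) * a) ^ 2))) +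
          Real.exp (-r) * ((1 + a) * E₀)) := by
        refine setIntegral_mono_on hint (hdom.add hdom2) measurableSet_Ioi fun r hr => ?_
        have hr' : 0 < r := hr
        by_cases h : r ≤ 1 / 2 * L
        · have h1 : (1 + r)⁻¹ ≤ 1 := inv_le_one_of_one_le₀ (by linarith)
          have h2 := exp_neg_le_of_le_half_log ha h
          have h3 : 0 ≤ (1 / 2 * L)⁻¹ * (Real.exp (-r) +
              2 * (Real.exp (-r) * a / (1 + (Real.exp (-r) * a) ^ 2))) := by positivity
          calc _ ≤ 1 * (Real.exp (-r) * (1 + a) * E₀) := by gcongr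
            _ ≤ _ := by linarith
        · have h1 : (1 + r)⁻¹ ≤ (1 / 2 * L)⁻¹ := by
            gcongr; linarith
          have h3 : 0 ≤ Real.exp (-r) * ((1 + a) * E₀) := by positivity
          have h4 : Real.exp (-(Real.exp (-r) ^ 2 * a ^ 2 / 2)) ≤
              2 / (1 + (Real.exp (-r) * a) ^ 2) := by
            rw [Real.exp_neg, ← one_div, div_le_div_iff₀ (Real.exp_pos _) (by positivity)]
            have := Real.add_one_le_exp (Real.exp (-r) ^ 2 * a ^ 2 / 2)
            rw [mul_pow]; linarith
          have h5 : Real.exp (-(Real.exp (-r) ^ 2 * a ^ 2 / 2)) ≤ 1 := by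
            rw [Real.exp_le_one_iff, neg_nonpos]; positivity
          have h6 : Real.exp (-r) * (1 + a) * Real.exp (-(Real.exp (-r) ^ 2 * a ^ 2 / 2)) ≤
              Real.exp (-r) + 2 * (Real.exp (-r) * a / (1 + (Real.exp (-r) * a) ^ 2)) := by
            calc _ = Real.exp (-r) * Real.exp (-(Real.exp (-r) ^ 2 * a ^ 2 / 2)) +
                  Real.exp (-r) * a * Real.exp (-(Real.exp (-r) ^ 2 * a ^ 2 / 2)) := by ring
              _ ≤ Real.exp (-r) * 1 +
                  Real.exp (-r) * a * (2 / (1 + (Real.exp (-r) * a) ^ 2)) := by gcongr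
              _ = _ := by ring
          calc _ ≤ (1 / 2 * L)⁻¹ * (Real.exp (-r) +
                2 * (Real.exp (-r) * a / (1 + (Real.exp (-r) * a) ^ 2))) := by gcongr
            _ ≤ _ := by linarith
    _ = (1 / 2 * L)⁻¹ * (1 + 2 * Real.arctan a) + (1 + a) * E₀ := by
        rw [integral_add hdom hdom2, integral_const_mul,
          integral_add integrableOn_exp_neg (hq.const_mul 2), integral_const_mul, hqi,
          integral_mul_const, integral_exp_neg, one_mul]
    _ ≤ 2 / √L * (1 + Real.pi) + 8 * Real.exp (Real.exp 1) / √L := by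
        have h1 : (1 / 2 * L)⁻¹ ≤ 2 / √L := by
          rw [mul_inv, one_div, inv_inv, ← div_eq_mul_inv]
          gcongr
          rw [Real.sqrt_le_left (by linarith)]
          nlinarith
        have h2 := Real.arctan_lt_pi_div_two a
        have h3 : 0 ≤ 1 + 2 * Real.arctan a := by
          have := Real.arctan_nonneg.2 ha
          positivity
        gcongr
        linarith
    _ = _ := by ring

/-- The symmetric form of the Mehler exponent. -/
lemma mehler_exponent_eq (x y : EuclideanSpace ℝ (Fin n)) {ρ : ℝ} (hρ : ρ ^ 2 < 1) :
    ‖y - ρ • x‖ ^ 2 / (1 - ρ ^ 2) = ‖y‖ ^ 2 - ‖x‖ ^ 2 + ‖x - ρ • y‖ ^ 2 / (1 - ρ ^ 2) := by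
  have h : 1 - ρ ^ 2 ≠ 0 := by linarith
  rw [norm_sub_sq_real, norm_sub_sq_real, inner_smul_right, inner_smul_right, norm_smul, norm_smul,
    mul_pow, mul_pow, Real.norm_eq_abs, sq_abs, real_inner_comm]
  field_simp
  ring

lemma mehlerKernel_le_gaussian (x y : EuclideanSpace ℝ (Fin n)) {r : ℝ} (hr : 0 < r) :
    mehlerKernel (Real.exp (-r)) x y ≤ ((1 + r) / r) ^ n * (Real.exp (2 * ‖x‖ ^ 2) *
      Real.exp (-‖y‖ ^ 2) * Real.exp (-(Real.exp (-r) ^ 2 * ‖y‖ ^ 2 / 2))) := by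
  have h0 := one_sub_exp_sq_pos hr
  set ρ := Real.exp (-r) with hρ
  rw [mehlerKernel, div_eq_mul_inv, mul_comm]
  gcongr
  · exact inv_one_sub_exp_sq_rpow_le n hr
  · rw [← Real.exp_add, ← Real.exp_add, mehler_exponent_eq x y (by linarith)]
    apply Real.exp_le_exp.2
    have h1 : ‖x - ρ • y‖ ^ 2 ≤ ‖x - ρ • y‖ ^ 2 / (1 - ρ ^ 2) := by
      rw [le_div_iff₀ h0]
      nlinarith [mul_nonneg (sq_nonneg ‖x - ρ • y‖) (sq_nonneg ρ)]
    have h2 : ρ * ‖y‖ ≤ ‖x - ρ • y‖ + ‖x‖ := by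
      have h3 := norm_sub_norm_le (ρ • y) x
      rw [norm_sub_rev, norm_smul, Real.norm_of_nonneg (Real.exp_pos _).le] at h3
      linarith
    have h4 : (ρ * ‖y‖) ^ 2 ≤ (‖x - ρ • y‖ + ‖x‖) ^ 2 :=
      pow_le_pow_left₀ (by positivity) h2 2
    nlinarith [sq_nonneg (‖x - ρ • y‖ - ‖x‖)]

/-- The weight of the growth condition. -/
def growthWeight (y : EuclideanSpace ℝ (Fin n)) : ℝ :=
  Real.exp (-‖y‖ ^ 2) / √(Real.log (Real.exp 1 + ‖y‖))

lemma growthWeight_nonneg (y : EuclideanSpace ℝ (Fin n)) : 0 ≤ growthWeight y := by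
  unfold growthWeight; positivity

lemma exists_levyDensity_mul_mehlerKernel_le (n : ℕ) {R t₀ t₁ : ℝ} (ht₀ : 0 < t₀)
    (ht₁ : t₀ ≤ t₁) :
    ∃ C : ℝ, 0 < C ∧ ∀ t ∈ Icc t₀ t₁, ∀ x y : EuclideanSpace ℝ (Fin n), ‖x‖ ≤ R → ∀ r, 0 < r →
      Real.pi ^ (-((n : ℝ) / 2)) * (levyDensity t r * mehlerKernel (Real.exp (-r)) x y) ≤
        C * Real.exp (-‖y‖ ^ 2) * ((r + 1) ^ (-(3 / 2) : ℝ) *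
          Real.exp (-(Real.exp (-r) ^ 2 * ‖y‖ ^ 2 / 2))) := by
  obtain ⟨C, hC, h⟩ := exists_levyDensity_mul_pow_le n ht₀ ht₁
  refine ⟨Real.pi ^ (-((n : ℝ) / 2)) * (C * Real.exp (2 * R ^ 2)), by positivity,
    fun t ht x y hx r hr => ?_⟩
  have h1 := levyDensity_nonneg (ht₀.le.trans ht.1) hr
  calc _ ≤ Real.pi ^ (-((n : ℝ) / 2)) * (levyDensity t r * (((1 + r) / r) ^ n *
        (Real.exp (2 * ‖x‖ ^ 2) * Real.exp (-‖y‖ ^ 2) *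
          Real.exp (-(Real.exp (-r) ^ 2 * ‖y‖ ^ 2 / 2))))) := by
        gcongr; exact mehlerKernel_le_gaussian x y hr
    _ = Real.pi ^ (-((n : ℝ) / 2)) * ((levyDensity t r * ((1 + r) / r) ^ n) *
        (Real.exp (2 * ‖x‖ ^ 2) * Real.exp (-‖y‖ ^ 2) *
          Real.exp (-(Real.exp (-r) ^ 2 * ‖y‖ ^ 2 / 2)))) := by ring
    _ ≤ Real.pi ^ (-((n : ℝ) / 2)) * ((C * (r + 1) ^ (-(3 / 2) : ℝ)) *
        (Real.exp (2 * R ^ 2) * Real.exp (-‖y‖ ^ 2) *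
          Real.exp (-(Real.exp (-r) ^ 2 * ‖y‖ ^ 2 / 2)))) := by
        refine mul_le_mul_of_nonneg_left (mul_le_mul (h t ht r hr) ?_ (by positivity)
          (by positivity)) (by positivity)
        gcongr
    _ = _ := by ring

/-- The weight of the growth condition dominates the Poisson kernel, locally uniformly in `(t, x)`.
-/
lemma exists_poissonKernel_le (n : ℕ) (R : ℝ) {t₀ t₁ : ℝ} (ht₀ : 0 < t₀) (ht₁ : t₀ ≤ t₁) :
    ∃ C : ℝ, 0 < C ∧ ∀ t ∈ Icc t₀ t₁, ∀ x y : EuclideanSpace ℝ (Fin n), ‖x‖ ≤ R →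
      poissonKernel t x y ≤ C * growthWeight y := by
  obtain ⟨C₁, hC₁, h₁⟩ := exists_levyDensity_mul_mehlerKernel_le n (R := R) ht₀ ht₁
  obtain ⟨C₂, hC₂, h₂⟩ := exists_integral_rpow_mul_exp_le
  refine ⟨C₁ * C₂, by positivity, fun t ht x y hx => ?_⟩
  have ht0 : 0 < t := ht₀.trans_le ht.1
  obtain ⟨hi, hle⟩ := h₂ ‖y‖ (norm_nonneg y)
  rw [poissonKernel_eq]
  calc _ ≤ ∫ r in Ioi (0 : ℝ), C₁ * Real.exp (-‖y‖ ^ 2) * ((r + 1) ^ (-(3 / 2) : ℝ) *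
          Real.exp (-(Real.exp (-r) ^ 2 * ‖y‖ ^ 2 / 2))) :=
        setIntegral_mono_on ((integrableOn_levyDensity_mul_mehlerKernel ht0 x y).const_mul _)
          (hi.const_mul _) measurableSet_Ioi fun r hr => h₁ t ht x y hx r hr
    _ ≤ C₁ * Real.exp (-‖y‖ ^ 2) * (C₂ / √(Real.log (Real.exp 1 + ‖y‖))) := by
        rw [integral_const_mul]
        gcongr
    _ = _ := by rw [growthWeight]; ring

lemma eventually_mem_Icc_norm_le (x : EuclideanSpace ℝ (Fin n)) {t : ℝ} (ht : 0 < t) :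
    ∀ᶠ q in 𝓝 (x, t), q.2 ∈ Icc (t / 2) (2 * t) ∧ ‖q.1‖ ≤ ‖x‖ + 1 := by
  have h1 : ∀ᶠ s in 𝓝 t, s ∈ Icc (t / 2) (2 * t) := Icc_mem_nhds (by linarith) (by linarith)
  have h2 : ∀ᶠ z in 𝓝 x, ‖z‖ ≤ ‖x‖ + 1 :=
    (continuous_norm.tendsto x).eventually_le_const (by linarith)
  rw [nhds_prod_eq]
  exact (tendsto_snd.eventually h1).and (tendsto_fst.eventually h2)

lemma continuousAt_poissonKernel (x y : EuclideanSpace ℝ (Fin n)) {t : ℝ} (ht : 0 < t) :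
    ContinuousAt (fun q : EuclideanSpace ℝ (Fin n) × ℝ => poissonKernel q.2 q.1 y) (x, t) := by
  obtain ⟨C₁, hC₁, h₁⟩ := exists_levyDensity_mul_mehlerKernel_le n (R := ‖x‖ + 1)
    (t₀ := t / 2) (t₁ := 2 * t) (by positivity) (by linarith)
  obtain ⟨C₂, hC₂, h₂⟩ := exists_integral_rpow_mul_exp_le
  obtain ⟨hi, -⟩ := h₂ ‖y‖ (norm_nonneg y)
  simp only [poissonKernel_eq]
  refine continuousAt_of_dominated (bound := fun r => C₁ * Real.exp (-‖y‖ ^ 2) *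
    ((r + 1) ^ (-(3 / 2) : ℝ) * Real.exp (-(Real.exp (-r) ^ 2 * ‖y‖ ^ 2 / 2)))) ?_ ?_
    (hi.const_mul _) ?_
  · refine Eventually.of_forall fun q => Measurable.aestronglyMeasurable ?_
    have := measurable_levyDensity q.2
    unfold mehlerKernel; fun_prop
  · filter_upwards [eventually_mem_Icc_norm_le x ht] with q hq
    filter_upwards [self_mem_ae_restrict measurableSet_Ioi] with r hr
    have hr' : 0 < r := hr
    have e1 := levyDensity_nonneg (show 0 ≤ q.2 by linarith [hq.1.1]) hr'
    have e2 := mehlerKernel_nonneg (exp_neg_sq_le_one hr'.le) q.1 y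
    rw [Real.norm_of_nonneg (by positivity)]
    exact h₁ q.2 hq.1 q.1 y hq.2 r hr
  · filter_upwards [self_mem_ae_restrict measurableSet_Ioi] with r hr
    have : Continuous fun q : EuclideanSpace ℝ (Fin n) × ℝ => Real.pi ^ (-((n : ℝ) / 2)) *
        (levyDensity q.2 r * mehlerKernel (Real.exp (-r)) q.1 y) := by
      unfold levyDensity mehlerKernel; fun_prop
    exact this.continuousAt

section

variable {𝕜 : Type*} [RCLike 𝕜] {f : EuclideanSpace ℝ (Fin n) → 𝕜}

lemma GrowthCondition.integrable (hf : GrowthCondition f) :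
    Integrable fun y => growthWeight y * ‖f y‖ := hf

lemma GrowthCondition.integrable_poissonMeasure (hf : GrowthCondition f)
    (hm : AEStronglyMeasurable f volume) {t : ℝ} (ht : 0 < t) (x : EuclideanSpace ℝ (Fin n)) :
    Integrable f (poissonMeasure t x) := by
  obtain ⟨C, hC, h⟩ := exists_poissonKernel_le n ‖x‖ ht le_rfl
  rw [integrable_poissonMeasure_iff ht.le]
  refine Integrable.mono' (hf.integrable.const_mul C)
    ((measurable_poissonKernel_right t x).aestronglyMeasurable.smul hm)
    (Eventually.of_forall fun y => ?_)
  rw [norm_smul, Real.norm_of_nonneg (poissonKernel_nonneg ht.le x y), ← mul_assoc]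
  gcongr
  exact h t ⟨le_rfl, le_rfl⟩ x y le_rfl

lemma GrowthCondition.continuousAt_poissonIntegral (hf : GrowthCondition f)
    (hm : AEStronglyMeasurable f volume) {t : ℝ} (ht : 0 < t) (x : EuclideanSpace ℝ (Fin n)) :
    ContinuousAt (fun q : EuclideanSpace ℝ (Fin n) × ℝ => poissonIntegral q.2 f q.1) (x, t) := by
  obtain ⟨C, hC, h⟩ := exists_poissonKernel_le n (‖x‖ + 1)
    (t₀ := t / 2) (t₁ := 2 * t) (by positivity) (by linarith)
  refine continuousAt_of_dominated (bound := fun y => C * (growthWeight y * ‖f y‖))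
    (Eventually.of_forall fun q =>
      (measurable_poissonKernel_right q.2 q.1).aestronglyMeasurable.smul hm) ?_
    (hf.integrable.const_mul C) ?_
  · filter_upwards [eventually_mem_Icc_norm_le x ht] with q hq
    refine Eventually.of_forall fun y => ?_
    rw [norm_smul, Real.norm_of_nonneg (poissonKernel_nonneg (by linarith [hq.1.1]) _ y),
      ← mul_assoc]
    gcongr
    exact h q.2 hq.1 q.1 y hq.2
  · exact Eventually.of_forall fun y =>
      (continuousAt_poissonKernel x y ht).smul continuousAt_const

/-- Since `x` enters the Mehler kernel only through `e^{-r} x`, differences in `x` gain a factor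
`e^{-r}`. -/
lemma abs_mehlerKernel_sub_le {R : ℝ} {x x' : EuclideanSpace ℝ (Fin n)} (hx : ‖x‖ ≤ R)
    (hx' : ‖x'‖ ≤ R) (y : EuclideanSpace ℝ (Fin n)) {r : ℝ} (hr : 0 < r) :
    |mehlerKernel (Real.exp (-r)) x y - mehlerKernel (Real.exp (-r)) x' y| ≤
      8 * R * (1 + R) * Real.exp (2 * R ^ 2) * Real.exp (-‖y‖ ^ 2) * (((1 + r) / r) ^ (n + 1) *
        (Real.exp (-r) * (1 + ‖y‖) * Real.exp (-(Real.exp (-r) ^ 2 * ‖y‖ ^ 2 / 2)))) := by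
  have h0 := one_sub_exp_sq_pos hr
  have hR : 0 ≤ R := (norm_nonneg x).trans hx
  have e1 := mehlerKernel_le_gaussian x y hr
  have e2 := mehlerKernel_le_gaussian x' y hr
  have einv := inv_one_sub_exp_sq_le hr
  have hρ1 : Real.exp (-r) ≤ 1 := Real.exp_le_one_iff.2 (by linarith)
  set ρ := Real.exp (-r) with hρ
  have hρ0 : 0 < ρ := Real.exp_pos _
  have hy := norm_nonneg y
  set G := Real.exp (2 * R ^ 2) * Real.exp (-‖y‖ ^ 2) * Real.exp (-(ρ ^ 2 * ‖y‖ ^ 2 / 2)) with hG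
  have hb : ∀ z : EuclideanSpace ℝ (Fin n), ‖z‖ ≤ R → mehlerKernel ρ z y ≤ ((1 + r) / r) ^ n * G :=
    fun z hz => (mehlerKernel_le_gaussian z y hr).trans (by rw [hG, hρ]; gcongr)
  have hA := abs_exp_neg_sub_exp_neg_le (‖y - ρ • x‖ ^ 2 / (1 - ρ ^ 2))
    (‖y - ρ • x'‖ ^ 2 / (1 - ρ ^ 2))
  have hnorm : ∀ z : EuclideanSpace ℝ (Fin n), ‖z‖ ≤ R → ‖y - ρ • z‖ ≤ ‖y‖ + R := by
    intro z hz
    refine (norm_sub_le _ _).trans ?_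
    rw [norm_smul, Real.norm_of_nonneg hρ0.le]
    nlinarith [norm_nonneg z]
  have hB : |‖y - ρ • x‖ ^ 2 / (1 - ρ ^ 2) - ‖y - ρ • x'‖ ^ 2 / (1 - ρ ^ 2)| ≤
      4 * R * (1 + R) * (ρ * (1 + ‖y‖)) * ((1 + r) / r) := by
    rw [← sub_div, abs_div, abs_of_pos h0, sq_sub_sq, abs_mul, div_eq_mul_inv,
      abs_of_nonneg (add_nonneg (norm_nonneg _) (norm_nonneg _))]
    have h1 : |‖y - ρ • x‖ - ‖y - ρ • x'‖| ≤ ρ * (2 * R) := by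
      refine (abs_norm_sub_norm_le _ _).trans ?_
      rw [show y - ρ • x - (y - ρ • x') = ρ • (x' - x) by rw [smul_sub]; abel, norm_smul,
        Real.norm_of_nonneg hρ0.le]
      gcongr
      exact (norm_sub_le _ _).trans (by linarith)
    calc _ ≤ ((‖y‖ + R) + (‖y‖ + R)) * (ρ * (2 * R)) * ((1 + r) / r) := by
          have := hnorm x hx
          have := hnorm x' hx'
          gcongr
      _ ≤ 2 * ((1 + R) * (1 + ‖y‖)) * (ρ * (2 * R)) * ((1 + r) / r) := by
          gcongr
          nlinarith
      _ = _ := by ring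
  have heq : mehlerKernel ρ x y - mehlerKernel ρ x' y =
      (Real.exp (-(‖y - ρ • x‖ ^ 2 / (1 - ρ ^ 2))) -
        Real.exp (-(‖y - ρ • x'‖ ^ 2 / (1 - ρ ^ 2)))) / (1 - ρ ^ 2) ^ ((n : ℝ) / 2) := by
    rw [mehlerKernel, mehlerKernel, sub_div]
  have hadd : (Real.exp (-(‖y - ρ • x‖ ^ 2 / (1 - ρ ^ 2))) +
        Real.exp (-(‖y - ρ • x'‖ ^ 2 / (1 - ρ ^ 2)))) / (1 - ρ ^ 2) ^ ((n : ℝ) / 2) =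
      mehlerKernel ρ x y + mehlerKernel ρ x' y := by
    rw [mehlerKernel, mehlerKernel, add_div]
  have hden : 0 < (1 - ρ ^ 2) ^ ((n : ℝ) / 2) := by positivity
  have hm := mehlerKernel_nonneg (ρ := ρ) (by linarith) x y
  have hm' := mehlerKernel_nonneg (ρ := ρ) (by linarith) x' y
  rw [heq, abs_div, abs_of_pos hden]
  calc _ ≤ |‖y - ρ • x‖ ^ 2 / (1 - ρ ^ 2) - ‖y - ρ • x'‖ ^ 2 / (1 - ρ ^ 2)| *
        (Real.exp (-(‖y - ρ • x‖ ^ 2 / (1 - ρ ^ 2))) +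
        Real.exp (-(‖y - ρ • x'‖ ^ 2 / (1 - ρ ^ 2)))) / (1 - ρ ^ 2) ^ ((n : ℝ) / 2) := by gcongr
    _ = |‖y - ρ • x‖ ^ 2 / (1 - ρ ^ 2) - ‖y - ρ • x'‖ ^ 2 / (1 - ρ ^ 2)| *
        (mehlerKernel ρ x y + mehlerKernel ρ x' y) := by rw [mul_div_assoc, hadd]
    _ ≤ (4 * R * (1 + R) * (ρ * (1 + ‖y‖)) * ((1 + r) / r)) *
        (((1 + r) / r) ^ n * G + ((1 + r) / r) ^ n * G) := by
        have := hb x hx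
        have := hb x' hx'
        gcongr
    _ = _ := by rw [hG]; ring

/-- Differences of the Poisson kernel in the space variable have, for large `t`, a majorant that is
independent of `t` and matches the growth condition, and they tend to zero. -/
lemma exists_abs_poissonKernel_sub_le (x x' : EuclideanSpace ℝ (Fin n)) :
    ∃ C : ℝ, 0 < C ∧ ∀ t : ℝ, 1 ≤ t → ∀ y : EuclideanSpace ℝ (Fin n),
      |poissonKernel t x y - poissonKernel t x' y| ≤ C * growthWeight y ∧
      |poissonKernel t x y - poissonKernel t x' y| ≤ C * (1 + ‖y‖) / t := by
  obtain ⟨C₁, hC₁, h₁⟩ := exists_levyDensity_mul_pow_le_of_one_le (n + 1)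
  obtain ⟨C₂, hC₂, h₂⟩ := exists_integral_inv_mul_exp_le
  set R : ℝ := max ‖x‖ ‖x'‖ + 1 with hR
  have hx : ‖x‖ ≤ R := (le_max_left _ _).trans (by linarith)
  have hx' : ‖x'‖ ≤ R := (le_max_right _ _).trans (by linarith)
  have hR0 : 0 < R := by
    have := (norm_nonneg x).trans (le_max_left ‖x‖ ‖x'‖); linarith
  set D : ℝ := Real.pi ^ (-((n : ℝ) / 2)) * (8 * R * (1 + R) * Real.exp (2 * R ^ 2)) with hD
  have hD0 : 0 < D := by positivity
  refine ⟨D * C₁ * (C₂ + 1), by positivity, fun t ht y => ?_⟩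
  have ht0 : 0 < t := by linarith
  have hi := integrableOn_levyDensity_mul_mehlerKernel ht0 x y
  have hi' := integrableOn_levyDensity_mul_mehlerKernel ht0 x' y
  have heq : poissonKernel t x y - poissonKernel t x' y = ∫ r in Ioi (0 : ℝ),
      Real.pi ^ (-((n : ℝ) / 2)) * (levyDensity t r *
        (mehlerKernel (Real.exp (-r)) x y - mehlerKernel (Real.exp (-r)) x' y)) := by
    rw [poissonKernel_eq, poissonKernel_eq, ← integral_sub (hi.const_mul _) (hi'.const_mul _)]
    simp only [mul_sub]
  set E : ℝ → ℝ := fun r =>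
    Real.exp (-r) * (1 + ‖y‖) * Real.exp (-(Real.exp (-r) ^ 2 * ‖y‖ ^ 2 / 2)) with hE
  have hE0 : ∀ r, 0 ≤ E r := fun r => by simp only [hE]; positivity
  have hpt : ∀ r, 0 < r → ‖Real.pi ^ (-((n : ℝ) / 2)) * (levyDensity t r *
        (mehlerKernel (Real.exp (-r)) x y - mehlerKernel (Real.exp (-r)) x' y))‖ ≤
      D * Real.exp (-‖y‖ ^ 2) * ((levyDensity t r * ((1 + r) / r) ^ (n + 1)) * E r) := by
    intro r hr
    have e1 := levyDensity_nonneg ht0.le hr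
    rw [norm_mul, norm_mul, Real.norm_of_nonneg (by positivity), Real.norm_of_nonneg e1,
      Real.norm_eq_abs]
    calc _ ≤ Real.pi ^ (-((n : ℝ) / 2)) * (levyDensity t r * _) :=
          mul_le_mul_of_nonneg_left (mul_le_mul_of_nonneg_left
            (abs_mehlerKernel_sub_le hx hx' y hr) e1) (by positivity)
      _ = _ := by simp only [hD, hE]; ring
  constructor
  · obtain ⟨hi2, hle⟩ := h₂ ‖y‖ (norm_nonneg y)
    have hbd := norm_integral_le_of_norm_le (μ := volume.restrict (Ioi (0 : ℝ)))
      (f := fun r => Real.pi ^ (-((n : ℝ) / 2)) * (levyDensity t r *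
        (mehlerKernel (Real.exp (-r)) x y - mehlerKernel (Real.exp (-r)) x' y)))
      (g := fun r => D * Real.exp (-‖y‖ ^ 2) * C₁ * ((1 + r)⁻¹ * E r))
      (hi2.const_mul _) (by
        filter_upwards [self_mem_ae_restrict measurableSet_Ioi] with r hr
        refine (hpt r hr).trans ?_
        have e2 := mul_le_mul_of_nonneg_right (h₁ t ht r hr).1 (hE0 r)
        calc _ ≤ D * Real.exp (-‖y‖ ^ 2) * (C₁ * (1 + r)⁻¹ * E r) := by gcongr
          _ = _ := by ring)
    rw [heq]
    refine hbd.trans ?_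
    rw [integral_const_mul]
    calc _ ≤ D * Real.exp (-‖y‖ ^ 2) * C₁ * (C₂ / √(Real.log (Real.exp 1 + ‖y‖))) := by gcongr
      _ = D * C₁ * C₂ * growthWeight y := by rw [growthWeight]; ring
      _ ≤ _ := by
        have := growthWeight_nonneg y
        gcongr; linarith
  · have hbd := norm_integral_le_of_norm_le (μ := volume.restrict (Ioi (0 : ℝ)))
      (f := fun r => Real.pi ^ (-((n : ℝ) / 2)) * (levyDensity t r *
        (mehlerKernel (Real.exp (-r)) x y - mehlerKernel (Real.exp (-r)) x' y)))
      (g := fun r => D * C₁ * (1 + ‖y‖) / t * Real.exp (-r))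
      (integrableOn_exp_neg.const_mul _) (by
        filter_upwards [self_mem_ae_restrict measurableSet_Ioi] with r hr
        refine (hpt r hr).trans ?_
        have e2 := mul_le_mul_of_nonneg_right (h₁ t ht r hr).2 (hE0 r)
        have e3 : Real.exp (-‖y‖ ^ 2) ≤ 1 := by
          rw [Real.exp_le_one_iff, neg_nonpos]; positivity
        have e4 : E r ≤ Real.exp (-r) * (1 + ‖y‖) := by
          simp only [hE]
          refine mul_le_of_le_one_right (by positivity) (Real.exp_le_one_iff.2 ?_)
          rw [neg_nonpos]; positivity
        calc _ ≤ D * Real.exp (-‖y‖ ^ 2) * (C₁ / t * E r) := by gcongr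
          _ ≤ D * 1 * (C₁ / t * (Real.exp (-r) * (1 + ‖y‖))) := by
            have := hE0 r
            gcongr
          _ = _ := by ring)
    rw [heq]
    refine hbd.trans ?_
    rw [integral_const_mul, integral_exp_neg, mul_one]
    have h3 : D * C₁ ≤ D * C₁ * (C₂ + 1) := le_mul_of_one_le_right (by positivity) (by linarith)
    exact div_le_div_of_nonneg_right (mul_le_mul_of_nonneg_right h3 (by positivity)) ht0.le

/-- Under the growth condition, `P_t f` becomes flat as `t → ∞`. The growth condition excludes the
nonconstant harmonic functions of the Ornstein-Uhlenbeck operator, such as `x ↦ ∫_0^x exp(s²) ds` in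
dimension one. -/
lemma GrowthCondition.tendsto_poissonIntegral_sub (hf : GrowthCondition f)
    (hm : AEStronglyMeasurable f volume) (x x' : EuclideanSpace ℝ (Fin n)) :
    Tendsto (fun t => poissonIntegral t f x - poissonIntegral t f x') atTop (𝓝 0) := by
  obtain ⟨C, hC, h⟩ := exists_abs_poissonKernel_sub_le x x'
  have hlim : Tendsto (fun t => ∫ y, (poissonKernel t x y - poissonKernel t x' y) • f y) atTop
      (𝓝 (∫ _ : EuclideanSpace ℝ (Fin n), (0 : 𝕜))) := by
    refine tendsto_integral_filter_of_dominated_convergence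
      (fun y => C * (growthWeight y * ‖f y‖)) (Eventually.of_forall fun t =>
        ((measurable_poissonKernel_right t x).sub
          (measurable_poissonKernel_right t x')).aestronglyMeasurable.smul hm) ?_
      (hf.integrable.const_mul C) ?_
    · filter_upwards [eventually_ge_atTop 1] with t ht
      refine Eventually.of_forall fun y => ?_
      rw [norm_smul, ← mul_assoc]
      gcongr
      exact (h t ht y).1
    · refine Eventually.of_forall fun y => ?_
      have h1 : Tendsto (fun t => poissonKernel t x y - poissonKernel t x' y) atTop (𝓝 0) := by
        refine squeeze_zero_norm' ?_ (tendsto_const_nhds.div_atTop tendsto_id :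
          Tendsto (fun t : ℝ => C * (1 + ‖y‖) / t) atTop (𝓝 0))
        filter_upwards [eventually_ge_atTop 1] with t ht
        exact (h t ht y).2
      simpa using h1.smul_const (f y)
  rw [integral_zero] at hlim
  refine hlim.congr' ?_
  filter_upwards [eventually_gt_atTop 0] with t ht
  simp only [sub_smul]
  rw [integral_sub ((integrable_poissonMeasure_iff ht.le x).1 (hf.integrable_poissonMeasure hm ht x))
    ((integrable_poissonMeasure_iff ht.le x').1 (hf.integrable_poissonMeasure hm ht x'))]
  rfl

end

/-! ### The boundary function -/

section

variable {𝕜 : Type*} [RCLike 𝕜] {f : EuclideanSpace ℝ (Fin n) → 𝕜}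

lemma PoissonLipBound.ae_norm_le {α A : ℝ} (hA : 0 ≤ A) (h : PoissonLipBound α f A) {t : ℝ}
    (ht : 0 < t) : ∀ᵐ x, ‖t • deriv (fun s : ℝ => poissonIntegral s f x) t‖ ≤ A * t ^ α := by
  have h1 := (h t ht).2
  rw [eLpNorm_exponent_top] at h1
  filter_upwards [ae_le_eLpNormEssSup (f := fun x : EuclideanSpace ℝ (Fin n) =>
      t • deriv (fun s : ℝ => poissonIntegral s f x) t) (μ := volume)] with x hx
  have h2 := hx.trans h1
  rw [← ofReal_norm] at h2
  exact (ENNReal.ofReal_le_ofReal_iff (by positivity)).1 h2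

/-- Integration of the derivative bound in `t`. The bound holds for almost every `x` with an
exceptional set depending on `t`; in the variable `s = ln t` the derivative is jointly measurable,
so Fubini's theorem and continuity in `x` give the estimate for every `x`. -/
lemma norm_poissonIntegral_sub_le {α A : ℝ} (hα : 0 < α) (hA : 0 ≤ A) (hf : GrowthCondition f)
    (hm : AEStronglyMeasurable f volume) (h : PoissonLipBound α f A) {s t : ℝ} (hs : 0 < s)
    (hst : s ≤ t) (x : EuclideanSpace ℝ (Fin n)) :
    ‖poissonIntegral t f x - poissonIntegral s f x‖ ≤ A / α * t ^ α := by
  set v : EuclideanSpace ℝ (Fin n) → ℝ → 𝕜 := fun x u => poissonIntegral (Real.exp u) f x with hv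
  have hcont : Continuous (Function.uncurry v) := by
    refine continuous_iff_continuousAt.2 fun q => ?_
    have h1 := hf.continuousAt_poissonIntegral hm (Real.exp_pos q.2) q.1
    have h2 : ContinuousAt (fun q : EuclideanSpace ℝ (Fin n) × ℝ => (q.1, Real.exp q.2)) q := by
      fun_prop
    exact ContinuousAt.comp (f := fun q : EuclideanSpace ℝ (Fin n) × ℝ => (q.1, Real.exp q.2))
      (g := fun q : EuclideanSpace ℝ (Fin n) × ℝ => poissonIntegral q.2 f q.1) h1 h2
  have hderiv : ∀ x u, HasDerivAt (v x)
      (Real.exp u • deriv (fun s : ℝ => poissonIntegral s f x) (Real.exp u)) u := fun x u =>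
    HasDerivAt.scomp u (((h _ (Real.exp_pos u)).1 x).hasDerivAt) (Real.hasDerivAt_exp u)
  have hmeas : Measurable fun p : EuclideanSpace ℝ (Fin n) × ℝ => deriv (v p.1) p.2 :=
    measurable_deriv_with_param hcont
  have hae : ∀ᵐ x, ∀ᵐ u : ℝ, ‖deriv (v x) u‖ ≤ A * Real.exp (α * u) := by
    have hset : MeasurableSet {q : EuclideanSpace ℝ (Fin n) × ℝ |
        ‖deriv (v q.1) q.2‖ ≤ A * Real.exp (α * q.2)} :=
      measurableSet_le hmeas.norm (by fun_prop)
    refine (Measure.ae_ae_comm (p := fun x u => ‖deriv (v x) u‖ ≤ A * Real.exp (α * u)) hset).2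
      (Eventually.of_forall fun u => ?_)
    filter_upwards [h.ae_norm_le hA (Real.exp_pos u)] with x hx
    rw [(hderiv x u).deriv]
    refine hx.trans (le_of_eq ?_)
    rw [← Real.exp_mul, mul_comm u α]
  have hae2 : ∀ᵐ x, ‖poissonIntegral t f x - poissonIntegral s f x‖ ≤ A / α * t ^ α := by
    filter_upwards [hae] with x hx
    have ht : 0 < t := hs.trans_le hst
    have hlog : Real.log s ≤ Real.log t := Real.log_le_log hs hst
    have hbint : IntervalIntegrable (fun u => A * Real.exp (α * u)) volume
        (Real.log s) (Real.log t) := Continuous.intervalIntegrable (by fun_prop) _ _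
    have hdint : IntervalIntegrable (deriv (v x)) volume (Real.log s) (Real.log t) :=
      hbint.mono_fun' (hmeas.comp measurable_prodMk_left).aestronglyMeasurable
        (ae_restrict_of_ae hx)
    have hftc := intervalIntegral.integral_eq_sub_of_hasDerivAt
      (fun u _ => (hderiv x u).differentiableAt.hasDerivAt) hdint
    simp only [hv, Real.exp_log ht, Real.exp_log hs] at hftc
    rw [← hftc]
    refine (intervalIntegral.norm_integral_le_of_norm_le hlog ?_ hbint).trans ?_
    · filter_upwards [hx] with u hu _ using hu
    · have hint : ∫ u in Real.log s..Real.log t, A * Real.exp (α * u) =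
          A / α * (t ^ α - s ^ α) := by
        rw [intervalIntegral.integral_const_mul,
          intervalIntegral.integral_comp_mul_left (fun u => Real.exp u) hα.ne', integral_exp,
          Real.rpow_def_of_pos ht, Real.rpow_def_of_pos hs, smul_eq_mul, mul_comm α, mul_comm α]
        field_simp
      rw [hint]
      have : 0 ≤ s ^ α := by positivity
      gcongr
      linarith
  have ht : 0 < t := hs.trans_le hst
  have hcx : ∀ r : ℝ, 0 < r → Continuous fun x => poissonIntegral r f x := fun r hr =>
    continuous_iff_continuousAt.2 fun x =>
      ContinuousAt.comp (f := fun x : EuclideanSpace ℝ (Fin n) => (x, r))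
        (g := fun q : EuclideanSpace ℝ (Fin n) × ℝ => poissonIntegral q.2 f q.1)
        (hf.continuousAt_poissonIntegral hm hr x) (by fun_prop)
  have hclosed : IsClosed {x | ‖poissonIntegral t f x - poissonIntegral s f x‖ ≤ A / α * t ^ α} :=
    isClosed_le ((hcx t ht).sub (hcx s hs)).norm continuous_const
  have hdense := Measure.dense_of_ae hae2
  have huniv := hclosed.closure_eq.symm.trans hdense.closure_eq
  have hx := mem_univ x
  rwa [← huniv] at hx

/-- The boundary function: the uniform limit of `P_t f` as `t → 0`. -/
lemma exists_continuous_norm_sub_poissonIntegral_le {α A : ℝ} (hα : 0 < α) (hA : 0 ≤ A)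
    (hf : GrowthCondition f) (hm : AEStronglyMeasurable f volume) (h : PoissonLipBound α f A) :
    ∃ g : EuclideanSpace ℝ (Fin n) → 𝕜, Continuous g ∧
      ∀ t : ℝ, 0 < t → ∀ x, ‖g x - poissonIntegral t f x‖ ≤ A / α * t ^ α := by
  set τ : ℕ → ℝ := fun k => 1 / ((k : ℝ) + 1) with hτ
  have hτ0 : ∀ k, 0 < τ k := fun k => by simp only [hτ]; positivity
  have hτlim : Tendsto τ atTop (𝓝 0) := tendsto_one_div_add_atTop_nhds_zero_nat
  have hτanti : Antitone τ := fun a b hab => by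
    simp only [hτ]; gcongr
  have hpow : Tendsto (fun k => A / α * τ k ^ α) atTop (𝓝 0) := by
    have := ((Real.continuous_rpow_const hα.le).tendsto 0).comp hτlim
    rw [Real.zero_rpow hα.ne'] at this
    simpa [Function.comp_def] using this.const_mul (A / α)
  have hcauchy : ∀ x, CauchySeq fun k => poissonIntegral (τ k) f x := by
    intro x
    refine cauchySeq_of_le_tendsto_0 _ (fun a b N ha hb => ?_) hpow
    have hmono : ∀ c, N ≤ c → A / α * τ c ^ α ≤ A / α * τ N ^ α := fun c hc => by
      have := hτ0 c
      have := hτanti hc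
      gcongr
    rcases le_total a b with hab | hab
    · rw [dist_eq_norm]
      exact (norm_poissonIntegral_sub_le hα hA hf hm h (hτ0 b) (hτanti hab) x).trans (hmono a ha)
    · rw [dist_comm, dist_eq_norm]
      exact (norm_poissonIntegral_sub_le hα hA hf hm h (hτ0 a) (hτanti hab) x).trans (hmono b hb)
  choose g hg using fun x => cauchySeq_tendsto_of_complete (hcauchy x)
  have hbd : ∀ t : ℝ, 0 < t → ∀ x, ‖g x - poissonIntegral t f x‖ ≤ A / α * t ^ α := by
    intro t ht x
    rw [norm_sub_rev]
    refine le_of_tendsto ((tendsto_const_nhds.sub (hg x)).norm) ?_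
    filter_upwards [hτlim.eventually_le_const ht] with k hk
    exact norm_poissonIntegral_sub_le hα hA hf hm h (hτ0 k) hk x
  refine ⟨g, ?_, hbd⟩
  have hunif : TendstoUniformly (fun k x => poissonIntegral (τ k) f x) g atTop := by
    rw [Metric.tendstoUniformly_iff]
    intro ε hε
    filter_upwards [hpow.eventually_lt_const hε] with k hk x
    rw [dist_eq_norm]
    exact (hbd (τ k) (hτ0 k) x).trans_lt hk
  refine hunif.continuous (Frequently.of_forall fun k => ?_)
  exact continuous_iff_continuousAt.2 fun x =>
    ContinuousAt.comp (f := fun x : EuclideanSpace ℝ (Fin n) => (x, τ k))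
      (g := fun q : EuclideanSpace ℝ (Fin n) × ℝ => poissonIntegral q.2 f q.1)
      (hf.continuousAt_poissonIntegral hm (hτ0 k) x) (by fun_prop)

/-- The Poisson kernel is symmetric with respect to the Gauss measure. -/
lemma exp_mul_poissonKernel_comm (t : ℝ) (x y : EuclideanSpace ℝ (Fin n)) :
    Real.exp (-‖x‖ ^ 2) * poissonKernel t x y = Real.exp (-‖y‖ ^ 2) * poissonKernel t y x := by
  rw [poissonKernel_eq, poissonKernel_eq, ← integral_const_mul, ← integral_const_mul]
  refine setIntegral_congr_fun measurableSet_Ioi fun r hr => ?_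
  have h0 := one_sub_exp_sq_pos hr
  have h1 : Real.exp (-‖x‖ ^ 2) * mehlerKernel (Real.exp (-r)) x y =
      Real.exp (-‖y‖ ^ 2) * mehlerKernel (Real.exp (-r)) y x := by
    rw [mehlerKernel, mehlerKernel, mehler_exponent_eq x y (by linarith), ← mul_div_assoc,
      ← mul_div_assoc, ← Real.exp_add, ← Real.exp_add]
    congr 2
    ring
  linear_combination (Real.pi ^ (-((n : ℝ) / 2)) * levyDensity t r) * h1

/-- Symmetry of `P_t` in `L²` of the Gauss measure, up to the normalizing constant. -/
lemma integral_smul_poissonIntegral_comm (hf : GrowthCondition f) (hm : StronglyMeasurable f)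
    {ψ : EuclideanSpace ℝ (Fin n) → ℝ} (hψ : Continuous ψ) (hψc : HasCompactSupport ψ) {t : ℝ}
    (ht : 0 < t) :
    ∫ x, (ψ x * Real.exp (-‖x‖ ^ 2)) • poissonIntegral t f x =
      ∫ y, (Real.exp (-‖y‖ ^ 2) * poissonIntegral t ψ y) • f y := by
  obtain ⟨R, hR⟩ := hψc.isCompact.isBounded.exists_norm_le
  obtain ⟨C, hC, hker⟩ := exists_poissonKernel_le n R ht le_rfl
  have h1 : ∀ x, (ψ x * Real.exp (-‖x‖ ^ 2)) • poissonIntegral t f x =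
      ∫ y, (ψ x * Real.exp (-‖x‖ ^ 2) * poissonKernel t x y) • f y := by
    intro x
    rw [poissonIntegral, ← integral_smul]
    simp only [smul_smul]
  have h2 : ∀ y, (Real.exp (-‖y‖ ^ 2) * poissonIntegral t ψ y) • f y =
      ∫ x, (ψ x * Real.exp (-‖x‖ ^ 2) * poissonKernel t x y) • f y := by
    intro y
    rw [integral_smul_const, poissonIntegral, ← integral_const_mul]
    congr 2
    ext x
    rw [smul_eq_mul]
    linear_combination -(ψ x) * exp_mul_poissonKernel_comm t x y
  simp only [h1, h2]
  refine integral_integral_swap ?_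
  have hdom : Integrable (fun p : EuclideanSpace ℝ (Fin n) × EuclideanSpace ℝ (Fin n) =>
      |ψ p.1| * (C * (growthWeight p.2 * ‖f p.2‖))) (volume.prod volume) :=
    (hψ.integrable_of_hasCompactSupport hψc).norm.mul_prod (hf.integrable.const_mul C)
  refine hdom.mono' ?_ (Eventually.of_forall fun p => ?_)
  · have hk := measurable_poissonKernel (n := n) t
    have hψm := hψ.measurable
    refine (StronglyMeasurable.smul (Measurable.stronglyMeasurable (by fun_prop))
      (hm.comp_measurable measurable_snd)).aestronglyMeasurable
  · simp only [Function.uncurry]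
    rw [norm_smul, norm_mul, norm_mul, Real.norm_eq_abs (ψ p.1),
      Real.norm_of_nonneg (Real.exp_pos _).le, Real.norm_of_nonneg (poissonKernel_nonneg ht.le _ _)]
    by_cases hp : ψ p.1 = 0
    · simp [hp]
    have hx := hker t ⟨le_rfl, le_rfl⟩ p.1 p.2 (hR _ (subset_tsupport _ hp))
    have he : Real.exp (-‖p.1‖ ^ 2) ≤ 1 := by
      rw [Real.exp_le_one_iff, neg_nonpos]; positivity
    have hk0 := poissonKernel_nonneg ht.le p.1 p.2
    calc |ψ p.1| * Real.exp (-‖p.1‖ ^ 2) * poissonKernel t p.1 p.2 * ‖f p.2‖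
        ≤ |ψ p.1| * 1 * (C * growthWeight p.2) * ‖f p.2‖ := by gcongr
      _ = _ := by ring

/-- Before time `½ ln (e + |y|)` the flow started at a far point `y` reaches a fixed ball only if
the Gaussian variable `z` is large. -/
lemma sqrt_log_le_of_norm_ouFlow_le {R r : ℝ} {y z : EuclideanSpace ℝ (Fin n)}
    (hr' : r ≤ 1 / 2 * Real.log (Real.exp 1 + ‖y‖)) (h : ‖ouFlow y (r, z)‖ ≤ R) :
    √(Real.log (Real.exp 1 + ‖y‖)) ≤ ‖z‖ + (2 + R) := by
  have hb : 0 < Real.exp 1 + ‖y‖ := by positivity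
  set b := Real.exp 1 + ‖y‖ with hbdef
  have hsb : 0 < √b := Real.sqrt_pos.2 hb
  have hsb2 : √b ^ 2 = b := Real.sq_sqrt hb.le
  have h1 : (√b)⁻¹ ≤ Real.exp (-r) := by
    rw [Real.sqrt_eq_rpow, Real.rpow_def_of_pos hb, ← Real.exp_neg]
    apply Real.exp_le_exp.2; linarith
  have h2 : Real.exp (-r) * ‖y‖ ≤ R + ‖z‖ := by
    have h3 : Real.exp (-r) • y = ouFlow y (r, z) - √(1 - Real.exp (-r) ^ 2) • z := by
      simp [ouFlow]
    have h4 : ‖Real.exp (-r) • y‖ = Real.exp (-r) * ‖y‖ := by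
      rw [norm_smul, Real.norm_of_nonneg (Real.exp_pos _).le]
    have h5 : √(1 - Real.exp (-r) ^ 2) ≤ 1 := by
      rw [Real.sqrt_le_left zero_le_one]; nlinarith [Real.exp_pos (-r)]
    rw [← h4, h3]
    refine (norm_sub_le _ _).trans (add_le_add h ?_)
    rw [norm_smul, Real.norm_of_nonneg (Real.sqrt_nonneg _)]
    exact mul_le_of_le_one_left (norm_nonneg _) h5
  have h6 : √b - 2 ≤ (√b)⁻¹ * ‖y‖ := by
    rw [← sub_nonneg]
    have hy : ‖y‖ = √b ^ 2 - Real.exp 1 := by rw [hsb2, hbdef]; ring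
    have he : Real.exp 1 ≤ 4 := by linarith [Real.exp_one_lt_d9]
    have hb1 : 2 ≤ 2 * √b := by
      have : 1 ≤ √b := by
        rw [Real.one_le_sqrt]
        linarith [Real.add_one_le_exp 1, norm_nonneg y]
      linarith
    have hbe : √(Real.exp 1) ≤ √b := Real.sqrt_le_sqrt (by linarith [norm_nonneg y])
    have he2 : √(Real.exp 1) ≤ 2 := by
      rw [Real.sqrt_le_left (by norm_num)]; linarith
    have he3 : Real.exp 1 = √(Real.exp 1) ^ 2 := (Real.sq_sqrt (Real.exp_pos 1).le).symm
    have he4 := Real.sqrt_nonneg (Real.exp 1)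
    rw [hy]
    have : (√b)⁻¹ * (√b ^ 2 - Real.exp 1) - (√b - 2) = (2 * √b - Real.exp 1) / √b := by
      field_simp; ring
    rw [this]
    apply div_nonneg _ hsb.le
    nlinarith
  have h7 : √(Real.log b) ≤ √b := Real.sqrt_le_sqrt (by linarith [Real.log_le_sub_one_of_pos hb])
  have h8 : (√b)⁻¹ * ‖y‖ ≤ Real.exp (-r) * ‖y‖ := by gcongr
  linarith

/-- The Poisson integral of a function of compact support decays like `1 / √ln (e + |y|)`,
uniformly in `t ≤ 1`: to reach the support from `y` the flow needs either a late Lévy time or a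
large Gaussian variable. -/
lemma exists_abs_poissonIntegral_le {ψ : EuclideanSpace ℝ (Fin n) → ℝ} (hψ : Continuous ψ)
    (hψc : HasCompactSupport ψ) :
    ∃ C : ℝ, 0 < C ∧ ∀ t : ℝ, 0 < t → t ≤ 1 → ∀ y,
      |poissonIntegral t ψ y| ≤ C / √(Real.log (Real.exp 1 + ‖y‖)) := by
  obtain ⟨R, hR⟩ := hψc.isCompact.isBounded.exists_norm_le
  obtain ⟨M, hM⟩ := hψc.exists_bound_of_continuous hψ
  have hM0 : 0 ≤ M := (norm_nonneg _).trans (hM 0)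
  set m : ℝ := ∫ z, |‖z‖ + (2 + R)| ∂gaussMeasure n with hm
  have hm0 : 0 ≤ m := integral_nonneg fun z => abs_nonneg _
  have hmi : Integrable (fun z : EuclideanSpace ℝ (Fin n) => |‖z‖ + (2 + R)|) (gaussMeasure n) :=
    (integrable_norm_gaussMeasure.add (integrable_const _)).abs
  refine ⟨M * (4 + m) + 1, by positivity, fun t ht ht1 y => ?_⟩
  have := isProbabilityMeasure_levyMeasure ht
  set L := Real.log (Real.exp 1 + ‖y‖) with hL
  have hs := one_le_sqrt_log ‖y‖ (norm_nonneg y)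
  rw [← hL] at hs
  have hs0 : 0 < √L := by linarith
  have hL1 : 1 ≤ L := by
    rw [Real.one_le_sqrt] at hs; exact hs
  have hr₀ : 0 < 1 / 2 * L := by positivity
  have hind : Integrable (fun r : ℝ => (Ioi (1 / 2 * L)).indicator (fun _ => (1 : ℝ)) r)
      (levyMeasure t) := (integrable_const 1).indicator measurableSet_Ioi
  have hI : ∫ r, (Ioi (1 / 2 * L)).indicator (fun _ => (1 : ℝ)) r ∂levyMeasure t ≤ 4 / √L := by
    rw [integral_levyMeasure ht.le]
    have h1 : ∀ r, levyDensity t r • (Ioi (1 / 2 * L)).indicator (fun _ => (1 : ℝ)) r =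
        (Ioi (1 / 2 * L)).indicator (levyDensity t) r := by
      intro r; simp only [indicator]; split_ifs <;> simp
    simp only [h1]
    rw [setIntegral_indicator measurableSet_Ioi, inter_eq_right.2 (Ioi_subset_Ioi hr₀.le)]
    refine (setIntegral_Ioi_levyDensity_le ht.le hr₀).trans ?_
    rw [div_le_div_iff₀ (Real.sqrt_pos.2 hr₀) hs0]
    have h2 : √L ≤ √(4 * (1 / 2 * L)) := Real.sqrt_le_sqrt (by linarith)
    rw [Real.sqrt_mul (by norm_num), show (4 : ℝ) = 2 ^ 2 by norm_num,
      Real.sqrt_sq (by norm_num)] at h2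
    calc 2 * t * √L ≤ 2 * 1 * √L := by gcongr
      _ ≤ _ := by linarith
  have hdom : Integrable (fun p : ℝ × EuclideanSpace ℝ (Fin n) =>
      M * ((Ioi (1 / 2 * L)).indicator (fun _ => (1 : ℝ)) p.1 + |‖p.2‖ + (2 + R)| / √L))
      ((levyMeasure t).prod (gaussMeasure n)) :=
    ((hind.comp_fst (gaussMeasure n)).add ((hmi.div_const _).comp_snd (levyMeasure t))).const_mul M
  rw [poissonIntegral_eq_integral_ouFlow ht hψ.aestronglyMeasurable, ← Real.norm_eq_abs]
  have h3 : ∀ᵐ p ∂(levyMeasure t).prod (gaussMeasure n), 0 < p.1 :=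
    Measure.quasiMeasurePreserving_fst.ae (ae_levyMeasure_pos t)
  refine (norm_integral_le_of_norm_le hdom ?_).trans ?_
  · filter_upwards [h3] with p hp
    have h0 : 0 ≤ (Ioi (1 / 2 * L)).indicator (fun _ => (1 : ℝ)) p.1 :=
      indicator_nonneg (fun _ _ => zero_le_one) _
    have h0' : 0 ≤ |‖p.2‖ + (2 + R)| / √L := by positivity
    by_cases hz : ψ (ouFlow y p) = 0
    · rw [hz, norm_zero]; positivity
    have hin := hR _ (subset_tsupport _ hz)
    have hone : 1 ≤ (Ioi (1 / 2 * L)).indicator (fun _ => (1 : ℝ)) p.1 +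
        |‖p.2‖ + (2 + R)| / √L := by
      by_cases hp' : p.1 ≤ 1 / 2 * L
      · have h4 := sqrt_log_le_of_norm_ouFlow_le hp' hin
        have h5 : 1 ≤ |‖p.2‖ + (2 + R)| / √L := by
          rw [one_le_div hs0]; exact h4.trans (le_abs_self _)
        linarith
      · rw [indicator_of_mem (by simpa using hp')]
        linarith
    calc _ ≤ M * 1 := by rw [mul_one]; exact hM _
      _ ≤ _ := by gcongr
  · rw [integral_const_mul, integral_add (hind.comp_fst _) ((hmi.div_const _).comp_snd _),
      integral_fun_fst,
      integral_fun_snd (f := fun z : EuclideanSpace ℝ (Fin n) => |‖z‖ + (2 + R)| / √L),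
      probReal_univ, probReal_univ, one_smul, one_smul, integral_div, ← hm]
    calc _ ≤ M * (4 / √L + m / √L) := by gcongr
      _ = M * (4 + m) / √L := by ring
      _ ≤ _ := by gcongr; linarith

lemma continuous_ouSemigroup {F : Type*} [NormedAddCommGroup F] [NormedSpace ℝ F] {M : ℝ}
    {h : EuclideanSpace ℝ (Fin n) → F} (hh : Continuous h) (hM : ∀ y, ‖h y‖ ≤ M)
    (y : EuclideanSpace ℝ (Fin n)) : Continuous fun r => ouSemigroup r h y := by
  refine continuous_of_dominated (bound := fun _ => M) (fun r => ?_)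
    (fun r => Eventually.of_forall fun z => hM _) (integrable_const M)
    (Eventually.of_forall fun z => ?_)
  · have : Continuous fun z => h (ouFlow y (r, z)) := by
      refine hh.comp ?_
      unfold ouFlow; fun_prop
    exact this.aestronglyMeasurable
  · refine hh.comp ?_
    unfold ouFlow; fun_prop

lemma ouSemigroup_zero {F : Type*} [NormedAddCommGroup F] [NormedSpace ℝ F] [CompleteSpace F]
    (h : EuclideanSpace ℝ (Fin n) → F) : ouSemigroup 0 h = h := by
  ext y
  simp [ouSemigroup, ouFlow]

lemma norm_ouSemigroup_le {F : Type*} [NormedAddCommGroup F] [NormedSpace ℝ F] {M : ℝ}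
    {h : EuclideanSpace ℝ (Fin n) → F} (hM : ∀ y, ‖h y‖ ≤ M) (r : ℝ)
    (y : EuclideanSpace ℝ (Fin n)) : ‖ouSemigroup r h y‖ ≤ M := by
  have h1 := norm_integral_le_of_norm_le_const (μ := gaussMeasure n)
    (f := fun z => h (ouFlow y (r, z))) (C := M) (Eventually.of_forall fun z => hM _)
  rwa [probReal_univ, mul_one] at h1

lemma integrable_poissonMeasure_of_bound {h : EuclideanSpace ℝ (Fin n) → 𝕜}
    (hh : StronglyMeasurable h) {M : ℝ} (hM : ∀ y, ‖h y‖ ≤ M) {t : ℝ} (ht : 0 < t)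
    (x : EuclideanSpace ℝ (Fin n)) : Integrable h (poissonMeasure t x) := by
  have := isProbabilityMeasure_poissonMeasure ht x
  exact Integrable.of_bound hh.aestronglyMeasurable M (Eventually.of_forall hM)

lemma tendsto_poissonIntegral_nhdsGT_zero {ψ : EuclideanSpace ℝ (Fin n) → ℝ} (hψ : Continuous ψ)
    {M : ℝ} (hM : ∀ y, ‖ψ y‖ ≤ M) (y : EuclideanSpace ℝ (Fin n)) :
    Tendsto (fun t => poissonIntegral t ψ y) (𝓝[>] 0) (𝓝 (ψ y)) := by
  have hc := continuous_ouSemigroup hψ hM y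
  have h1 : Tendsto (fun t : ℝ => ∫ r in Ioi 0, levyDensity 1 r • ouSemigroup (t ^ 2 * r) ψ y)
      (𝓝 0) (𝓝 (∫ r in Ioi 0, levyDensity 1 r • ouSemigroup ((0 : ℝ) ^ 2 * r) ψ y)) := by
    refine tendsto_integral_filter_of_dominated_convergence (fun r => levyDensity 1 r * M)
      (Eventually.of_forall fun t => ?_) (Eventually.of_forall fun t => ?_)
      ((integrableOn_levyDensity one_pos).mul_const M) (Eventually.of_forall fun r => ?_)
    · exact ((measurable_levyDensity 1).mul
        (hc.comp (continuous_const.mul continuous_id)).measurable).aestronglyMeasurable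
    · filter_upwards [self_mem_ae_restrict measurableSet_Ioi] with r hr
      rw [norm_smul, Real.norm_of_nonneg (levyDensity_nonneg zero_le_one hr)]
      exact mul_le_mul_of_nonneg_left (norm_ouSemigroup_le hM _ y)
        (levyDensity_nonneg zero_le_one hr)
    · have h4 : Continuous fun t : ℝ => t ^ 2 * r := by fun_prop
      have h2 : Continuous fun t : ℝ => levyDensity 1 r • ouSemigroup (t ^ 2 * r) ψ y :=
        continuous_const.fun_smul (hc.comp h4 : Continuous fun t : ℝ => ouSemigroup (t ^ 2 * r) ψ y)
      exact h2.tendsto 0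
  have h3 : ∫ r in Ioi 0, levyDensity 1 r • ouSemigroup ((0 : ℝ) ^ 2 * r) ψ y = ψ y := by
    simp only [ne_eq, OfNat.ofNat_ne_zero, not_false_eq_true, zero_pow, zero_mul, ouSemigroup_zero]
    rw [integral_smul_const, integral_levyDensity one_pos, one_smul]
  rw [h3] at h1
  refine (h1.mono_left nhdsWithin_le_nhds).congr' ?_
  filter_upwards [self_mem_nhdsWithin] with t ht
  rw [poissonIntegral_eq_integral_ouSemigroup ht hψ.aestronglyMeasurable
    (integrable_poissonMeasure_of_bound hψ.stronglyMeasurable hM ht y),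
    integral_levyDensity_smul_eq ht]

lemma continuous_growthWeight :
    Continuous (growthWeight : EuclideanSpace ℝ (Fin n) → ℝ) := by
  unfold growthWeight
  refine Continuous.div (by fun_prop) ?_ fun y => by
    have := one_le_sqrt_log ‖y‖ (norm_nonneg y); positivity
  refine Real.continuous_sqrt.comp (Continuous.log (by fun_prop) fun y => ?_)
  positivity

/-- A function that is uniformly approximated by `P_t f` as `t → 0` agrees with `f` almost
everywhere. By symmetry of the kernel it suffices to test against continuous functions `ψ` of
compact support, and `P_t ψ → ψ` with a majorant that matches the growth condition. -/
lemma GrowthCondition.ae_eq_of_norm_sub_poissonIntegral_le (hf : GrowthCondition f)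
    (hm : StronglyMeasurable f) {α B : ℝ} (hα : 0 < α) (hB : 0 ≤ B)
    {g : EuclideanSpace ℝ (Fin n) → 𝕜}
    (hg : Continuous g)
    (hgf : ∀ t : ℝ, 0 < t → ∀ x, ‖g x - poissonIntegral t f x‖ ≤ B * t ^ α) :
    g =ᵐ[volume] f := by
  have htest : ∀ ψ : EuclideanSpace ℝ (Fin n) → ℝ, Continuous ψ → HasCompactSupport ψ →
      ∫ x, (ψ x * Real.exp (-‖x‖ ^ 2)) • g x = ∫ x, (ψ x * Real.exp (-‖x‖ ^ 2)) • f x := by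
    intro ψ hψ hψc
    obtain ⟨M, hM⟩ := hψc.exists_bound_of_continuous hψ
    obtain ⟨C, hC, hCb⟩ := exists_abs_poissonIntegral_le hψ hψc
    have hsmall : ∀ᶠ t : ℝ in 𝓝[>] 0, 0 < t ∧ t ≤ 1 := by
      filter_upwards [self_mem_nhdsWithin, nhdsWithin_le_nhds (eventually_le_nhds one_pos)]
        with t h1 h2 using ⟨h1, h2⟩
    have hL : Tendsto (fun t => ∫ x, (ψ x * Real.exp (-‖x‖ ^ 2)) • poissonIntegral t f x)
        (𝓝[>] 0) (𝓝 (∫ x, (ψ x * Real.exp (-‖x‖ ^ 2)) • g x)) := by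
      refine tendsto_integral_filter_of_dominated_convergence
        (fun x => |ψ x| * (‖g x‖ + B)) (Eventually.of_forall fun t => ?_) ?_ ?_ ?_
      · exact (StronglyMeasurable.smul (by fun_prop)
          (stronglyMeasurable_poissonIntegral f hm)).aestronglyMeasurable
      · filter_upwards [hsmall] with t ht
        refine Eventually.of_forall fun x => ?_
        have h1 := norm_le_norm_add_norm_sub' (poissonIntegral t f x) (g x)
        rw [norm_sub_rev] at h1
        have h2 := hgf t ht.1 x
        have h3 : B * t ^ α ≤ B := mul_le_of_le_one_right hB
          (Real.rpow_le_one ht.1.le ht.2 hα.le)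
        have he : Real.exp (-‖x‖ ^ 2) ≤ 1 := by
          rw [Real.exp_le_one_iff, neg_nonpos]; positivity
        rw [norm_smul, norm_mul, Real.norm_of_nonneg (Real.exp_pos _).le, Real.norm_eq_abs]
        calc _ ≤ |ψ x| * 1 * (‖g x‖ + B) := by gcongr; linarith
          _ = _ := by ring
      · exact Continuous.integrable_of_hasCompactSupport (by fun_prop) (hψc.abs.mul_right)
      · refine Eventually.of_forall fun x => Tendsto.const_smul ?_ _
        rw [tendsto_iff_norm_sub_tendsto_zero]
        have hpow : Tendsto (fun t : ℝ => B * t ^ α) (𝓝[>] 0) (𝓝 0) := by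
          have := (Real.continuous_rpow_const hα.le).tendsto 0
          rw [Real.zero_rpow hα.ne'] at this
          simpa using (this.mono_left nhdsWithin_le_nhds).const_mul B
        refine squeeze_zero' (Eventually.of_forall fun t => norm_nonneg _) ?_ hpow
        filter_upwards [self_mem_nhdsWithin] with t ht
        rw [norm_sub_rev]
        exact hgf t ht x
    have hR : Tendsto (fun t => ∫ y, (Real.exp (-‖y‖ ^ 2) * poissonIntegral t ψ y) • f y)
        (𝓝[>] 0) (𝓝 (∫ y, (Real.exp (-‖y‖ ^ 2) * ψ y) • f y)) := by
      refine tendsto_integral_filter_of_dominated_convergence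
        (fun y => C * (growthWeight y * ‖f y‖)) (Eventually.of_forall fun t => ?_) ?_
        (hf.integrable.const_mul C) ?_
      · exact (StronglyMeasurable.smul (StronglyMeasurable.mul (by fun_prop)
          (stronglyMeasurable_poissonIntegral ψ hψ.stronglyMeasurable)) hm).aestronglyMeasurable
      · filter_upwards [hsmall] with t ht
        refine Eventually.of_forall fun y => ?_
        rw [norm_smul, norm_mul, Real.norm_of_nonneg (Real.exp_pos _).le, Real.norm_eq_abs,
          growthWeight]
        calc _ ≤ Real.exp (-‖y‖ ^ 2) * (C / √(Real.log (Real.exp 1 + ‖y‖))) * ‖f y‖ := by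
              gcongr; exact hCb t ht.1 ht.2 y
          _ = _ := by ring
      · exact Eventually.of_forall fun y =>
          ((tendsto_poissonIntegral_nhdsGT_zero hψ hM y).const_mul _).smul_const _
    have hLR : Tendsto (fun t => ∫ x, (ψ x * Real.exp (-‖x‖ ^ 2)) • poissonIntegral t f x)
        (𝓝[>] 0) (𝓝 (∫ y, (Real.exp (-‖y‖ ^ 2) * ψ y) • f y)) := by
      refine hR.congr' ?_
      filter_upwards [self_mem_nhdsWithin] with t ht
      exact (integral_smul_poissonIntegral_comm hf hm hψ hψc ht).symm
    rw [tendsto_nhds_unique hL hLR]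
    simp only [mul_comm]
  have hwpos : ∀ y : EuclideanSpace ℝ (Fin n), 0 < growthWeight y := fun y => by
    have := one_le_sqrt_log ‖y‖ (norm_nonneg y)
    unfold growthWeight; positivity
  have hwg : LocallyIntegrable (fun y => growthWeight y • g y) volume :=
    (continuous_growthWeight.smul hg).locallyIntegrable
  have hwf : LocallyIntegrable (fun y => growthWeight y • f y) volume := by
    refine Integrable.locallyIntegrable ?_
    refine hf.integrable.mono' (continuous_growthWeight.stronglyMeasurable.smul
      hm).aestronglyMeasurable (Eventually.of_forall fun y => ?_)
    rw [norm_smul, Real.norm_of_nonneg (growthWeight_nonneg y)]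
  have hae := ae_eq_of_integral_contDiff_smul_eq hwg hwf fun φ hφ hφc => by
    have hsqrt : Continuous fun x : EuclideanSpace ℝ (Fin n) =>
        √(Real.log (Real.exp 1 + ‖x‖)) :=
      Real.continuous_sqrt.comp (Continuous.log (by fun_prop) fun y => by positivity)
    have hcψ : Continuous fun x => φ x * (√(Real.log (Real.exp 1 + ‖x‖)))⁻¹ :=
      hφ.continuous.mul (hsqrt.inv₀ fun y => by
        have := one_le_sqrt_log ‖y‖ (norm_nonneg y); positivity)
    -- with this choice of `ψ` the Gaussian weight in `htest` becomes `growthWeight`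
    have h1 := htest (fun x => φ x * (√(Real.log (Real.exp 1 + ‖x‖)))⁻¹) hcψ hφc.mul_right
    have h2 : ∀ (u : EuclideanSpace ℝ (Fin n) → 𝕜) x,
        (φ x * (√(Real.log (Real.exp 1 + ‖x‖)))⁻¹ * Real.exp (-‖x‖ ^ 2)) • u x =
        φ x • growthWeight x • u x := by
      intro u x
      rw [smul_smul, growthWeight]
      congr 1
      ring
    simpa only [h2] using h1
  filter_upwards [hae] with y hy
  exact smul_right_injective 𝕜 (hwpos y).ne' hy

end

/-! ### Regularity in space and along dilations -/

lemma exp_neg_mul_sqrt_le {r : ℝ} (hr : 0 ≤ r) :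
    Real.exp (-r) * √r ≤ √(1 - Real.exp (-r) ^ 2) := by
  apply Real.le_sqrt_of_sq_le
  rw [mul_pow, Real.sq_sqrt hr]
  have h1 : Real.exp (-r) ^ 2 * Real.exp (2 * r) = 1 := by
    rw [← Real.exp_nat_mul, ← Real.exp_add, Real.exp_eq_one_iff]; push_cast; ring
  have h2 := Real.add_one_le_exp (2 * r)
  have h3 : 0 ≤ Real.exp (-r) ^ 2 := by positivity
  nlinarith

/-- Smoothing by the Mehler semigroup: for bounded `h` the function `T_r h` is Lipschitz with
constant `O(r^{-1/2})`, since moving `x` amounts to translating the Gauss measure. -/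
lemma exists_norm_ouSemigroup_sub_le (n : ℕ) (F : Type*) [NormedAddCommGroup F] [NormedSpace ℝ F] :
    ∃ C : ℝ, 0 < C ∧ ∀ (M : ℝ) (h : EuclideanSpace ℝ (Fin n) → F), StronglyMeasurable h →
      (∀ z, ‖h z‖ ≤ M) → ∀ r : ℝ, 0 < r → ∀ x y,
        ‖ouSemigroup r h x - ouSemigroup r h y‖ ≤ C * M * ‖x - y‖ * r ^ (-(1 / 2) : ℝ) := by
  obtain ⟨C, hC, H⟩ := exists_norm_integral_gaussMeasure_sub_translate_le n F
  refine ⟨C, hC, fun M h hh hM r hr x y => ?_⟩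
  have hM0 : 0 ≤ M := (norm_nonneg _).trans (hM 0)
  have hσ : 0 < √(1 - Real.exp (-r) ^ 2) := Real.sqrt_pos.2 (one_sub_exp_sq_pos hr)
  set σ := √(1 - Real.exp (-r) ^ 2) with hσd
  have hm : StronglyMeasurable fun z => h (ouFlow y (r, z)) :=
    hh.comp_measurable (by unfold ouFlow; fun_prop)
  have h1 := H ((Real.exp (-r) / σ) • (x - y)) M (fun z => h (ouFlow y (r, z))) hm fun z => hM _
  have h2 : ∀ z, ouFlow y (r, (Real.exp (-r) / σ) • (x - y) + z) = ouFlow x (r, z) := by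
    intro z
    simp only [ouFlow]
    rw [← hσd, smul_add, smul_smul, mul_div_cancel₀ _ hσ.ne', smul_sub]
    abel
  simp only [h2] at h1
  refine h1.trans ?_
  rw [norm_smul, Real.norm_of_nonneg (by positivity)]
  have h3 : Real.exp (-r) / σ ≤ r ^ (-(1 / 2) : ℝ) := by
    rw [Real.rpow_neg hr.le, ← Real.sqrt_eq_rpow, div_le_iff₀ hσ, ← div_eq_inv_mul,
      le_div_iff₀ (Real.sqrt_pos.2 hr)]
    exact exp_neg_mul_sqrt_le hr.le
  calc C * M * (Real.exp (-r) / σ * ‖x - y‖) ≤ C * M * (r ^ (-(1 / 2) : ℝ) * ‖x - y‖) := by gcongr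
    _ = _ := by ring

section

variable {𝕜 : Type*} [RCLike 𝕜] {g h : EuclideanSpace ℝ (Fin n) → 𝕜}

lemma integrableOn_levyDensity_smul {F : Type*} [NormedAddCommGroup F] [NormedSpace ℝ F] {t M : ℝ}
    (ht : 0 < t) {H : ℝ → F} (hH : StronglyMeasurable H) (hM : ∀ r, ‖H r‖ ≤ M) :
    IntegrableOn (fun r => levyDensity t r • H r) (Ioi 0) := by
  refine Integrable.mono' ((integrableOn_levyDensity ht).mul_const M)
    ((measurable_levyDensity t).stronglyMeasurable.smul hH).aestronglyMeasurable ?_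
  filter_upwards [self_mem_ae_restrict measurableSet_Ioi] with r hr
  rw [norm_smul, Real.norm_of_nonneg (levyDensity_nonneg ht.le hr)]
  exact mul_le_mul_of_nonneg_left (hM r) (levyDensity_nonneg ht.le hr)

/-- For bounded `h` the function `P_t h` is Lipschitz with constant `O(1 / t)`. -/
lemma exists_norm_poissonIntegral_sub_le (n : ℕ) (𝕜 : Type*) [RCLike 𝕜] :
    ∃ C : ℝ, 0 < C ∧ ∀ (M : ℝ) (h : EuclideanSpace ℝ (Fin n) → 𝕜), StronglyMeasurable h →
      (∀ z, ‖h z‖ ≤ M) → ∀ t : ℝ, 0 < t → ∀ x y,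
        ‖poissonIntegral t h x - poissonIntegral t h y‖ ≤ C * M * (‖x - y‖ / t) := by
  obtain ⟨C, hC, H⟩ := exists_norm_ouSemigroup_sub_le n 𝕜
  set c : ℝ := ∫ r in Ioi 0, levyDensity 1 r * r ^ (-(1 / 2) : ℝ) with hc
  have hc0 : 0 ≤ c := setIntegral_nonneg measurableSet_Ioi fun r hr =>
    mul_nonneg (levyDensity_nonneg zero_le_one hr) (Real.rpow_nonneg (le_of_lt hr) _)
  refine ⟨C * c + 1, by positivity, fun M h hh hM t ht x y => ?_⟩
  have hM0 : 0 ≤ M := (norm_nonneg _).trans (hM 0)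
  have hi : ∀ x, IntegrableOn (fun r => levyDensity t r • ouSemigroup r h x) (Ioi 0) := fun x =>
    integrableOn_levyDensity_smul ht (stronglyMeasurable_ouSemigroup hh x)
      fun r => norm_ouSemigroup_le hM r x
  rw [poissonIntegral_eq_integral_ouSemigroup ht hh.aestronglyMeasurable
      (integrable_poissonMeasure_of_bound hh hM ht x),
    poissonIntegral_eq_integral_ouSemigroup ht hh.aestronglyMeasurable
      (integrable_poissonMeasure_of_bound hh hM ht y), ← integral_sub (hi x) (hi y)]
  have hdom := ((integrableOn_levyDensity_mul_rpow ht
    (show (-(1 / 2) : ℝ) < 1 / 2 by norm_num)).mul_const (C * M * ‖x - y‖))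
  refine (norm_integral_le_of_norm_le hdom ?_).trans ?_
  · filter_upwards [self_mem_ae_restrict measurableSet_Ioi] with r hr
    have hl := levyDensity_nonneg ht.le hr
    rw [← smul_sub, norm_smul, Real.norm_of_nonneg hl]
    calc _ ≤ levyDensity t r * (C * M * ‖x - y‖ * r ^ (-(1 / 2) : ℝ)) :=
          mul_le_mul_of_nonneg_left (H M h hh hM r hr x y) hl
      _ = _ := by ring
  · rw [integral_mul_const, integral_levyDensity_mul_rpow ht, ← hc,
      show (2 * (-(1 / 2)) : ℝ) = -1 by norm_num, Real.rpow_neg_one]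
    calc t⁻¹ * c * (C * M * ‖x - y‖) = C * c * M * (‖x - y‖ / t) := by ring
      _ ≤ _ := by gcongr; linarith

lemma stronglyMeasurable_comp_ouFlow (hh : StronglyMeasurable h) (x : EuclideanSpace ℝ (Fin n))
    (s : ℝ) : StronglyMeasurable fun z => h (ouFlow x (s, z)) :=
  hh.comp_measurable (by unfold ouFlow; fun_prop)

lemma ouSemigroup_ouSemigroup (hh : StronglyMeasurable h) {M : ℝ} (hM : ∀ z, ‖h z‖ ≤ M) {r s : ℝ}
    (hr : 0 ≤ r) (hs : 0 ≤ s) (x : EuclideanSpace ℝ (Fin n)) :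
    ouSemigroup r (ouSemigroup s h) x = ouSemigroup (r + s) h x := by
  have hm : Measurable fun p : EuclideanSpace ℝ (Fin n) × EuclideanSpace ℝ (Fin n) =>
    ouFlow (ouFlow x (r, p.1)) (s, p.2) := by unfold ouFlow; fun_prop
  have hm' : Measurable fun z : EuclideanSpace ℝ (Fin n) => ouFlow x (r + s, z) := by
    unfold ouFlow; fun_prop
  have hi : Integrable (fun p : EuclideanSpace ℝ (Fin n) × EuclideanSpace ℝ (Fin n) =>
      h (ouFlow (ouFlow x (r, p.1)) (s, p.2))) ((gaussMeasure n).prod (gaussMeasure n)) :=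
    Integrable.of_bound (hh.comp_measurable hm).aestronglyMeasurable M
      (Eventually.of_forall fun p => hM _)
  have h1 : ouSemigroup r (ouSemigroup s h) x =
      ∫ p, h (ouFlow (ouFlow x (r, p.1)) (s, p.2)) ∂(gaussMeasure n).prod (gaussMeasure n) :=
    (integral_prod _ hi).symm
  rw [h1, ← integral_map (f := h) hm.aemeasurable hh.aestronglyMeasurable,
    map_ouFlow_ouFlow x hr hs, integral_map hm'.aemeasurable hh.aestronglyMeasurable]
  rfl

lemma ouSemigroup_poissonIntegral (hh : StronglyMeasurable h) {M : ℝ} (hM : ∀ z, ‖h z‖ ≤ M)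
    {t s : ℝ} (ht : 0 < t) (hs : 0 ≤ s) (x : EuclideanSpace ℝ (Fin n)) :
    ouSemigroup s (poissonIntegral t h) x =
      ∫ r in Ioi 0, levyDensity t r • ouSemigroup (r + s) h x := by
  have := isProbabilityMeasure_levyMeasure ht
  have h1 : ∀ z, poissonIntegral t h (ouFlow x (s, z)) =
      ∫ r, ouSemigroup r h (ouFlow x (s, z)) ∂levyMeasure t := fun z => by
    rw [poissonIntegral_eq_integral_ouSemigroup ht hh.aestronglyMeasurable
      (integrable_poissonMeasure_of_bound hh hM ht _), integral_levyMeasure ht.le]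
  have hmeas : StronglyMeasurable fun q : EuclideanSpace ℝ (Fin n) × ℝ =>
      ouSemigroup q.2 h (ouFlow x (s, q.1)) := by
    refine StronglyMeasurable.integral_prod_right
      (f := fun (q : EuclideanSpace ℝ (Fin n) × ℝ) z => h (ouFlow (ouFlow x (s, q.1)) (q.2, z))) ?_
    refine hh.comp_measurable ?_
    unfold ouFlow; fun_prop
  have hint : Integrable (Function.uncurry fun (z : EuclideanSpace ℝ (Fin n)) (r : ℝ) =>
      ouSemigroup r h (ouFlow x (s, z))) ((gaussMeasure n).prod (levyMeasure t)) :=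
    Integrable.of_bound hmeas.aestronglyMeasurable M
      (Eventually.of_forall fun q => norm_ouSemigroup_le hM _ _)
  rw [ouSemigroup]
  simp only [h1]
  rw [integral_integral_swap hint, ← integral_levyMeasure ht.le]
  refine integral_congr_ae ?_
  filter_upwards [ae_levyMeasure_pos t] with r hr
  rw [add_comm r s, ← ouSemigroup_ouSemigroup hh hM hs hr.le]
  rfl

/-- For bounded `h`, applying `T_s` to `P_t h` shifts the Lévy time by `s` and so changes the value
by `O(s / t²)`. -/
lemma exists_norm_poissonIntegral_sub_ouSemigroup_le (n : ℕ) (𝕜 : Type*) [RCLike 𝕜] :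
    ∃ C : ℝ, 0 < C ∧ ∀ (M : ℝ) (h : EuclideanSpace ℝ (Fin n) → 𝕜), StronglyMeasurable h →
      (∀ z, ‖h z‖ ≤ M) → ∀ t s : ℝ, 0 < t → 0 < s → ∀ x,
        ‖poissonIntegral t h x - ouSemigroup s (poissonIntegral t h) x‖ ≤ C * M * (s / t ^ 2) := by
  obtain ⟨C, hC, H⟩ := exists_norm_integral_levyDensity_smul_sub_shift_le 𝕜
  refine ⟨C, hC, fun M h hh hM t s ht hs x => ?_⟩
  have hm := stronglyMeasurable_ouSemigroup hh x
  rw [ouSemigroup_poissonIntegral hh hM ht hs.le,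
    poissonIntegral_eq_integral_ouSemigroup ht hh.aestronglyMeasurable
      (integrable_poissonMeasure_of_bound hh hM ht x),
    ← integral_sub (integrableOn_levyDensity_smul ht hm fun r => norm_ouSemigroup_le hM r x)
      (integrableOn_levyDensity_smul (H := fun r => ouSemigroup (r + s) h x) ht
        (hm.comp_measurable (by fun_prop)) fun r => norm_ouSemigroup_le hM _ x)]
  simp only [← smul_sub]
  exact H t s M ht hs _ hm fun r => norm_ouSemigroup_le hM r x

lemma poissonIntegral_sub_poissonIntegral_two_mul (hg : StronglyMeasurable g)
    (hG : GrowthCondition g) {t M : ℝ} (ht : 0 < t) (hM : ∀ y, ‖g y - poissonIntegral t g y‖ ≤ M)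
    (x : EuclideanSpace ℝ (Fin n)) :
    poissonIntegral t g x - poissonIntegral (2 * t) g x =
      poissonIntegral t (fun y => g y - poissonIntegral t g y) x := by
  have hgi := hG.integrable_poissonMeasure hg.aestronglyMeasurable ht x
  have hhm : StronglyMeasurable fun y => g y - poissonIntegral t g y :=
    hg.sub (stronglyMeasurable_poissonIntegral g hg)
  have hhi := integrable_poissonMeasure_of_bound hhm hM ht x
  have hPi : Integrable (poissonIntegral t g) (poissonMeasure t x) := by
    refine (hgi.sub hhi).congr (Eventually.of_forall fun y => ?_)
    simp
  rw [← poissonIntegral_poissonIntegral ht hg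
    (hG.integrable_poissonMeasure hg.aestronglyMeasurable (by positivity) x),
    poissonIntegral_eq_integral_poissonMeasure ht.le g,
    poissonIntegral_eq_integral_poissonMeasure ht.le (poissonIntegral t g),
    poissonIntegral_eq_integral_poissonMeasure ht.le, integral_sub hgi hPi]

lemma norm_poissonIntegral_sub_le_of_holder {L α : ℝ} (hα : 0 < α) (hL : 0 ≤ L)
    (hg : StronglyMeasurable g)
    (hG : GrowthCondition g) (h : ∀ x y, ‖g x - g y‖ ≤ L * ‖x - y‖ ^ α) {t : ℝ} (ht : 0 < t)
    (x y : EuclideanSpace ℝ (Fin n)) :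
    ‖poissonIntegral t g x - poissonIntegral t g y‖ ≤ L * ‖x - y‖ ^ α := by
  have := isProbabilityMeasure_levyMeasure ht
  have hi : ∀ x, Integrable (fun p => g (ouFlow x p)) ((levyMeasure t).prod (gaussMeasure n)) :=
    fun x => (integrable_comp_ouFlow_iff ht hg.aestronglyMeasurable x).2
      (hG.integrable_poissonMeasure hg.aestronglyMeasurable ht x)
  rw [poissonIntegral_eq_integral_ouFlow ht hg.aestronglyMeasurable,
    poissonIntegral_eq_integral_ouFlow ht hg.aestronglyMeasurable, ← integral_sub (hi x) (hi y)]
  have h3 : ∀ᵐ p ∂(levyMeasure t).prod (gaussMeasure n), 0 < p.1 :=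
    Measure.quasiMeasurePreserving_fst.ae (ae_levyMeasure_pos t)
  have h4 := norm_integral_le_of_norm_le_const (μ := (levyMeasure t).prod (gaussMeasure n))
    (f := fun p => g (ouFlow x p) - g (ouFlow y p)) (C := L * ‖x - y‖ ^ α) ?_
  · rwa [probReal_univ, mul_one] at h4
  · filter_upwards [h3] with p hp
    refine (h _ _).trans (mul_le_mul_of_nonneg_left ?_ hL)
    refine Real.rpow_le_rpow (norm_nonneg _) ?_ hα.le
    have h5 : ouFlow x p - ouFlow y p = Real.exp (-p.1) • (x - y) := by
      simp only [ouFlow, smul_sub]; abel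
    rw [h5, norm_smul, Real.norm_of_nonneg (Real.exp_pos _).le]
    exact mul_le_of_le_one_left (norm_nonneg _) (Real.exp_le_one_iff.2 (by linarith))

lemma rpow_le_one_add {a α : ℝ} (ha : 0 ≤ a) (hα0 : 0 ≤ α) (hα1 : α ≤ 1) : a ^ α ≤ 1 + a := by
  rcases le_total a 1 with h | h
  · linarith [Real.rpow_le_one ha h hα0]
  · linarith [Real.rpow_le_self_of_one_le h hα1]

lemma integrable_norm_ouFlow_sub_rpow {α : ℝ} (hα0 : 0 ≤ α) (hα1 : α ≤ 1)
    (x : EuclideanSpace ℝ (Fin n)) (s : ℝ) :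
    Integrable (fun z => ‖ouFlow x (s, z) - x‖ ^ α) (gaussMeasure n) := by
  refine Integrable.mono' (g := fun z => 1 + (‖Real.exp (-s) • x - x‖ +
      √(1 - Real.exp (-s) ^ 2) * ‖z‖))
    ((integrable_const _).add ((integrable_const _).add (integrable_norm_gaussMeasure.const_mul _)))
    (Measurable.aestronglyMeasurable (by unfold ouFlow; fun_prop)) (Eventually.of_forall fun z => ?_)
  rw [Real.norm_of_nonneg (by positivity)]
  refine (rpow_le_one_add (norm_nonneg _) hα0 hα1).trans ?_
  have h1 : ouFlow x (s, z) - x = (Real.exp (-s) • x - x) + √(1 - Real.exp (-s) ^ 2) • z := by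
    simp only [ouFlow]; abel
  have h2 := norm_add_le (Real.exp (-s) • x - x) (√(1 - Real.exp (-s) ^ 2) • z)
  rw [norm_smul √_, Real.norm_of_nonneg (Real.sqrt_nonneg _)] at h2
  rw [h1]
  linarith

lemma integrable_comp_ouFlow_of_holder {L α : ℝ} (hα0 : 0 ≤ α) (hα1 : α ≤ 1)
    (hg : StronglyMeasurable g) (h : ∀ x y, ‖g x - g y‖ ≤ L * ‖x - y‖ ^ α)
    (x : EuclideanSpace ℝ (Fin n)) (s : ℝ) :
    Integrable (fun z => g (ouFlow x (s, z))) (gaussMeasure n) := by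
  refine Integrable.mono' (g := fun z => ‖g x‖ + L * ‖ouFlow x (s, z) - x‖ ^ α)
    ((integrable_const _).add ((integrable_norm_ouFlow_sub_rpow hα0 hα1 x s).const_mul L))
    (stronglyMeasurable_comp_ouFlow hg x s).aestronglyMeasurable (Eventually.of_forall fun z => ?_)
  exact (norm_le_norm_add_norm_sub' _ (g x)).trans (by gcongr; exact h _ _)

lemma two_pow_mul_rpow (t β : ℝ) (ht : 0 < t) (k : ℕ) :
    ((2 : ℝ) ^ k * t) ^ β = t ^ β * ((2 : ℝ) ^ β) ^ k := by
  rw [Real.mul_rpow (by positivity) ht.le, mul_comm, ← Real.rpow_natCast, ← Real.rpow_natCast,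
    ← Real.rpow_mul zero_le_two, ← Real.rpow_mul zero_le_two, mul_comm β]

lemma tendsto_two_pow_mul_atTop {t : ℝ} (ht : 0 < t) :
    Tendsto (fun k : ℕ => (2 : ℝ) ^ k * t) atTop atTop :=
  (tendsto_pow_atTop_atTop_of_one_lt one_lt_two).atTop_mul_const ht

/-- Hölder continuity. The differences of `P_{2^k t} g` are Poisson integrals of the bounded
functions `g - P_{2^k t} g`, whose Lipschitz constants form a geometric series, and the differences
`P_{2^k t} g(x) - P_{2^k t} g(y)` tend to zero. -/
lemma exists_holder_of_norm_sub_poissonIntegral_le (n : ℕ) (𝕜 : Type*) [RCLike 𝕜] {α : ℝ}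
    (hα1 : α < 1) :
    ∃ C : ℝ, 0 < C ∧ ∀ (g : EuclideanSpace ℝ (Fin n) → 𝕜) (B : ℝ), 0 ≤ B →
      StronglyMeasurable g → GrowthCondition g →
      (∀ t : ℝ, 0 < t → ∀ x, ‖g x - poissonIntegral t g x‖ ≤ B * t ^ α) →
      ∀ x y, ‖g x - g y‖ ≤ C * B * ‖x - y‖ ^ α := by
  obtain ⟨C, hC, H⟩ := exists_norm_poissonIntegral_sub_le n 𝕜
  set ρ : ℝ := 2 ^ (α - 1) with hρ
  have hρ1 : ρ < 1 := Real.rpow_lt_one_of_one_lt_of_neg one_lt_two (by linarith)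
  have hρ2 : 0 < 1 - ρ := by linarith
  refine ⟨2 + C / (1 - ρ), by positivity, fun g B hB hg hG hb x y => ?_⟩
  rcases eq_or_ne x y with rfl | hxy
  · rw [sub_self, norm_zero]; positivity
  set t := ‖x - y‖ with htd
  have ht : 0 < t := norm_sub_pos_iff.2 hxy
  set τ : ℕ → ℝ := fun k => 2 ^ k * t with hτ
  have hτ0 : ∀ k, 0 < τ k := fun k => by simp only [hτ]; positivity
  have hstep : ∀ k, dist (poissonIntegral (τ k) g x - poissonIntegral (τ k) g y)
      (poissonIntegral (τ (k + 1)) g x - poissonIntegral (τ (k + 1)) g y) ≤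
        C * B * t ^ α * ρ ^ k := by
    intro k
    have h2 : τ (k + 1) = 2 * τ k := by simp only [hτ]; ring
    have h1 := H (B * τ k ^ α) (fun y => g y - poissonIntegral (τ k) g y)
      (hg.sub (stronglyMeasurable_poissonIntegral g hg)) (hb _ (hτ0 k)) (τ k) (hτ0 k) x y
    rw [← poissonIntegral_sub_poissonIntegral_two_mul hg hG (hτ0 k) (hb _ (hτ0 k)),
      ← poissonIntegral_sub_poissonIntegral_two_mul hg hG (hτ0 k) (hb _ (hτ0 k)), ← h2] at h1
    rw [dist_eq_norm, sub_sub_sub_comm]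
    refine h1.trans (le_of_eq ?_)
    have h3 : τ k ^ α / τ k = t ^ α / t * ρ ^ k := by
      have := two_pow_mul_rpow t (α - 1) ht k
      rw [Real.rpow_sub_one (hτ0 k).ne', Real.rpow_sub_one ht.ne'] at this
      exact this
    rw [← htd]
    calc C * (B * τ k ^ α) * (t / τ k) = C * B * t * (τ k ^ α / τ k) := by ring
      _ = _ := by rw [h3]; field_simp
  have hlim := (hG.tendsto_poissonIntegral_sub hg.aestronglyMeasurable x y).comp
    (tendsto_two_pow_mul_atTop ht)
  have h4 := dist_le_of_le_geometric_of_tendsto₀ ρ (C * B * t ^ α) hρ1 hstep hlim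
  rw [dist_zero_right] at h4
  have h5 : τ 0 = t := by simp [hτ]
  rw [h5] at h4
  have h6 := hb t ht x
  have h7 := hb t ht y
  rw [norm_sub_rev] at h7
  calc ‖g x - g y‖ = ‖(g x - poissonIntegral t g x) +
        (poissonIntegral t g x - poissonIntegral t g y) + (poissonIntegral t g y - g y)‖ := by
        congr 1; abel
    _ ≤ _ := norm_add₃_le
    _ ≤ B * t ^ α + C * B * t ^ α / (1 - ρ) + B * t ^ α := by gcongr
    _ = _ := by ring

lemma norm_ouSemigroup_sub_exp_smul_le {L α : ℝ} (hα0 : 0 < α) (hα1 : α < 1) (hL : 0 ≤ L)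
    (hg : StronglyMeasurable g) (h : ∀ x y, ‖g x - g y‖ ≤ L * ‖x - y‖ ^ α) {s : ℝ} (hs : 0 ≤ s)
    (x : EuclideanSpace ℝ (Fin n)) :
    ‖ouSemigroup s g x - g (Real.exp (-s) • x)‖ ≤
      L * (2 * ∫ z : EuclideanSpace ℝ (Fin n), ‖z‖ ^ α ∂gaussMeasure n) * s ^ (α / 2) := by
  have h1 : ouSemigroup s g x - g (Real.exp (-s) • x) =
      ∫ z, (g (ouFlow x (s, z)) - g (Real.exp (-s) • x)) ∂gaussMeasure n := by
    rw [integral_sub (integrable_comp_ouFlow_of_holder hα0.le hα1.le hg h x s) (integrable_const _),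
      integral_const, probReal_univ, one_smul]
    rfl
  rw [h1]
  refine (norm_integral_le_of_norm_le ((integrable_norm_rpow_gaussMeasure hα0.le hα1.le).const_mul
    (L * 2 * s ^ (α / 2))) (Eventually.of_forall fun z => ?_)).trans (le_of_eq ?_)
  · refine (h _ _).trans ?_
    have h2 : ouFlow x (s, z) - Real.exp (-s) • x = √(1 - Real.exp (-s) ^ 2) • z := by
      simp only [ouFlow]; abel
    rw [h2]
    calc _ ≤ L * (2 * s ^ (α / 2) * ‖z‖ ^ α) :=
          mul_le_mul_of_nonneg_left (norm_sqrt_smul_rpow_le hα0 hα1 hs z) hL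
      _ = _ := by ring
  · rw [integral_const_mul]; ring

/-- Regularity along dilations. As for Hölder continuity, with the increments `P_t g - T_s P_t g`
of the Poisson integral along the Mehler semigroup in place of the increments in space. -/
lemma exists_norm_sub_exp_smul_le (n : ℕ) (𝕜 : Type*) [RCLike 𝕜] {α : ℝ}
    (hα0 : 0 < α) (hα1 : α < 1) :
    ∃ C : ℝ, 0 < C ∧ ∀ (g : EuclideanSpace ℝ (Fin n) → 𝕜) (B : ℝ), 0 ≤ B →
      StronglyMeasurable g → GrowthCondition g →
      (∀ t : ℝ, 0 < t → ∀ x, ‖g x - poissonIntegral t g x‖ ≤ B * t ^ α) →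
      ∀ x s, 0 ≤ s → ‖g x - g (Real.exp (-s) • x)‖ ≤ C * B * s ^ (α / 2) := by
  obtain ⟨C₀, hC₀, H₀⟩ := exists_holder_of_norm_sub_poissonIntegral_le n 𝕜 hα1
  obtain ⟨C, hC, H⟩ := exists_norm_poissonIntegral_sub_ouSemigroup_le n 𝕜
  set m : ℝ := ∫ z : EuclideanSpace ℝ (Fin n), ‖z‖ ^ α ∂gaussMeasure n with hm
  have hm0 : 0 ≤ m := integral_nonneg fun z => by positivity
  set ρ : ℝ := 2 ^ (α - 2) with hρ
  have hρ1 : ρ < 1 := Real.rpow_lt_one_of_one_lt_of_neg one_lt_two (by linarith)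
  have hρ2 : 0 < 1 - ρ := by linarith
  refine ⟨2 + C / (1 - ρ) + C₀ * (2 * m), by positivity, fun g B hB hg hG hb x s hs => ?_⟩
  rcases hs.eq_or_lt with rfl | hs
  · simp only [neg_zero, Real.exp_zero, one_smul, sub_self, norm_zero]; positivity
  have hhol := H₀ g B hB hg hG hb
  have hL : 0 ≤ C₀ * B := by positivity
  -- the scale at which `g - P_t g = O(t^α)` balances the bound `s / t²` for the increments
  set t := √s with htd
  have ht : 0 < t := Real.sqrt_pos.2 hs
  have hts : t ^ 2 = s := Real.sq_sqrt hs.le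
  have htα : t ^ α = s ^ (α / 2) := by
    rw [htd, Real.sqrt_eq_rpow, ← Real.rpow_mul hs.le]; congr 1; ring
  set τ : ℕ → ℝ := fun k => 2 ^ k * t with hτ
  have hτ0 : ∀ k, 0 < τ k := fun k => by simp only [hτ]; positivity
  have hPm : ∀ r, StronglyMeasurable (poissonIntegral r g) := fun r =>
    stronglyMeasurable_poissonIntegral g hg
  have hPhol : ∀ r : ℝ, 0 < r → ∀ x y,
      ‖poissonIntegral r g x - poissonIntegral r g y‖ ≤ C₀ * B * ‖x - y‖ ^ α := fun r hr =>
    norm_poissonIntegral_sub_le_of_holder hα0 hL hg hG hhol hr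
  have hPi : ∀ r : ℝ, 0 < r →
      Integrable (fun z => poissonIntegral r g (ouFlow x (s, z))) (gaussMeasure n) := fun r hr =>
    integrable_comp_ouFlow_of_holder hα0.le hα1.le (hPm r) (hPhol r hr) x s
  have hgi := integrable_comp_ouFlow_of_holder hα0.le hα1.le hg hhol x s
  have hstep : ∀ k, dist (poissonIntegral (τ k) g x - ouSemigroup s (poissonIntegral (τ k) g) x)
      (poissonIntegral (τ (k + 1)) g x - ouSemigroup s (poissonIntegral (τ (k + 1)) g) x) ≤
        C * B * t ^ α * ρ ^ k := by
    intro k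
    have h2 : τ (k + 1) = 2 * τ k := by simp only [hτ]; ring
    have h1 := H (B * τ k ^ α) (fun y => g y - poissonIntegral (τ k) g y)
      (hg.sub (hPm _)) (hb _ (hτ0 k)) (τ k) s (hτ0 k) hs x
    have h4 : poissonIntegral (τ k) (fun y => g y - poissonIntegral (τ k) g y) =
        fun x => poissonIntegral (τ k) g x - poissonIntegral (τ (k + 1)) g x := by
      ext x
      rw [h2, poissonIntegral_sub_poissonIntegral_two_mul hg hG (hτ0 k) (hb _ (hτ0 k))]
    have h5 : ouSemigroup s (fun x => poissonIntegral (τ k) g x - poissonIntegral (τ (k + 1)) g x) x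
        = ouSemigroup s (poissonIntegral (τ k) g) x -
          ouSemigroup s (poissonIntegral (τ (k + 1)) g) x :=
      integral_sub (hPi _ (hτ0 k)) (hPi _ (hτ0 (k + 1)))
    rw [h4, h5] at h1
    rw [dist_eq_norm, sub_sub_sub_comm]
    refine h1.trans (le_of_eq ?_)
    have h3 : τ k ^ α / τ k ^ 2 = t ^ α / t ^ 2 * ρ ^ k := by
      have := two_pow_mul_rpow t (α - 2) ht k
      rw [Real.rpow_sub (hτ0 k), Real.rpow_sub ht, Real.rpow_two, Real.rpow_two] at this
      exact this
    calc C * (B * τ k ^ α) * (s / τ k ^ 2) = C * B * s * (τ k ^ α / τ k ^ 2) := by ring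
      _ = _ := by rw [h3, ← hts]; field_simp
  have hlim : Tendsto (fun k => poissonIntegral (τ k) g x -
      ouSemigroup s (poissonIntegral (τ k) g) x) atTop (𝓝 0) := by
    have h1 : ∀ k, poissonIntegral (τ k) g x - ouSemigroup s (poissonIntegral (τ k) g) x =
        ∫ z, (poissonIntegral (τ k) g x - poissonIntegral (τ k) g (ouFlow x (s, z)))
          ∂gaussMeasure n := fun k => by
      rw [integral_sub (integrable_const _) (hPi _ (hτ0 k)), integral_const, probReal_univ,
        one_smul]
      rfl
    simp only [h1]
    have h2 : Tendsto (fun k => ∫ z, (poissonIntegral (τ k) g x -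
        poissonIntegral (τ k) g (ouFlow x (s, z))) ∂gaussMeasure n) atTop
        (𝓝 (∫ _, (0 : 𝕜) ∂gaussMeasure n)) := by
      refine tendsto_integral_of_dominated_convergence
        (fun z => C₀ * B * ‖ouFlow x (s, z) - x‖ ^ α) (fun k => ?_)
        ((integrable_norm_ouFlow_sub_rpow hα0.le hα1.le x s).const_mul _)
        (fun k => Eventually.of_forall fun z => ?_) (Eventually.of_forall fun z => ?_)
      · exact (integrable_const _).aestronglyMeasurable.sub (hPi _ (hτ0 k)).aestronglyMeasurable
      · rw [norm_sub_rev]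
        exact hPhol _ (hτ0 k) _ _
      · exact (hG.tendsto_poissonIntegral_sub hg.aestronglyMeasurable x _).comp
          (tendsto_two_pow_mul_atTop ht)
    rwa [integral_zero] at h2
  have h4 := dist_le_of_le_geometric_of_tendsto₀ ρ (C * B * t ^ α) hρ1 hstep hlim
  rw [dist_zero_right] at h4
  have h5 : τ 0 = t := by simp [hτ]
  rw [h5] at h4
  have h6 := hb t ht x
  have h7 : ‖ouSemigroup s (poissonIntegral t g) x - ouSemigroup s g x‖ ≤ B * t ^ α := by
    have h8 : ouSemigroup s g x - ouSemigroup s (poissonIntegral t g) x =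
        ouSemigroup s (fun y => g y - poissonIntegral t g y) x := (integral_sub hgi (hPi t ht)).symm
    rw [norm_sub_rev, h8]
    exact norm_ouSemigroup_le (hb t ht) s x
  have h9 := norm_ouSemigroup_sub_exp_smul_le hα0 hα1 hL hg hhol hs.le x
  rw [← hm] at h9
  calc ‖g x - g (Real.exp (-s) • x)‖ = ‖(g x - poissonIntegral t g x) +
        (poissonIntegral t g x - ouSemigroup s (poissonIntegral t g) x) +
        (ouSemigroup s (poissonIntegral t g) x - ouSemigroup s g x) +
        (ouSemigroup s g x - g (Real.exp (-s) • x))‖ := by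
        congr 1; abel
    _ ≤ _ := norm_add₄_le
    _ ≤ B * t ^ α + C * B * t ^ α / (1 - ρ) + B * t ^ α +
        C₀ * B * (2 * m) * s ^ (α / 2) := by gcongr
    _ = _ := by rw [htα]; ring

end

/-! ### The pointwise condition -/

/-- In dimension one every vector is already a multiple of `x ≠ 0`, so the projection formula holds
there, too. -/
lemma parallelPart_eq_smul {x : EuclideanSpace ℝ (Fin n)} (hx : x ≠ 0)
    (y : EuclideanSpace ℝ (Fin n)) : parallelPart x y = (inner ℝ x y / ‖x‖ ^ 2) • x := by
  rw [parallelPart]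
  split_ifs with h
  · have hn := h.resolve_left hx
    obtain ⟨c, hc⟩ := exists_smul_eq_of_finrank_eq_one
      (show Module.finrank ℝ (EuclideanSpace ℝ (Fin n)) = 1 by rw [finrank_euclideanSpace_fin, hn])
      hx y
    have hx' : ‖x‖ ≠ 0 := norm_ne_zero_iff.2 hx
    rw [← hc, real_inner_smul_right, real_inner_self_eq_norm_sq]
    congr 1
    field_simp
  · rfl

lemma rpow_half_le_two_mul {α d s : ℝ} (hα0 : 0 < α) (hα1 : α < 1) (hs : 0 ≤ s) (hsd : s ≤ 2 * d) :
    s ^ (α / 2) ≤ 2 * d ^ (α / 2) := by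
  have hd : 0 ≤ d := by linarith
  calc s ^ (α / 2) ≤ (2 * d) ^ (α / 2) := Real.rpow_le_rpow hs hsd (by positivity)
    _ = 2 ^ (α / 2) * d ^ (α / 2) := Real.mul_rpow zero_le_two hd
    _ ≤ 2 * d ^ (α / 2) := by
        gcongr
        exact Real.rpow_le_self_of_one_le one_le_two (by linarith)

section

variable {F : Type*} [NormedAddCommGroup F] {g : EuclideanSpace ℝ (Fin n) → F} {α L : ℝ}

/-- Away from the unit ball `d` is comparable to the time that the dilation flow takes between two
points of a ray, and in the unit ball to the distance. -/
lemma norm_sub_le_on_ray_of_le (hα0 : 0 < α) (hα1 : α < 1) (hL : 0 ≤ L)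
    (hhol : ∀ x y, ‖g x - g y‖ ≤ L * ‖x - y‖ ^ α)
    (hrad : ∀ x s, 0 ≤ s → ‖g x - g (Real.exp (-s) • x)‖ ≤ L * s ^ (α / 2))
    {e : EuclideanSpace ℝ (Fin n)} (he : ‖e‖ = 1) {a b : ℝ} (ha : 0 ≤ a) (hab : a ≤ b) :
    ‖g (b • e) - g (a • e)‖ ≤ 4 * L * (Real.log (1 + b) - Real.log (1 + a)) ^ (α / 2) := by
  have hout : ∀ a b : ℝ, 1 ≤ a → a ≤ b → ‖g (b • e) - g (a • e)‖ ≤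
      2 * L * (Real.log (1 + b) - Real.log (1 + a)) ^ (α / 2) := by
    intro a b ha hab
    have ha0 : 0 < a := by linarith
    have hb0 : 0 < b := by linarith
    have hs : 0 ≤ Real.log b - Real.log a := sub_nonneg.2 (Real.log_le_log ha0 hab)
    have h1 := hrad (b • e) _ hs
    rw [neg_sub, Real.exp_sub, Real.exp_log ha0, Real.exp_log hb0, smul_smul,
      div_mul_cancel₀ _ hb0.ne'] at h1
    have h2 : Real.log b - Real.log a ≤ 2 * (Real.log (1 + b) - Real.log (1 + a)) := by
      have h3 : Real.log (b * (1 + a) ^ 2) ≤ Real.log (a * (1 + b) ^ 2) := by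
        refine Real.log_le_log (by positivity) ?_
        have h4 : 1 ≤ a * b := one_le_mul_of_one_le_of_one_le ha (ha.trans hab)
        nlinarith [mul_nonneg (sub_nonneg.2 hab) (sub_nonneg.2 h4)]
      rw [Real.log_mul (by positivity) (by positivity), Real.log_mul (by positivity) (by positivity),
        Real.log_pow, Real.log_pow] at h3
      push_cast at h3
      linarith
    calc _ ≤ L * (Real.log b - Real.log a) ^ (α / 2) := h1
      _ ≤ L * (2 * (Real.log (1 + b) - Real.log (1 + a)) ^ (α / 2)) :=
        mul_le_mul_of_nonneg_left (rpow_half_le_two_mul hα0 hα1 hs h2) hL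
      _ = _ := by ring
  have hin : ∀ a b : ℝ, 0 ≤ a → a ≤ b → b ≤ 1 → ‖g (b • e) - g (a • e)‖ ≤
      2 * L * (Real.log (1 + b) - Real.log (1 + a)) ^ (α / 2) := by
    intro a b ha hab hb
    have hba : 0 ≤ b - a := sub_nonneg.2 hab
    have h1 := hhol (b • e) (a • e)
    rw [← sub_smul, norm_smul, he, mul_one, Real.norm_of_nonneg hba] at h1
    have hb1 : 0 < 1 + b := by linarith
    have ha1 : 0 < 1 + a := by linarith
    have h2 : b - a ≤ 2 * (Real.log (1 + b) - Real.log (1 + a)) := by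
      have h3 := Real.one_sub_inv_le_log_of_pos (div_pos hb1 ha1)
      rw [Real.log_div hb1.ne' ha1.ne', inv_div] at h3
      have h4 : (b - a) / 2 ≤ 1 - (1 + a) / (1 + b) := by
        rw [one_sub_div hb1.ne', div_le_div_iff₀ two_pos hb1]
        nlinarith
      linarith
    have h5 : (b - a) ^ α ≤ (b - a) ^ (α / 2) :=
      Real.rpow_le_rpow_of_exponent_ge_of_imp hba (by linarith) (by linarith)
        fun _ h => absurd h (by positivity)
    calc _ ≤ L * (b - a) ^ α := h1
      _ ≤ L * (2 * (Real.log (1 + b) - Real.log (1 + a)) ^ (α / 2)) :=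
        mul_le_mul_of_nonneg_left (h5.trans (rpow_half_le_two_mul hα0 hα1 hba h2)) hL
      _ = _ := by ring
  have hd : 0 ≤ Real.log (1 + b) - Real.log (1 + a) :=
    sub_nonneg.2 (Real.log_le_log (by linarith) (by linarith))
  have hd' := Real.rpow_nonneg hd (α / 2)
  have hdL := mul_nonneg hL hd'
  rcases le_total 1 a with h | h
  · linarith [hout a b h hab]
  rcases le_total b 1 with h' | h'
  · linarith [hin a b ha hab h']
  have h1 := hout 1 b le_rfl h'
  have h2 := hin a 1 ha h le_rfl
  have hl1 : Real.log (1 + a) ≤ Real.log (1 + 1) := Real.log_le_log (by linarith) (by linarith)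
  have hl2 : Real.log (1 + 1) ≤ Real.log (1 + b) := Real.log_le_log (by linarith) (by linarith)
  have h3 : (Real.log (1 + b) - Real.log (1 + 1)) ^ (α / 2) ≤
      (Real.log (1 + b) - Real.log (1 + a)) ^ (α / 2) :=
    Real.rpow_le_rpow (by linarith) (by linarith) (by positivity)
  have h4 : (Real.log (1 + 1) - Real.log (1 + a)) ^ (α / 2) ≤
      (Real.log (1 + b) - Real.log (1 + a)) ^ (α / 2) :=
    Real.rpow_le_rpow (by linarith) (by linarith) (by positivity)
  have h5 := mul_le_mul_of_nonneg_left h3 hL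
  have h6 := mul_le_mul_of_nonneg_left h4 hL
  linarith [norm_sub_le_norm_sub_add_norm_sub (g (b • e)) (g ((1 : ℝ) • e)) (g (a • e))]

lemma norm_sub_le_on_ray (hα0 : 0 < α) (hα1 : α < 1) (hL : 0 ≤ L)
    (hhol : ∀ x y, ‖g x - g y‖ ≤ L * ‖x - y‖ ^ α)
    (hrad : ∀ x s, 0 ≤ s → ‖g x - g (Real.exp (-s) • x)‖ ≤ L * s ^ (α / 2))
    {e : EuclideanSpace ℝ (Fin n)} (he : ‖e‖ = 1) {a b : ℝ} (ha : 0 ≤ a) (hb : 0 ≤ b) :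
    ‖g (a • e) - g (b • e)‖ ≤ 4 * L * |Real.log (1 + a) - Real.log (1 + b)| ^ (α / 2) := by
  rcases le_total a b with h | h
  · rw [norm_sub_rev, abs_sub_comm, abs_of_nonneg
      (sub_nonneg.2 (Real.log_le_log (by linarith) (by linarith)))]
    exact norm_sub_le_on_ray_of_le hα0 hα1 hL hhol hrad he ha h
  · rw [abs_of_nonneg (sub_nonneg.2 (Real.log_le_log (by linarith) (by linarith)))]
    exact norm_sub_le_on_ray_of_le hα0 hα1 hL hhol hrad he hb h

/-- Points on opposite rays are joined through the origin. -/
lemma norm_sub_le_on_line (hα0 : 0 < α) (hα1 : α < 1) (hL : 0 ≤ L)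
    (hhol : ∀ x y, ‖g x - g y‖ ≤ L * ‖x - y‖ ^ α)
    (hrad : ∀ x s, 0 ≤ s → ‖g x - g (Real.exp (-s) • x)‖ ≤ L * s ^ (α / 2))
    {e : EuclideanSpace ℝ (Fin n)} (he : ‖e‖ = 1) {a : ℝ} (ha : 0 ≤ a) (b : ℝ) :
    ‖g (a • e) - g (b • e)‖ ≤
      8 * L * |Real.log (1 + a) - sgn b * Real.log (1 + |b|)| ^ (α / 2) := by
  rcases le_or_gt 0 b with hb | hb
  · rw [sgn, if_pos hb, one_mul, abs_of_nonneg hb]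
    refine (norm_sub_le_on_ray hα0 hα1 hL hhol hrad he ha hb).trans ?_
    gcongr
    norm_num
  · have hb' : 0 ≤ -b := by linarith
    have hla : 0 ≤ Real.log (1 + a) := Real.log_nonneg (by linarith)
    have hlb : 0 ≤ Real.log (1 + -b) := Real.log_nonneg (by linarith)
    have h1 := norm_sub_le_on_ray hα0 hα1 hL hhol hrad he ha le_rfl
    have h2 := norm_sub_le_on_ray hα0 hα1 hL hhol hrad (e := -e) (by rwa [norm_neg]) le_rfl hb'
    rw [neg_smul_neg, zero_smul, add_zero, Real.log_one, zero_sub, abs_neg, abs_of_nonneg hlb] at h2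
    rw [zero_smul, add_zero, Real.log_one, sub_zero, abs_of_nonneg hla] at h1
    rw [sgn, if_neg hb.not_ge, abs_of_neg hb, neg_one_mul, sub_neg_eq_add,
      abs_of_nonneg (add_nonneg hla hlb)]
    have h3 : Real.log (1 + a) ^ (α / 2) ≤ (Real.log (1 + a) + Real.log (1 + -b)) ^ (α / 2) :=
      Real.rpow_le_rpow hla (by linarith) (by positivity)
    have h4 : Real.log (1 + -b) ^ (α / 2) ≤ (Real.log (1 + a) + Real.log (1 + -b)) ^ (α / 2) :=
      Real.rpow_le_rpow hlb (by linarith) (by positivity)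
    have h5 := mul_le_mul_of_nonneg_left h3 hL
    have h6 := mul_le_mul_of_nonneg_left h4 hL
    linarith [norm_sub_le_norm_sub_add_norm_sub (g (a • e)) (g 0) (g (b • e))]

lemma sgn_div_of_pos (a : ℝ) {c : ℝ} (hc : 0 < c) : sgn (a / c) = sgn a := by
  simp only [sgn, le_div_iff₀ hc, zero_mul]

lemma norm_sub_parallelPart_le (hα0 : 0 < α) (hα1 : α < 1) (hL : 0 ≤ L)
    (hhol : ∀ x y, ‖g x - g y‖ ≤ L * ‖x - y‖ ^ α)
    (hrad : ∀ x s, 0 ≤ s → ‖g x - g (Real.exp (-s) • x)‖ ≤ L * s ^ (α / 2))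
    (x y : EuclideanSpace ℝ (Fin n)) :
    ‖g x - g (parallelPart x y)‖ ≤ 8 * L * logDist x y ^ (α / 2) := by
  have hunit : ∀ v : EuclideanSpace ℝ (Fin n), v ≠ 0 → ‖‖v‖⁻¹ • v‖ = 1 := fun v hv =>
    norm_smul_inv_norm (𝕜 := ℝ) hv
  rcases eq_or_ne x 0 with rfl | hx
  · have hp : parallelPart 0 y = y := by simp [parallelPart]
    rcases eq_or_ne y 0 with rfl | hy
    · rw [hp, sub_self, norm_zero]
      have := Real.rpow_nonneg (logDist_nonneg (0 : EuclideanSpace ℝ (Fin n)) 0) (α / 2)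
      positivity
    have h1 := norm_sub_le_on_line hα0 hα1 hL hhol hrad (hunit y hy) le_rfl ‖y‖
    rw [zero_smul, smul_inv_smul₀ (norm_ne_zero_iff.2 hy), sgn, if_pos (norm_nonneg y)] at h1
    rw [logDist, hp, inner_zero_left, sgn, if_pos le_rfl, norm_zero]
    rwa [abs_of_nonneg (norm_nonneg y)] at h1
  · have hx' : 0 < ‖x‖ := norm_pos_iff.2 hx
    have h1 := norm_sub_le_on_line hα0 hα1 hL hhol hrad (hunit x hx) hx'.le (inner ℝ x y / ‖x‖)
    have h2 : (inner ℝ x y / ‖x‖) • ‖x‖⁻¹ • x = parallelPart x y := by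
      rw [parallelPart_eq_smul hx, smul_smul]
      congr 1
      field_simp
    have h3 : ‖parallelPart x y‖ = |inner ℝ x y / ‖x‖| := by
      rw [← h2, norm_smul, hunit x hx, mul_one, Real.norm_eq_abs]
    rw [smul_inv_smul₀ hx'.ne', h2, sgn_div_of_pos _ hx', ← h3] at h1
    exact h1

end

section

variable {𝕜 : Type*} [RCLike 𝕜]

lemma pointwiseLip_of_holder {g : EuclideanSpace ℝ (Fin n) → 𝕜} {α L : ℝ} (hα0 : 0 < α)
    (hα1 : α < 1) (hL : 0 ≤ L)
    (hhol : ∀ x y, ‖g x - g y‖ ≤ L * ‖x - y‖ ^ α)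
    (hrad : ∀ x s, 0 ≤ s → ‖g x - g (Real.exp (-s) • x)‖ ≤ L * s ^ (α / 2)) :
    PointwiseLip α g (8 * L) := by
  intro x y
  rw [mul_min_of_nonneg _ _ (by positivity)]
  refine le_min ?_ ?_
  · have h1 : 0 ≤ L * ‖x - y‖ ^ α := by positivity
    linarith [hhol x y]
  · have h1 := norm_sub_parallelPart_le hα0 hα1 hL hhol hrad x y
    have h2 := hhol (parallelPart x y) y
    rw [norm_sub_rev (parallelPart x y), ← orthogonalPart] at h2
    have h3 : 0 ≤ L * ‖orthogonalPart x y‖ ^ α := by positivity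
    linarith [norm_sub_le_norm_sub_add_norm_sub (g x) (g (parallelPart x y)) (g y)]

lemma GrowthCondition.congr {f g : EuclideanSpace ℝ (Fin n) → 𝕜} (hf : GrowthCondition f)
    (h : g =ᵐ[volume] f) : GrowthCondition g := by
  refine Integrable.congr hf ?_
  filter_upwards [h] with y hy
  rw [hy]

/-- The pointwise condition holds for the boundary function `g`, which agrees with `f` almost
everywhere and therefore has the same Poisson integral. -/
theorem exists_aePointwiseLip_of_poissonLipBound (n : ℕ) (𝕜 : Type*) [RCLike 𝕜] {α : ℝ}
    (hα0 : 0 < α) (hα1 : α < 1) :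
    ∃ C : ℝ, 0 < C ∧ ∀ (f : EuclideanSpace ℝ (Fin n) → 𝕜) (A : ℝ), 0 ≤ A →
      AEStronglyMeasurable f volume → GrowthCondition f → PoissonLipBound α f A →
      AEPointwiseLip α f (C * A) := by
  obtain ⟨C₁, hC₁, H₁⟩ := exists_holder_of_norm_sub_poissonIntegral_le n 𝕜 hα1
  obtain ⟨C₂, hC₂, H₂⟩ := exists_norm_sub_exp_smul_le n 𝕜 hα0 hα1
  refine ⟨8 * ((C₁ + C₂) / α), by positivity, fun f A hA hm hf h => ?_⟩
  obtain ⟨g, hgc, hgf⟩ := exists_continuous_norm_sub_poissonIntegral_le hα0 hA hf hm h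
  have hB : 0 ≤ A / α := by positivity
  have hmk := hm.ae_eq_mk.symm
  have hae : g =ᵐ[volume] f :=
    ((hf.congr hmk).ae_eq_of_norm_sub_poissonIntegral_le hm.stronglyMeasurable_mk hα0 hB hgc
      fun t ht x => by rw [poissonIntegral_congr_ae hmk]; exact hgf t ht x).trans hmk
  have hgg : ∀ t : ℝ, 0 < t → ∀ x, ‖g x - poissonIntegral t g x‖ ≤ A / α * t ^ α := fun t ht x => by
    rw [poissonIntegral_congr_ae hae]; exact hgf t ht x
  have hgm := hgc.stronglyMeasurable
  have hG := hf.congr hae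
  refine ⟨g, hae, ?_⟩
  have h1 := H₁ g _ hB hgm hG hgg
  have h2 := H₂ g _ hB hgm hG hgg
  have hL : 8 * ((C₁ + C₂) / α) * A = 8 * ((C₁ + C₂) * (A / α)) := by ring
  rw [hL]
  refine pointwiseLip_of_holder hα0 hα1 (by positivity) (fun x y => (h1 x y).trans ?_)
    fun x s hs => (h2 x s hs).trans ?_
  · gcongr; linarith
  · gcongr; linarith

end

end GaussLip

end

theorem theorem1p2 {𝕜 : Type*} [RCLike 𝕜] (n : ℕ) (hn : 1 ≤ n)
    (α : ℝ) (hα0 : 0 < α) (hα1 : α < 1) :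
    (∀ f : EuclideanSpace ℝ (Fin n) → 𝕜, AEStronglyMeasurable f volume →
      (GaussLip.MemGGLip α f ↔ ∃ K : ℝ, 0 < K ∧ GaussLip.AEPointwiseLip α f K)) ∧
    ∃ C : ℝ, 0 < C ∧
      ∀ f : EuclideanSpace ℝ (Fin n) → 𝕜, AEStronglyMeasurable f volume →
        GaussLip.MemGGLip α f →
          GaussLip.ggLipNorm α f ≤ C * GaussLip.pointwiseLipConst α f ∧
          GaussLip.pointwiseLipConst α f ≤ C * GaussLip.ggLipNorm α f := by
  obtain ⟨C₁, hC₁, H₁⟩ := GaussLip.exists_poissonLipBound_of_aePointwiseLip n 𝕜 hα0 hα1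
  obtain ⟨C₂, hC₂, H₂⟩ := GaussLip.exists_aePointwiseLip_of_poissonLipBound n 𝕜 hα0 hα1
  refine ⟨fun f hm => ⟨fun ⟨hf, A, hA, h⟩ => ⟨C₂ * A, by positivity, H₂ f A hA.le hm hf h⟩,
    fun ⟨K, hK, h⟩ => ⟨GaussLip.growthCondition_of_aePointwiseLip hα0 hα1 hK.le h, C₁ * K,
      by positivity, H₁ f K hK.le h⟩⟩, C₁ + C₂, by positivity, fun f hm ⟨hf, A, hA, h⟩ => ⟨?_, ?_⟩⟩
  · rw [← div_le_iff₀' (by positivity)]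
    refine le_csInf ⟨C₂ * A, by positivity, H₂ f A hA.le hm hf h⟩ fun K ⟨hK, hfK⟩ => ?_
    rw [div_le_iff₀' (by positivity)]
    calc GaussLip.ggLipNorm α f ≤ C₁ * K :=
          csInf_le ⟨0, fun _ hx => hx.1.le⟩ ⟨by positivity, H₁ f K hK.le hfK⟩
      _ ≤ (C₁ + C₂) * K := by gcongr; linarith
  · rw [← div_le_iff₀' (by positivity)]
    refine le_csInf ⟨A, hA, h⟩ fun A' ⟨hA', hfA'⟩ => ?_
    rw [div_le_iff₀' (by positivity)]
    calc GaussLip.pointwiseLipConst α f ≤ C₂ * A' :=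
          csInf_le ⟨0, fun _ hx => hx.1.le⟩ ⟨by positivity, H₂ f A' hA'.le hm hf hfA'⟩
      _ ≤ (C₁ + C₂) * A' := by gcongr; linarith
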